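/- Consider the Korteweg--de Vries equation $\partial_t q=-q'''+6qq'$ on $\mathbb R$, where primes denote derivatives in $x$. A *Schwartz solution* is a continuous curve $\mathbb R\ni t\mapsto q(t)\in\mathcal S(\mathbb R;\mathbb R)$ satisfying the equation at all $(t,x)\in\mathbb R^2$. Write $$\|f\|_{H^{-1}}^2=\int_{\mathbb R}\frac{|\hat f(\xi)|^2}{4+\xi^2}\,d\xi,\qquad \hat f(\xi)=\tfrac1{\sqrt{2\pi}}\int_{\mathbb R} e^{-i\xi x}f(x)\,dx .$$ For $\kappa\ge1$ and $q\in\mathcal S(\mathbb R;\mathbb R)$, let $L=-\partial_x^2+q$ be the operator on $L^2(\mathbb R)$ associated to the quadratic form $\psi\mapsto\int|\psi'|^2+q|\psi|^2\,dx$ with form domain $H^1(\mathbb R)$, and let $G(x,y;\kappa,q)$ denote the continuous integral kernel of $(L+\kappa^2)^{-1}$, whenever it exists. Put $$g(x;\kappa,q)=G(x,x;\kappa,q),\qquad \rho(x;\kappa,q)=\kappa-\frac1{2g(x;\kappa,q)}+\frac12\int_{\mathbb R} e^{-2\kappa|x-y|}q(y)\,dy,\qquad \alpha(\kappa;q)=\int_{\mathbb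 R}\rho(x;\kappa,q)\,dx .$$ **Proposition 3.1.** For every $\delta>0$ there is $\delta_0>0$ such that every Schwartz solution $q$ of KdV with $\|q(0)\|_{H^{-1}}\le\delta_0$ satisfies $$\sup_{t\in\mathbb R}\|q(t)\|_{H^{-1}}\le\delta .$$ Moreover, for each $\kappa\ge1$ and $t\in\mathbb R$, the operator $L+\kappa^2$ with potential $q(t)$ is boundedly invertible and its inverse has a unique continuous (real-valued) integral kernel; the function $g(t,x)=g(x;\kappa,q(t))$ is positive and differentiable in $x$, and $\rho(t,x)=\rho(x;\kappa,q(t))$ is integrable in $x$; and for all $t,x\in\mathbb R$ (all the derivatives below exist) $$\partial_t\, g=-2q'g+2qg'-4\kappa^2g',$$ $$\partial_t\,\frac1{2g}=\Bigl(\frac qg-\frac{2\kappa^2}{g}+4\kappa^3\Bigr)',$$ $$\partial_t\,\rho=\Bigl(\tfrac32\bigl[e^{-2\kappa|\cdot|}*q^2\bigr]+2q\Bigl[\kappa-\frac1{2g}\Bigr]-4\kappa^2\rho\Bigr)',$$ $$\frac{d}{dt}\,\alpha(\kappa;q(t))=0 .$$ -/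

import Mathlib

open scoped SchwartzMap ContDiff ComplexConjugate

open MeasureTheory

noncomputable section

namespace KdV

/-- The Fourier transform `(2π)^{-1/2} ∫ e^{-iξx} f(x) dx`. -/
def fourierHat (f : ℝ → ℝ) (ξ : ℝ) : ℂ :=
  ((1 / Real.sqrt (2 * Real.pi) : ℝ) : ℂ) *
    ∫ x : ℝ, Complex.exp (-(Complex.I * ξ * x)) * (f x : ℂ)

/-- The `H^{-1}(ℝ)` norm of a Schwartz function, `(∫ |f̂(ξ)|² (4 + ξ²)^{-1} dξ)^{1/2}`. -/
def hNegOneNorm (f : 𝓢(ℝ, ℝ)) : ℝ :=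
  Real.sqrt (∫ ξ : ℝ, ‖fourierHat f ξ‖ ^ 2 / (4 + ξ ^ 2))

/-- `q` is a (global in time) Schwartz solution of `∂ₜ q = -q''' + 6 q q'`: a continuous curve in
Schwartz space along which the equation holds at every point of space-time.  (The right-hand side
is then a continuous curve in Schwartz space as well, so that `q` is automatically continuously
differentiable in time with respect to the Schwartz topology.) -/
structure IsSchwartzSolution (q : ℝ → 𝓢(ℝ, ℝ)) : Prop where
  continuous : Continuous q
  equation : ∀ t x : ℝ, HasDerivAt (fun s : ℝ => q s x)
    (-iteratedDeriv 3 (q t) x + 6 * q t x * deriv (q t) x) t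

/-- The Hilbert space `L²(ℝ; ℂ)`. -/
abbrev L2 : Type := Lp ℂ 2 (volume : Measure ℝ)

/-- `u' ∈ L²` is the weak (distributional) derivative of `u ∈ L²`.  Thus `u` belongs to the
Sobolev space `H¹(ℝ)` if and only if `HasWeakDeriv u u'` for some `u'`. -/
def HasWeakDeriv (u u' : L2) : Prop :=
  ∀ φ : ℝ → ℂ, ContDiff ℝ ∞ φ → HasCompactSupport φ →
    ∫ x : ℝ, u x * deriv φ x = -∫ x : ℝ, u' x * φ x

/-- The graph of the Schrödinger operator `L = -∂ₓ² + q` associated to the quadratic form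
`ψ ↦ ∫ |ψ'|² + q |ψ|²` with form domain `H¹(ℝ)`: `u` lies in the domain of `L` and `L u = f` if and
only if `u ∈ H¹(ℝ)` and `∫ u' v̄' + q u v̄ = ∫ f v̄` for all `v ∈ H¹(ℝ)`. -/
def SchrodingerGraph (q : 𝓢(ℝ, ℝ)) (u f : L2) : Prop :=
  ∃ u' : L2, HasWeakDeriv u u' ∧
    ∀ v v' : L2, HasWeakDeriv v v' →
      ∫ x : ℝ, (u' x * conj (v' x) + (q x : ℂ) * u x * conj (v x)) =
        ∫ x : ℝ, f x * conj (v x)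

/-- The bounded operator `R` on `L²(ℝ)` is the resolvent `(L + κ²)⁻¹`, that is, `R f = u` if and
only if `u` lies in the domain of `L` and `(L + κ²) u = f`. -/
def IsResolvent (κ : ℝ) (q : 𝓢(ℝ, ℝ)) (R : L2 →L[ℂ] L2) : Prop :=
  ∀ u f : L2, R f = u ↔ SchrodingerGraph q u (f - ((κ ^ 2 : ℝ) : ℂ) • u)

/-- `G` is a continuous integral kernel of the resolvent `(L + κ²)⁻¹`. -/
def IsGreensFunction (κ : ℝ) (q : 𝓢(ℝ, ℝ)) (G : ℝ → ℝ → ℝ) : Prop :=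
  Continuous (fun p : ℝ × ℝ => G p.1 p.2) ∧
    ∃ R : L2 →L[ℂ] L2, IsResolvent κ q R ∧
      ∀ f : L2,
        (∀ᵐ x : ℝ, Integrable (fun y : ℝ => (G x y : ℂ) * f y)) ∧
        ∀ᵐ x : ℝ, R f x = ∫ y : ℝ, (G x y : ℂ) * f y

open scoped Classical in
/-- The Green's function `G(x, y; κ, q)`: the continuous integral kernel of `(L + κ²)⁻¹`
(and `0` if there is none). -/
def greensFunction (κ : ℝ) (q : 𝓢(ℝ, ℝ)) : ℝ → ℝ → ℝ :=
  if h : ∃ G : ℝ → ℝ → ℝ, IsGreensFunction κ q G then h.choose else 0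

/-- The diagonal Green's function `g(x; κ, q) = G(x, x; κ, q)`. -/
def g (κ : ℝ) (q : 𝓢(ℝ, ℝ)) (x : ℝ) : ℝ := greensFunction κ q x x

/-- The convolution `[e^{-2κ|·|} * f](x)`. -/
def expConv (κ : ℝ) (f : ℝ → ℝ) (x : ℝ) : ℝ :=
  ∫ y : ℝ, Real.exp (-(2 * κ * |x - y|)) * f y

/-- The density `ρ(x; κ, q) = κ - 1/(2g(x)) + ½ ∫ e^{-2κ|x-y|} q(y) dy`. -/
def rho (κ : ℝ) (q : 𝓢(ℝ, ℝ)) (x : ℝ) : ℝ :=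
  κ - 1 / (2 * g κ q x) + 1 / 2 * expConv κ q x

/-- `α(κ; q) = ∫ ρ(x; κ, q) dx`. -/
def alpha (κ : ℝ) (q : 𝓢(ℝ, ℝ)) : ℝ := ∫ x : ℝ, rho κ q x

/-- The flux `q/g - 2κ²/g + 4κ³` of the conservation law for `1/(2g)`. -/
def recipFlux (κ : ℝ) (q : 𝓢(ℝ, ℝ)) (x : ℝ) : ℝ :=
  q x / g κ q x - 2 * κ ^ 2 / g κ q x + 4 * κ ^ 3

/-- The flux `(3/2) e^{-2κ|·|} * q² + 2q (κ - 1/(2g)) - 4κ² ρ` of the conservation law for `ρ`. -/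
def rhoFlux (κ : ℝ) (q : 𝓢(ℝ, ℝ)) (x : ℝ) : ℝ :=
  3 / 2 * expConv κ (fun y => q y ^ 2) x + 2 * q x * (κ - 1 / (2 * g κ q x))
    - 4 * κ ^ 2 * rho κ q x

end KdV

end

/-! Everything is read off from the Jost solution `m = jost κ q`, for which `e^{-κx} m(x)` solves
`-ψ'' + qψ = -κ²ψ` and `m → 1` at `+∞`. Its limit `a = jostLim κ q` at `-∞` is the reciprocal
transmission coefficient. The Lax pair of KdV gives an explicit time derivative of `m`, namely
`jostDot`, which decays at both ends. Hence `a` is conserved (`IsSchwartzSolution.jostLim_eq`), and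
so is `∫ q`.

A priori bound. If `m` is positive, `s = m'/m` solves the Riccati equation `s' = q + 2κs - s²`.
Integrating it gives `∫ s² = ∫ q - 2κ log a` (`integral_riccati_sq`), a conserved quantity `E`.
Applying `(2κ - ∂)⁻¹`, which is `expTail κ`, gives `(2κ - ∂)⁻¹q = -s + (2κ - ∂)⁻¹(s²)`, where the
last term has squared `L²` norm at most `E²/2`. The `H⁻¹` norm of `q` is the `L²` norm of `(2 -
∂)⁻¹q` (`hNegOneNorm_eq`), so for small `E` the quantities `E` and `‖q‖²` control each other when `κ
= 1`; for `κ ≥ 1` the upper bound on `E` persists. Positivity of `m` for small `q` comes from a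
continuity method along `l • q`, `0 ≤ l ≤ 1` (`jostPos_of_small`). It persists in time because `a`
stays fixed and `m` cannot acquire a double zero (`IsSchwartzSolution.jostPos`).

Evolution equations. With the reflected Jost solution `m₋ = jostLeft κ q`, the Wronskian is `2κa`
and `g = m m₋ / (2κa)` (`g_eq`). As `a` is constant in time, the equation for `g` is the product
rule, and the other two laws are algebra. The Wronskian identity also expresses `ρ` through the two
Riccati variables and a convolution (`rho_eq`), so `α` depends only on `∫ q`, `a` and its reflected
counterpart, all conserved. -/

noncomputable section

namespace KdV

open Filter Topology Set

/-! ### Functions with quadratic decay -/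

/-- `f` is continuous and `|f x| ≤ B / (1 + x²)`. -/
structure QuadDecay (B : ℝ) (f : ℝ → ℝ) : Prop where
  continuous : Continuous f
  bound : ∀ x, |f x| ≤ B * (1 + x ^ 2)⁻¹

lemma one_add_sq_inv_pos (x : ℝ) : 0 < (1 + x ^ 2)⁻¹ := by positivity

lemma one_add_sq_inv_le_one (x : ℝ) : (1 + x ^ 2)⁻¹ ≤ 1 :=
  inv_le_one_of_one_le₀ (by nlinarith [sq_nonneg x])

lemma tendsto_one_add_sq_inv_atTop : Tendsto (fun x : ℝ => (1 + x ^ 2)⁻¹) atTop (𝓝 0) :=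
  tendsto_inv_atTop_zero.comp
    (tendsto_atTop_add_const_left _ _ (tendsto_pow_atTop two_ne_zero))

lemma tendsto_one_add_sq_inv_atBot : Tendsto (fun x : ℝ => (1 + x ^ 2)⁻¹) atBot (𝓝 0) := by
  have := tendsto_one_add_sq_inv_atTop.comp tendsto_neg_atBot_atTop
  simpa [Function.comp_def] using this

namespace QuadDecay

variable {B C : ℝ} {f h : ℝ → ℝ}

lemma nonneg (hf : QuadDecay B f) : 0 ≤ B := by
  have := (abs_nonneg _).trans (hf.bound 0)
  simpa using this

lemma abs_le (hf : QuadDecay B f) (x : ℝ) : |f x| ≤ B :=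
  (hf.bound x).trans (mul_le_of_le_one_right hf.nonneg (one_add_sq_inv_le_one x))

lemma integrable (hf : QuadDecay B f) : Integrable f :=
  (integrable_inv_one_add_sq.const_mul B).mono' hf.continuous.aestronglyMeasurable
    (Eventually.of_forall fun x => hf.bound x)

lemma tendsto_atTop (hf : QuadDecay B f) : Tendsto f atTop (𝓝 0) :=
  squeeze_zero_norm hf.bound (by simpa using tendsto_one_add_sq_inv_atTop.const_mul B)

lemma tendsto_atBot (hf : QuadDecay B f) : Tendsto f atBot (𝓝 0) :=
  squeeze_zero_norm hf.bound (by simpa using tendsto_one_add_sq_inv_atBot.const_mul B)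

lemma add (hf : QuadDecay B f) (hh : QuadDecay C h) : QuadDecay (B + C) (fun x => f x + h x) :=
  ⟨hf.continuous.add hh.continuous, fun x => by
    rw [add_mul]; exact (abs_add_le _ _).trans (add_le_add (hf.bound x) (hh.bound x))⟩

lemma neg (hf : QuadDecay B f) : QuadDecay B (fun x => -f x) :=
  ⟨hf.continuous.neg, fun x => by rw [abs_neg]; exact hf.bound x⟩

lemma sub (hf : QuadDecay B f) (hh : QuadDecay C h) : QuadDecay (B + C) (fun x => f x - h x) := by
  simpa [sub_eq_add_neg] using hf.add hh.neg

lemma mul_bounded (hf : QuadDecay B f) (hc : Continuous h) (hh : ∀ x, |h x| ≤ C) :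
    QuadDecay (B * C) (fun x => f x * h x) :=
  ⟨hf.continuous.mul hc, fun x => by
    rw [abs_mul, mul_right_comm]
    exact mul_le_mul (hf.bound x) (hh x) (abs_nonneg _)
      (mul_nonneg hf.nonneg (one_add_sq_inv_pos x).le)⟩

lemma mul (hf : QuadDecay B f) (hh : QuadDecay C h) : QuadDecay (B * C) (fun x => f x * h x) :=
  hf.mul_bounded hh.continuous hh.abs_le

lemma const_mul (hf : QuadDecay B f) (c : ℝ) : QuadDecay (B * |c|) (fun x => c * f x) := by
  simpa [mul_comm] using hf.mul_bounded (h := fun _ => c) continuous_const fun _ => le_rfl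

lemma comp_neg (hf : QuadDecay B f) : QuadDecay B (fun x => f (-x)) :=
  ⟨hf.continuous.comp continuous_neg, fun x => by simpa using hf.bound (-x)⟩

end QuadDecay

/-! ### Tail integrals -/

/-- `∫_x^∞ f`. -/
def tail (f : ℝ → ℝ) (x : ℝ) : ℝ := ∫ y in Ioi x, f y

/-- `∫_x^∞ e^{-2κ(y-x)} f(y) dy`. -/
def expTail (κ : ℝ) (f : ℝ → ℝ) (x : ℝ) : ℝ :=
  ∫ y in Ioi x, Real.exp (-(2 * κ * (y - x))) * f y

/-- The Volterra operator `∫_x^∞ (1 - e^{-2κ(y-x)}) / (2κ) f(y) dy`. -/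
def volterra (κ : ℝ) (f : ℝ → ℝ) (x : ℝ) : ℝ := (tail f x - expTail κ f x) / (2 * κ)

lemma hasDerivAt_integral_Ioi {E : Type*} [NormedAddCommGroup E] [NormedSpace ℝ E]
    [CompleteSpace E] {f : ℝ → E} (hc : Continuous f)
    (hi : ∀ a, IntegrableOn f (Ioi a)) (x : ℝ) :
    HasDerivAt (fun a => ∫ y in Ioi a, f y) (-f x) x := by
  have h1 : (fun a => ∫ y in Ioi a, f y) = fun a => (∫ y in Ioi 0, f y) - ∫ y in (0 : ℝ)..a, f y := by
    funext a
    rw [← intervalIntegral.integral_interval_add_Ioi (hi 0) (hi a), add_sub_cancel_left]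
  rw [h1]
  exact (intervalIntegral.integral_hasDerivAt_right (hc.intervalIntegrable _ _)
    (hc.stronglyMeasurableAtFilter _ _) hc.continuousAt).const_sub _

section Tail

variable {B κ : ℝ} {f : ℝ → ℝ}

lemma exp_neg_sub_le_one (hκ : 0 ≤ κ) {x y : ℝ} (h : x < y) :
    Real.exp (-(2 * κ * (y - x))) ≤ 1 :=
  Real.exp_le_one_iff.2 (neg_nonpos.2 (mul_nonneg (by linarith) (by linarith)))

lemma integrableOn_exp_mul (hκ : 0 ≤ κ) (hc : Continuous f) (hf : Integrable f) (x : ℝ) :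
    IntegrableOn (fun y => Real.exp (-(2 * κ * (y - x))) * f y) (Ioi x) := by
  refine hf.norm.integrableOn.mono' (by fun_prop) ?_
  filter_upwards [self_mem_ae_restrict measurableSet_Ioi] with y hy
  rw [norm_mul, Real.norm_eq_abs, Real.abs_exp]
  exact mul_le_of_le_one_left (norm_nonneg _) (exp_neg_sub_le_one hκ hy)

lemma QuadDecay.hasDerivAt_tail (hf : QuadDecay B f) (x : ℝ) :
    HasDerivAt (tail f) (-f x) x :=
  hasDerivAt_integral_Ioi hf.continuous (fun _ => hf.integrable.integrableOn) x

lemma expTail_eq (κ : ℝ) (f : ℝ → ℝ) (x : ℝ) :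
    expTail κ f x = Real.exp (2 * κ * x) * ∫ y in Ioi x, Real.exp (-(2 * κ * y)) * f y := by
  rw [expTail, ← integral_const_mul]
  congr 1; funext y
  rw [← mul_assoc, ← Real.exp_add]; ring_nf

lemma integrableOn_exp_mul' (hκ : 0 ≤ κ) (hc : Continuous f) (hf : Integrable f) (x : ℝ) :
    IntegrableOn (fun y => Real.exp (-(2 * κ * y)) * f y) (Ioi x) := by
  have := (integrableOn_exp_mul hκ hc hf x).const_mul (Real.exp (-(2 * κ * x)))
  refine this.congr (Eventually.of_forall fun y => ?_)
  simp only
  rw [← mul_assoc, ← Real.exp_add]; ring_nf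

/-- `expTail κ` is a right inverse of `2κ - ∂`. Together with uniqueness of bounded solutions
(`QuadDecay.eq_expTail`), this reduces later identities for exponential tails to differentiation.
Pulling out `e^{2κx}` first leaves `x` only in the endpoint of the integral. -/
lemma QuadDecay.hasDerivAt_expTail (hκ : 0 ≤ κ) (hf : QuadDecay B f) (x : ℝ) :
    HasDerivAt (expTail κ f) (2 * κ * expTail κ f x - f x) x := by
  have h1 : expTail κ f = fun x =>
      Real.exp (2 * κ * x) * ∫ y in Ioi x, Real.exp (-(2 * κ * y)) * f y :=
    funext fun x => expTail_eq κ f x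
  have h2 := hasDerivAt_integral_Ioi (f := fun y => Real.exp (-(2 * κ * y)) * f y)
    (by have := hf.continuous; fun_prop) (integrableOn_exp_mul' hκ hf.continuous hf.integrable) x
  have h3 : HasDerivAt (fun x => Real.exp (2 * κ * x)) (Real.exp (2 * κ * x) * (2 * κ)) x := by
    simpa using ((hasDerivAt_id x).const_mul (2 * κ)).exp
  have h4 := h3.mul h2
  rw [expTail_eq κ f x, h1]
  have : Real.exp (2 * κ * x) * Real.exp (-(2 * κ * x)) = 1 := by
    rw [← Real.exp_add]; simp
  exact h4.congr_deriv (by linear_combination (-f x) * this)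

lemma QuadDecay.abs_tail_le (hf : QuadDecay B f) (x : ℝ) :
    |tail f x| ≤ B * (Real.pi / 2 - Real.arctan x) := by
  rw [← integral_Ioi_inv_one_add_sq, ← integral_const_mul]
  refine (Real.norm_eq_abs _).symm.le.trans ((norm_integral_le_integral_norm _).trans ?_)
  exact integral_mono hf.integrable.norm.integrableOn
    (integrable_inv_one_add_sq.const_mul B).integrableOn hf.bound

lemma abs_expTail_le_integral (hκ : 0 ≤ κ) (hc : Continuous f) (hf : Integrable f) (x : ℝ) :
    |expTail κ f x| ≤ ∫ y, |f y| := by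
  refine (Real.norm_eq_abs _).symm.le.trans ((norm_integral_le_integral_norm _).trans ?_)
  refine (setIntegral_mono_on (integrableOn_exp_mul hκ hc hf x).norm hf.norm.integrableOn
    measurableSet_Ioi fun y hy => ?_).trans
    (setIntegral_le_integral hf.norm (Eventually.of_forall fun y => norm_nonneg _))
  rw [norm_mul, Real.norm_eq_abs, Real.abs_exp]
  exact mul_le_of_le_one_left (norm_nonneg _) (exp_neg_sub_le_one hκ hy)

/-- Exponential tails preserve quadratic decay. -/
lemma QuadDecay.expTail (hκ : 1 ≤ κ) (hf : QuadDecay B f) : QuadDecay B (expTail κ f) := by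
  have hκ0 : 0 ≤ κ := by linarith
  refine ⟨continuous_iff_continuousAt.2 fun x => (hf.hasDerivAt_expTail hκ0 x).continuousAt,
    fun x => ?_⟩
  have hB := hf.nonneg
  -- A primitive whose derivative dominates the integrand. Since `2y ≥ -(1 + y²)` and `2κ - 1 ≥ 1`,
  -- the loss from differentiating the weight is absorbed, and the constant `B` is preserved
  -- exactly.
  set w : ℝ → ℝ := fun y => -(Real.exp (-(2 * κ * (y - x))) * (B * (1 + y ^ 2)⁻¹)) with hw
  set w' : ℝ → ℝ := fun y => Real.exp (-(2 * κ * (y - x))) *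
    (2 * κ * (B * (1 + y ^ 2)⁻¹) + B * (2 * y * ((1 + y ^ 2)⁻¹) ^ 2)) with hw'
  have hd : ∀ y, HasDerivAt w (w' y) y := by
    intro y
    have h1 : HasDerivAt (fun y => Real.exp (-(2 * κ * (y - x))))
        (Real.exp (-(2 * κ * (y - x))) * (-(2 * κ))) y := by
      simpa using ((((hasDerivAt_id y).sub_const x).const_mul (2 * κ)).neg).exp
    have h2 : HasDerivAt (fun y : ℝ => (1 + y ^ 2)⁻¹) (-(2 * y) / (1 + y ^ 2) ^ 2) y := by
      have h3 : HasDerivAt (fun y : ℝ => 1 + y ^ 2) (2 * y) y := by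
        simpa using (hasDerivAt_pow 2 y).const_add 1
      exact h3.inv (by positivity)
    refine (h1.mul (h2.const_mul B)).neg.congr_deriv ?_
    simp only [hw']
    field_simp
    ring
  have hle : ∀ y, Real.exp (-(2 * κ * (y - x))) * |f y| ≤ w' y := by
    intro y
    refine mul_le_mul_of_nonneg_left ((hf.bound y).trans ?_) (Real.exp_pos _).le
    have hp := one_add_sq_inv_pos y
    set p := (1 + y ^ 2)⁻¹ with hpdef
    have hpy : p * (1 + y ^ 2) = 1 := inv_mul_cancel₀ (by positivity)
    have h5 : -p ≤ 2 * y * p ^ 2 := by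
      have h6 : p ^ 2 * (1 + y) ^ 2 ≥ 0 := by positivity
      nlinarith
    nlinarith [mul_le_mul_of_nonneg_left h5 hB, mul_nonneg hB hp.le,
      mul_nonneg (mul_nonneg hB hp.le) (sub_nonneg.2 hκ)]
  have hlim : Tendsto w atTop (𝓝 0) := by
    refine squeeze_zero_norm' ?_ (by simpa using tendsto_one_add_sq_inv_atTop.const_mul B)
    filter_upwards [eventually_gt_atTop x] with y hy
    rw [hw, norm_neg, norm_mul, Real.norm_eq_abs, Real.abs_exp, Real.norm_of_nonneg (by positivity)]
    exact mul_le_of_le_one_left (by positivity) (exp_neg_sub_le_one hκ0 hy)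
  have hnn : ∀ y ∈ Ioi x, 0 ≤ w' y := fun y _ => le_trans (by positivity) (hle y)
  have hint := integrableOn_Ioi_deriv_of_nonneg' (fun y _ => hd y) hnn hlim
  have hval := integral_Ioi_of_hasDerivAt_of_nonneg' (fun y _ => hd y) hnn hlim
  refine (Real.norm_eq_abs _).symm.le.trans ((norm_integral_le_integral_norm _).trans ?_)
  calc ∫ y in Ioi x, ‖Real.exp (-(2 * κ * (y - x))) * f y‖ ≤ ∫ y in Ioi x, w' y := by
        refine integral_mono (integrableOn_exp_mul hκ0 hf.continuous hf.integrable x).norm hint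
          fun y => ?_
        simpa [abs_mul] using hle y
    _ = B * (1 + x ^ 2)⁻¹ := by rw [hval]; simp [hw]

/-- The boundary terms `-f` of the two tails cancel. A second differentiation then shows that `u =
volterra κ f` solves `u'' - 2κu' = f`. -/
lemma QuadDecay.hasDerivAt_volterra (hκ : 1 ≤ κ) (hf : QuadDecay B f) (x : ℝ) :
    HasDerivAt (volterra κ f) (-KdV.expTail κ f x) x := by
  have := ((hf.hasDerivAt_tail x).sub (hf.hasDerivAt_expTail (κ := κ) (by linarith) x)).div_const (2 * κ)
  refine this.congr_deriv ?_
  field_simp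
  ring

lemma QuadDecay.continuous_volterra (hκ : 1 ≤ κ) (hf : QuadDecay B f) : Continuous (volterra κ f) :=
  continuous_iff_continuousAt.2 fun x => (hf.hasDerivAt_volterra hκ x).continuousAt

lemma QuadDecay.tendsto_tail_atTop (hf : QuadDecay B f) : Tendsto (tail f) atTop (𝓝 0) := by
  refine squeeze_zero_norm (fun x => hf.abs_tail_le x) ?_
  have : Tendsto Real.arctan atTop (𝓝 (Real.pi / 2)) :=
    Real.tendsto_arctan_atTop.mono_right nhdsWithin_le_nhds
  simpa using (this.const_sub (Real.pi / 2)).const_mul B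

lemma QuadDecay.tendsto_tail_atBot (hf : QuadDecay B f) : Tendsto (tail f) atBot (𝓝 (∫ y, f y)) := by
  have h : tail f = fun x => (∫ y, f y) - ∫ y in Iic x, f y := by
    funext x
    rw [tail, ← intervalIntegral.integral_Iic_add_Ioi (b := x) hf.integrable.integrableOn hf.integrable.integrableOn]
    ring
  have h2 : Tendsto (fun x => ∫ y in Iic x, f y) atBot (𝓝 0) := by
    have h3 := hf.comp_neg.tendsto_tail_atTop.comp tendsto_neg_atBot_atTop
    refine h3.congr fun x => ?_
    simp only [Function.comp, tail]
    rw [← integral_comp_neg_Iic]; simp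
  rw [h]
  simpa using h2.const_sub (∫ y, f y)

lemma QuadDecay.tendsto_volterra_atTop (hκ : 1 ≤ κ) (hf : QuadDecay B f) :
    Tendsto (volterra κ f) atTop (𝓝 0) := by
  have h := (hf.tendsto_tail_atTop.sub (hf.expTail hκ).tendsto_atTop).div_const (2 * κ)
  rw [sub_zero, zero_div] at h
  exact h

lemma QuadDecay.tendsto_volterra_atBot (hκ : 1 ≤ κ) (hf : QuadDecay B f) :
    Tendsto (volterra κ f) atBot (𝓝 ((∫ y, f y) / (2 * κ))) := by
  have h := (hf.tendsto_tail_atBot.sub (hf.expTail hκ).tendsto_atBot).div_const (2 * κ)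
  rw [sub_zero] at h
  exact h

/-- Bounded solutions of `d' = 2κ d` vanish. -/
lemma eq_zero_of_deriv_eq_of_bounded (hκ : 0 < κ) {d : ℝ → ℝ} {C : ℝ}
    (hd : ∀ x, HasDerivAt d (2 * κ * d x) x) (hb : ∀ x, |d x| ≤ C) (x : ℝ) : d x = 0 := by
  have h1 : ∀ y, HasDerivAt (fun y => Real.exp (-(2 * κ * y)) * d y) 0 y := by
    intro y
    have h3 : HasDerivAt (fun x => Real.exp (-(2 * κ * x))) (Real.exp (-(2 * κ * y)) * (-(2 * κ))) y := by
      simpa using ((hasDerivAt_id y).const_mul (2 * κ)).neg.exp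
    exact (h3.mul (hd y)).congr_deriv (by ring)
  have h2 : ∀ y, Real.exp (-(2 * κ * x)) * d x = Real.exp (-(2 * κ * y)) * d y := fun y =>
    is_const_of_deriv_eq_zero (fun z => (h1 z).differentiableAt) (fun z => (h1 z).deriv) x y
  have h3 : Tendsto (fun y => Real.exp (-(2 * κ * y)) * d y) atTop (𝓝 0) := by
    have h4 : Tendsto (fun y => Real.exp (-(2 * κ * y)) * C) atTop (𝓝 0) := by
      have : Tendsto (fun y => -(2 * κ * y)) atTop atBot :=
        tendsto_neg_atTop_atBot.comp (tendsto_id.const_mul_atTop (by positivity))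
      simpa using (Real.tendsto_exp_atBot.comp this).mul_const C
    refine squeeze_zero_norm (fun y => ?_) h4
    rw [norm_mul, Real.norm_eq_abs, Real.abs_exp]
    exact mul_le_mul_of_nonneg_left (hb y) (Real.exp_pos _).le
  have h5 : Real.exp (-(2 * κ * x)) * d x = 0 :=
    tendsto_nhds_unique (tendsto_const_nhds.congr h2) h3
  exact (mul_eq_zero.1 h5).resolve_left (Real.exp_pos _).ne'

/-- The difference of two bounded solutions of `j' = 2κj - f` is a bounded multiple of `e^{2κx}`,
hence zero. -/
lemma QuadDecay.eq_expTail (hκ : 1 ≤ κ) (hf : QuadDecay B f) {j : ℝ → ℝ} {C : ℝ}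
    (hj : ∀ x, HasDerivAt j (2 * κ * j x - f x) x) (hb : ∀ x, |j x| ≤ C) (x : ℝ) :
    j x = KdV.expTail κ f x := by
  refine sub_eq_zero.1 (eq_zero_of_deriv_eq_of_bounded (κ := κ) (d := fun x => j x - KdV.expTail κ f x)
    (C := C + B) (by linarith) (fun y => ?_) (fun y => ?_) x)
  · exact ((hj y).sub (hf.hasDerivAt_expTail (κ := κ) (by linarith) y)).congr_deriv (by ring)
  · exact (abs_sub _ _).trans (add_le_add (hb y) ((hf.expTail hκ).abs_le y))

/-- A solution of `u'' - 2κ u' = f` with `u → 0` at `+∞` and bounded `u'` is the Volterra integral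
of `f`. -/
lemma QuadDecay.eq_volterra (hκ : 1 ≤ κ) (hf : QuadDecay B f) {u u' : ℝ → ℝ} {C : ℝ}
    (hu : ∀ x, HasDerivAt u (u' x) x) (hu' : ∀ x, HasDerivAt u' (2 * κ * u' x + f x) x)
    (hb : ∀ x, |u' x| ≤ C) (hlim : Tendsto u atTop (𝓝 0)) (x : ℝ) : u x = volterra κ f x := by
  have h1 : ∀ x, -u' x = KdV.expTail κ f x := fun x => by
    refine hf.eq_expTail hκ (j := fun x => -u' x) (C := C) (fun y => ?_) (fun y => by simpa using hb y) x
    exact (hu' y).neg.congr_deriv (by ring)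
  have h2 : ∀ y, HasDerivAt (fun y => u y - volterra κ f y) 0 y := fun y => by
    refine ((hu y).sub (hf.hasDerivAt_volterra hκ y)).congr_deriv ?_
    rw [← h1]; ring
  have h3 : ∀ y, u x - volterra κ f x = u y - volterra κ f y := fun y =>
    is_const_of_deriv_eq_zero (fun z => (h2 z).differentiableAt) (fun z => (h2 z).deriv) x y
  have h4 := hlim.sub (hf.tendsto_volterra_atTop hκ)
  have h5 := tendsto_nhds_unique (tendsto_const_nhds.congr h3) h4
  linarith

/-- The Volterra operator gains a factor `1/2` with respect to the weight
`exp (B (π/2 - arctan x))`. -/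
lemma abs_volterra_le (hκ : 1 ≤ κ) {N C : ℝ} (hf : QuadDecay C f) (hB : 0 ≤ B) (hN : 0 ≤ N)
    (h : ∀ y, |f y| ≤ N * (B * (1 + y ^ 2)⁻¹ * Real.exp (B * (Real.pi / 2 - Real.arctan y))))
    (x : ℝ) :
    |volterra κ f x| ≤ N / 2 * Real.exp (B * (Real.pi / 2 - Real.arctan x)) := by
  have hκ0 : 0 ≤ κ := by linarith
  -- The weight is an exponential of the tail of `B / (1 + y²)`, so the integral of `B / (1 + y²)`
  -- times the weight telescopes. The factor `1/2` is the bound `1/(2κ)` of the Volterra kernel.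
  set w : ℝ → ℝ := fun y => -Real.exp (B * (Real.pi / 2 - Real.arctan y)) with hw
  set w' : ℝ → ℝ := fun y => B * (1 + y ^ 2)⁻¹ * Real.exp (B * (Real.pi / 2 - Real.arctan y)) with hw'
  have hd : ∀ y, HasDerivAt w (w' y) y := fun y => by
    have := (((Real.hasDerivAt_arctan y).const_sub (Real.pi / 2)).const_mul B).exp.neg
    refine this.congr_deriv ?_
    simp only [hw', one_div]; ring
  have hnn : ∀ y, 0 ≤ w' y := fun y => by simp only [hw']; positivity
  have hlim : Tendsto w atTop (𝓝 (-1)) := by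
    have h1 : Tendsto Real.arctan atTop (𝓝 (Real.pi / 2)) :=
      Real.tendsto_arctan_atTop.mono_right nhdsWithin_le_nhds
    have h2 := ((Real.continuous_exp.tendsto _).comp ((h1.const_sub (Real.pi / 2)).const_mul B)).neg
    simpa [Function.comp_def, hw] using h2
  have hint := integrableOn_Ioi_deriv_of_nonneg' (a := x) (fun y _ => hd y) (fun y _ => hnn y) hlim
  have hval := integral_Ioi_of_hasDerivAt_of_nonneg' (a := x) (fun y _ => hd y) (fun y _ => hnn y) hlim
  have hfi := hf.integrable.integrableOn (s := Ioi x)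
  have hei := integrableOn_exp_mul hκ0 hf.continuous hf.integrable x
  have h1 : |tail f x - expTail κ f x| ≤ N * Real.exp (B * (Real.pi / 2 - Real.arctan x)) := by
    rw [tail, expTail, ← integral_sub hfi hei]
    refine (Real.norm_eq_abs _).symm.le.trans ((norm_integral_le_integral_norm _).trans ?_)
    calc ∫ y in Ioi x, ‖f y - Real.exp (-(2 * κ * (y - x))) * f y‖ ≤ ∫ y in Ioi x, N * w' y := by
          refine setIntegral_mono_on (hfi.sub hei).norm (hint.const_mul N) measurableSet_Ioi
            fun y hy => ?_
          have h2 := exp_neg_sub_le_one hκ0 hy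
          have h3 := Real.exp_pos (-(2 * κ * (y - x)))
          rw [show f y - Real.exp (-(2 * κ * (y - x))) * f y
            = (1 - Real.exp (-(2 * κ * (y - x)))) * f y by ring, norm_mul,
            Real.norm_of_nonneg (by linarith)]
          exact (mul_le_of_le_one_left (norm_nonneg _) (by linarith)).trans (h y)
      _ ≤ _ := by
          rw [integral_const_mul, hval]
          refine mul_le_mul_of_nonneg_left ?_ hN
          simp only [hw]; linarith
  rw [volterra, abs_div, abs_of_pos (show 0 < 2 * κ by linarith), div_le_iff₀ (by linarith)]
  refine h1.trans ?_
  have : 0 ≤ N * Real.exp (B * (Real.pi / 2 - Real.arctan x)) := by positivity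
  nlinarith

end Tail

/-! ### The Jost solution -/

section Volterra

variable {B C D κ b : ℝ} {f h q u : ℝ → ℝ}

lemma QuadDecay.tail_add (hf : QuadDecay B f) (hh : QuadDecay C h) (x : ℝ) :
    tail (fun y => f y + h y) x = tail f x + tail h x :=
  integral_add hf.integrable.integrableOn hh.integrable.integrableOn

lemma QuadDecay.expTail_add (hκ : 0 ≤ κ) (hf : QuadDecay B f) (hh : QuadDecay C h) (x : ℝ) :
    KdV.expTail κ (fun y => f y + h y) x = KdV.expTail κ f x + KdV.expTail κ h x := by
  simp only [KdV.expTail, mul_add]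
  exact integral_add (integrableOn_exp_mul hκ hf.continuous hf.integrable x)
    (integrableOn_exp_mul hκ hh.continuous hh.integrable x)

lemma tail_const_mul (c : ℝ) (x : ℝ) : tail (fun y => c * f y) x = c * tail f x :=
  integral_const_mul _ _

lemma expTail_const_mul (c : ℝ) (x : ℝ) :
    expTail κ (fun y => c * f y) x = c * expTail κ f x := by
  simp only [expTail, mul_left_comm _ c]
  exact integral_const_mul _ _

lemma volterra_const_mul (c : ℝ) (x : ℝ) :
    volterra κ (fun y => c * f y) x = c * volterra κ f x := by
  simp only [volterra, tail_const_mul, expTail_const_mul]; ring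

lemma QuadDecay.volterra_add (hκ : 1 ≤ κ) (hf : QuadDecay B f) (hh : QuadDecay C h) (x : ℝ) :
    volterra κ (fun y => f y + h y) x = volterra κ f x + volterra κ h x := by
  simp only [volterra, hf.tail_add hh, hf.expTail_add (by linarith : 0 ≤ κ) hh]; ring

lemma QuadDecay.volterra_sub (hκ : 1 ≤ κ) (hf : QuadDecay B f) (hh : QuadDecay C h) (x : ℝ) :
    volterra κ (fun y => f y - h y) x = volterra κ f x - volterra κ h x := by
  have h1 := hf.volterra_add hκ (hh.const_mul (-1)) x
  rw [volterra_const_mul] at h1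
  rw [sub_eq_add_neg, ← neg_one_mul, ← h1]
  congr 1; funext y; ring

lemma QuadDecay.abs_volterra_le (hκ : 1 ≤ κ) (hf : QuadDecay B f) (x : ℝ) :
    |volterra κ f x| ≤ 3 * B := by
  have h1 := hf.abs_tail_le x
  have h2 := (hf.expTail hκ).abs_le x
  have h3 := Real.neg_pi_div_two_lt_arctan x
  have h4 := hf.nonneg
  have h5 := Real.pi_le_four
  -- The tail is at most `πB ≤ 4B` and the exponential tail at most `B`.
  have h6 : |tail f x - KdV.expTail κ f x| ≤ 5 * B := by
    refine (abs_sub _ _).trans ?_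
    nlinarith
  rw [volterra, abs_div, abs_of_pos (show 0 < 2 * κ by linarith), div_le_iff₀ (by linarith)]
  nlinarith

/-- The weight in which the Volterra equation is a contraction. -/
def weight (B x : ℝ) : ℝ := Real.exp (B * (Real.pi / 2 - Real.arctan x))

lemma weight_pos (B x : ℝ) : 0 < weight B x := Real.exp_pos _

lemma continuous_weight (B : ℝ) : Continuous (weight B) := by
  unfold weight; fun_prop

lemma one_le_weight (hB : 0 ≤ B) (x : ℝ) : 1 ≤ weight B x :=
  Real.one_le_exp (mul_nonneg hB (by linarith [Real.arctan_lt_pi_div_two x]))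

lemma weight_le (hB : 0 ≤ B) (x : ℝ) : weight B x ≤ Real.exp (B * Real.pi) :=
  Real.exp_le_exp.2 (mul_le_mul_of_nonneg_left (by linarith [Real.neg_pi_div_two_lt_arctan x]) hB)

lemma inv_weight_le_one (hB : 0 ≤ B) (x : ℝ) : (weight B x)⁻¹ ≤ 1 :=
  inv_le_one_of_one_le₀ (one_le_weight hB x)

lemma QuadDecay.mul_weight_mul (hq : QuadDecay B q) (hu : Continuous u) (hb : ∀ x, |u x| ≤ C) :
    QuadDecay (B * (Real.exp (B * Real.pi) * C)) (fun y => q y * (weight B y * u y)) :=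
  hq.mul_bounded ((continuous_weight B).mul hu) fun x => by
    rw [abs_mul, abs_of_pos (weight_pos B x)]
    exact mul_le_mul (weight_le hq.nonneg x) (hb x) (abs_nonneg _) (Real.exp_pos _).le

lemma QuadDecay.abs_volterra_weight_le (hκ : 1 ≤ κ) (hq : QuadDecay B q) (hu : Continuous u)
    (hC : 0 ≤ C) (hb : ∀ x, |u x| ≤ C) (x : ℝ) :
    (weight B x)⁻¹ * |volterra κ (fun y => q y * (weight B y * u y)) x| ≤ C / 2 := by
  have h := KdV.abs_volterra_le hκ (hq.mul_weight_mul hu hb) hq.nonneg hC (fun y => by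
    rw [abs_mul, abs_mul, abs_of_pos (weight_pos B y)]
    have h1 := hq.bound y
    have h2 := hb y
    have h3 := weight_pos B y
    calc |q y| * (weight B y * |u y|) ≤ (B * (1 + y ^ 2)⁻¹) * (weight B y * C) :=
          mul_le_mul h1 (mul_le_mul_of_nonneg_left h2 h3.le) (by positivity)
            (mul_nonneg hq.nonneg (one_add_sq_inv_pos y).le)
      _ = C * (B * (1 + y ^ 2)⁻¹ * weight B y) := by ring) x
  rw [inv_mul_le_iff₀ (weight_pos B x), mul_comm (weight B x)]
  exact h

/-- Stability for the Volterra equation. -/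
lemma QuadDecay.abs_le_of_volterra (hκ : 1 ≤ κ) (hq : QuadDecay B q) (hu : Continuous u)
    (hb : ∀ x, |u x| ≤ C) (h : ∀ x, |u x - volterra κ (fun y => q y * u y) x| ≤ b) (x : ℝ) :
    |u x| ≤ 2 * b * Real.exp (B * Real.pi) := by
  have hB := hq.nonneg
  have hC : 0 ≤ C := (abs_nonneg _).trans (hb 0)
  -- After division by the weight the Volterra operator has norm at most `1/2`, so its contribution
  -- is absorbed. The bound `C` is only needed for `‖v‖` to be finite and drops out of the
  -- conclusion.
  set v : BoundedContinuousFunction ℝ ℝ := BoundedContinuousFunction.ofNormedAddCommGroup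
    (fun x => (weight B x)⁻¹ * u x)
    (((continuous_weight B).inv₀ fun x => (weight_pos B x).ne').mul hu) C (fun x => by
      rw [norm_mul, Real.norm_of_nonneg (inv_nonneg.2 (weight_pos B x).le)]
      exact (mul_le_of_le_one_left (norm_nonneg _) (inv_weight_le_one hB x)).trans (hb x)) with hv
  have hvu : ∀ y, weight B y * v y = u y := fun y => by
    simp [hv, mul_inv_cancel_left₀ (weight_pos B y).ne']
  have hb0 : 0 ≤ b := (abs_nonneg _).trans (h 0)
  have h1 : ‖v‖ ≤ b + ‖v‖ / 2 := by
    refine (BoundedContinuousFunction.norm_le (by positivity)).2 fun y => ?_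
    have h2 := hq.abs_volterra_weight_le hκ v.continuous (norm_nonneg v) v.norm_coe_le_norm y
    simp only [hvu] at h2
    have h3 : ‖v y‖ = (weight B y)⁻¹ * |u y| := by
      rw [← hvu, abs_mul, abs_of_pos (weight_pos B y), inv_mul_cancel_left₀ (weight_pos B y).ne']
      rfl
    have h4 : |u y| ≤ b + |volterra κ (fun y => q y * u y) y| := by
      have := abs_sub_abs_le_abs_sub (u y) (volterra κ (fun y => q y * u y) y)
      linarith [h y]
    rw [h3]
    calc (weight B y)⁻¹ * |u y| ≤ (weight B y)⁻¹ * (b + |volterra κ (fun y => q y * u y) y|) :=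
          mul_le_mul_of_nonneg_left h4 (inv_nonneg.2 (weight_pos B y).le)
      _ ≤ b + ‖v‖ / 2 := by
          rw [mul_add]
          exact add_le_add (mul_le_of_le_one_left hb0 (inv_weight_le_one hB y)) h2
  rw [← hvu x, abs_mul, abs_of_pos (weight_pos B x), mul_comm]
  exact mul_le_mul ((v.norm_coe_le_norm x).trans (by linarith)) (weight_le hB x)
    (weight_pos B x).le (by linarith)

/-- Existence for the Volterra equation. -/
lemma QuadDecay.exists_volterra (hκ : 1 ≤ κ) (hq : QuadDecay B q) :
    ∃ m : ℝ → ℝ, Continuous m ∧ (∃ C, ∀ x, |m x| ≤ C) ∧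
      ∀ x, m x = 1 + volterra κ (fun y => q y * m y) x := by
  have hB := hq.nonneg
  have hqv : ∀ v : BoundedContinuousFunction ℝ ℝ, QuadDecay (B * (Real.exp (B * Real.pi) * ‖v‖))
      (fun y => q y * (weight B y * v y)) := fun v => hq.mul_weight_mul v.continuous v.norm_coe_le_norm
  -- The equation for `m`, conjugated by the weight: a fixed point `v` gives `m = weight * v`, and
  -- `T` contracts by `1/2` whatever the size of `q`.
  let T : BoundedContinuousFunction ℝ ℝ → BoundedContinuousFunction ℝ ℝ := fun v =>
    BoundedContinuousFunction.ofNormedAddCommGroup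
      (fun x => (weight B x)⁻¹ * (1 + volterra κ (fun y => q y * (weight B y * v y)) x))
      (((continuous_weight B).inv₀ fun x => (weight_pos B x).ne').mul
        (continuous_const.add ((hqv v).continuous_volterra hκ))) (1 + ‖v‖ / 2) (fun x => by
        rw [norm_mul, Real.norm_of_nonneg (inv_nonneg.2 (weight_pos B x).le)]
        refine (mul_le_mul_of_nonneg_left (norm_add_le _ _)
          (inv_nonneg.2 (weight_pos B x).le)).trans ?_
        rw [mul_add]
        refine add_le_add ?_
          (hq.abs_volterra_weight_le hκ v.continuous (norm_nonneg v) v.norm_coe_le_norm x)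
        simpa using inv_weight_le_one hB x)
  have hT : ContractingWith (1 / 2) T := by
    refine ⟨by rw [← NNReal.coe_lt_coe]; norm_num, LipschitzWith.of_dist_le_mul fun v w => ?_⟩
    rw [BoundedContinuousFunction.dist_le (by positivity)]
    intro x
    have h1 := hq.abs_volterra_weight_le hκ (v - w).continuous (norm_nonneg (v - w))
      (v - w).norm_coe_le_norm x
    have h2 : (fun y => q y * (weight B y * (v - w) y)) =
        fun y => q y * (weight B y * v y) - q y * (weight B y * w y) := by
      funext y; simp only [BoundedContinuousFunction.coe_sub, Pi.sub_apply]; ring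
    rw [h2, (hqv v).volterra_sub hκ (hqv w)] at h1
    have h3 : T v x - T w x = (weight B x)⁻¹ * (volterra κ (fun y => q y * (weight B y * v y)) x -
        volterra κ (fun y => q y * (weight B y * w y)) x) := by
      simp only [T, BoundedContinuousFunction.coe_ofNormedAddCommGroup]; ring
    rw [Real.dist_eq, h3, abs_mul, abs_of_pos (inv_pos.2 (weight_pos B x)), dist_eq_norm]
    refine h1.trans (le_of_eq ?_)
    push_cast; ring
  have hfix := hT.fixedPoint_isFixedPt
  set v := ContractingWith.fixedPoint T hT
  have hcont : Continuous fun x => weight B x * v x := (continuous_weight B).mul v.continuous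
  refine ⟨fun x => weight B x * v x, hcont, ⟨Real.exp (B * Real.pi) * ‖v‖, fun x => ?_⟩, fun x => ?_⟩
  · rw [abs_mul, abs_of_pos (weight_pos B x)]
    exact mul_le_mul (weight_le hB x) (v.norm_coe_le_norm x) (abs_nonneg _) (Real.exp_pos _).le
  · have h4 : v x = T v x := by rw [hfix.eq]
    change weight B x * v x = 1 + volterra κ (fun y => q y * (weight B y * v y)) x
    conv_lhs => rw [h4]
    simp only [T, BoundedContinuousFunction.coe_ofNormedAddCommGroup]
    rw [mul_inv_cancel_left₀ (weight_pos B x).ne']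

end Volterra

/-! ### Schwartz functions and quadratic decay -/

/-- A weighted sup norm of the `k`-th derivative. -/
def decayNorm (k : ℕ) (f : 𝓢(ℝ, ℝ)) : ℝ :=
  SchwartzMap.seminorm ℝ 0 k f + SchwartzMap.seminorm ℝ 2 k f

lemma decayNorm_nonneg (k : ℕ) (f : 𝓢(ℝ, ℝ)) : 0 ≤ decayNorm k f :=
  add_nonneg (apply_nonneg _ _) (apply_nonneg _ _)

lemma continuous_decayNorm (k : ℕ) : Continuous (decayNorm k) :=
  ((schwartz_withSeminorms ℝ ℝ ℝ).continuous_seminorm (0, k)).add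
    ((schwartz_withSeminorms ℝ ℝ ℝ).continuous_seminorm (2, k))

lemma tendsto_decayNorm_sub (k : ℕ) (q : 𝓢(ℝ, ℝ)) :
    Tendsto (fun q' => decayNorm k (q' - q)) (𝓝 q) (𝓝 0) := by
  have h : Continuous fun q' => decayNorm k (q' - q) :=
    (continuous_decayNorm k).comp (continuous_id.sub continuous_const)
  have := h.tendsto q
  simpa [decayNorm] using this

lemma quadDecay_iteratedDeriv (k : ℕ) (f : 𝓢(ℝ, ℝ)) :
    QuadDecay (decayNorm k f) (iteratedDeriv k f) := by
  refine ⟨(f.smooth k).continuous_iteratedDeriv k le_rfl, fun x => ?_⟩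
  have h0 := SchwartzMap.le_seminorm' ℝ 0 k f x
  have h2 := SchwartzMap.le_seminorm' ℝ 2 k f x
  rw [← div_eq_mul_inv, le_div_iff₀ (by positivity), decayNorm]
  rw [pow_zero, one_mul, Real.norm_eq_abs] at h0
  rw [sq_abs, Real.norm_eq_abs] at h2
  linarith

lemma quadDecay (f : 𝓢(ℝ, ℝ)) : QuadDecay (decayNorm 0 f) f := by
  simpa using quadDecay_iteratedDeriv 0 f

lemma quadDecay_deriv (f : 𝓢(ℝ, ℝ)) : QuadDecay (decayNorm 1 f) (deriv f) := by
  simpa [iteratedDeriv_one] using quadDecay_iteratedDeriv 1 f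

lemma hasDerivAt_iteratedDeriv (k : ℕ) (f : 𝓢(ℝ, ℝ)) (x : ℝ) :
    HasDerivAt (iteratedDeriv k f) (iteratedDeriv (k + 1) f x) x := by
  rw [iteratedDeriv_succ]
  have : ContDiff ℝ (k + 1 : ℕ) f := f.smooth (k + 1 : ℕ)
  exact (this.differentiable_iteratedDeriv k (by exact_mod_cast Nat.lt_succ_self k) x).hasDerivAt

lemma hasDerivAt_schwartz (f : 𝓢(ℝ, ℝ)) (x : ℝ) : HasDerivAt f (deriv f x) x :=
  (f.differentiableAt).hasDerivAt

lemma hasDerivAt_deriv_schwartz (f : 𝓢(ℝ, ℝ)) (x : ℝ) :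
    HasDerivAt (deriv f) (iteratedDeriv 2 f x) x := by
  simpa [iteratedDeriv_one] using hasDerivAt_iteratedDeriv 1 f x

/-! ### The normalized Jost solution at `+∞` -/

open scoped Classical in
/-- The normalized Jost solution `m` at `+∞`: `e^{-κx} m(x)` solves `-ψ'' + qψ = -κ²ψ` and
`m → 1` at `+∞`. -/
def jost (κ : ℝ) (q : 𝓢(ℝ, ℝ)) : ℝ → ℝ :=
  if h : ∃ m : ℝ → ℝ, Continuous m ∧ (∃ C, ∀ x, |m x| ≤ C) ∧
      ∀ x, m x = 1 + volterra κ (fun y => q y * m y) x then h.choose else 0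

/-- The derivative of `jost`. -/
def jostDeriv (κ : ℝ) (q : 𝓢(ℝ, ℝ)) (x : ℝ) : ℝ := -expTail κ (fun y => q y * jost κ q y) x

/-- The limit of `jost` at `-∞`. -/
def jostLim (κ : ℝ) (q : 𝓢(ℝ, ℝ)) : ℝ := 1 + (∫ y, q y * jost κ q y) / (2 * κ)

/-- A bound for `jost`. -/
def jostBound (q : 𝓢(ℝ, ℝ)) : ℝ := 2 * Real.exp (decayNorm 0 q * Real.pi)

section Jost

variable {κ : ℝ} (hκ : 1 ≤ κ) (q : 𝓢(ℝ, ℝ))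

include hκ in
lemma jost_spec : Continuous (jost κ q) ∧ (∃ C, ∀ x, |jost κ q x| ≤ C) ∧
      ∀ x, jost κ q x = 1 + volterra κ (fun y => q y * jost κ q y) x := by
  have h := (quadDecay q).exists_volterra hκ
  rw [jost, dif_pos h]
  exact h.choose_spec

include hκ in
lemma continuous_jost : Continuous (jost κ q) := (jost_spec hκ q).1

include hκ in
lemma jost_eq (x : ℝ) : jost κ q x = 1 + volterra κ (fun y => q y * jost κ q y) x :=
  (jost_spec hκ q).2.2 x

include hκ in
lemma abs_jost_le (x : ℝ) : |jost κ q x| ≤ jostBound q := by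
  obtain ⟨h1, ⟨C, h2⟩, h3⟩ := jost_spec hκ q
  have := (quadDecay q).abs_le_of_volterra hκ h1 h2 (b := 1) (fun x => by
    rw [← sub_eq_iff_eq_add.2 ((h3 x).trans (add_comm _ _)) ]; simp) x
  simpa [jostBound] using this

include hκ in
lemma quadDecay_mul_jost :
    QuadDecay (decayNorm 0 q * jostBound q) (fun y => q y * jost κ q y) :=
  (quadDecay q).mul_bounded (continuous_jost hκ q) (abs_jost_le hκ q)

include hκ in
lemma quadDecay_jostDeriv : QuadDecay (decayNorm 0 q * jostBound q) (jostDeriv κ q) :=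
  ((quadDecay_mul_jost hκ q).expTail hκ).neg

include hκ in
lemma hasDerivAt_jost (x : ℝ) : HasDerivAt (jost κ q) (jostDeriv κ q x) x := by
  have h := ((quadDecay_mul_jost hκ q).hasDerivAt_volterra hκ x).const_add 1
  exact h.congr_of_eventuallyEq (Eventually.of_forall (jost_eq hκ q))

include hκ in
lemma hasDerivAt_jostDeriv (x : ℝ) :
    HasDerivAt (jostDeriv κ q) (2 * κ * jostDeriv κ q x + q x * jost κ q x) x :=
  ((quadDecay_mul_jost hκ q).hasDerivAt_expTail (by linarith) x).neg.congr_deriv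
    (by simp only [jostDeriv]; ring)

include hκ in
lemma tendsto_jost_atTop : Tendsto (jost κ q) atTop (𝓝 1) := by
  have h := ((quadDecay_mul_jost hκ q).tendsto_volterra_atTop hκ).const_add 1
  rw [add_zero] at h
  exact h.congr fun x => (jost_eq hκ q x).symm

include hκ in
lemma tendsto_jost_atBot : Tendsto (jost κ q) atBot (𝓝 (jostLim κ q)) :=
  (((quadDecay_mul_jost hκ q).tendsto_volterra_atBot hκ).const_add 1).congr
    fun x => (jost_eq hκ q x).symm

include hκ in
-- Subtracting the two Volterra equations gives a Volterra equation with potential `q` for the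
-- difference, with source the Volterra integral of `(q' - q) * jost κ q'`. The stability estimate
-- then applies.
lemma abs_jost_sub_le (q' : 𝓢(ℝ, ℝ)) (x : ℝ) :
    |jost κ q' x - jost κ q x| ≤ 3 * decayNorm 0 (q' - q) * jostBound q' * jostBound q := by
  have h1 := quadDecay_mul_jost hκ q'
  have h2 := quadDecay_mul_jost hκ q
  have h3 : QuadDecay (decayNorm 0 (q' - q) * jostBound q') (fun y => (q' - q) y * jost κ q' y) :=
    (quadDecay (q' - q)).mul_bounded (continuous_jost hκ q') (abs_jost_le hκ q')
  have hb : ∀ y, |jost κ q' y - jost κ q y| ≤ jostBound q' + jostBound q := fun y =>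
    (abs_sub _ _).trans (add_le_add (abs_jost_le hκ q' y) (abs_jost_le hκ q y))
  have h5 := (quadDecay q).mul_bounded (h := fun y => jost κ q' y - jost κ q y)
    ((continuous_jost hκ q').sub (continuous_jost hκ q)) hb
  have h4 := (quadDecay q).abs_le_of_volterra hκ (u := fun y => jost κ q' y - jost κ q y)
    ((continuous_jost hκ q').sub (continuous_jost hκ q)) hb
    (b := 3 * (decayNorm 0 (q' - q) * jostBound q')) (fun y => by
      have h6 : jost κ q' y - jost κ q y - volterra κ (fun y => q y * (jost κ q' y - jost κ q y)) y =
          volterra κ (fun y => (q' - q) y * jost κ q' y) y := by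
        rw [jost_eq hκ q' y, jost_eq hκ q y]
        have h7 := (h3.volterra_add hκ h5 y).symm
        have h8 := h1.volterra_sub hκ h2 y
        have h9 : (fun y => (q' - q) y * jost κ q' y + q y * (jost κ q' y - jost κ q y)) =
          fun y => q' y * jost κ q' y - q y * jost κ q y := by
          funext z; simp only [sub_apply]; ring
        rw [h9] at h7
        linarith
      rw [h6]
      exact h3.abs_volterra_le hκ y) x
  refine h4.trans (le_of_eq ?_)
  rw [jostBound, jostBound]; ring

lemma continuous_jostBound : Continuous jostBound := by
  unfold jostBound
  exact continuous_const.mul (Real.continuous_exp.comp ((continuous_decayNorm 0).mul continuous_const))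

include hκ in
lemma eventually_abs_jost_sub_le {ε : ℝ} (hε : 0 < ε) :
    ∀ᶠ q' in 𝓝 q, ∀ x, |jost κ q' x - jost κ q x| ≤ ε := by
  have h : Tendsto (fun q' => 3 * decayNorm 0 (q' - q) * jostBound q' * jostBound q) (𝓝 q) (𝓝 0) := by
    have := (((tendsto_decayNorm_sub 0 q).const_mul 3).mul (continuous_jostBound.tendsto q)).mul_const
      (jostBound q)
    simpa using this
  filter_upwards [h.eventually (ge_mem_nhds hε)] with q' hq' x
  exact (abs_jost_sub_le hκ q q' x).trans hq'

include hκ in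
-- The Jost solutions are close uniformly in `x`, so the estimate passes to the limit at `-∞`.
lemma continuous_jostLim : Continuous (jostLim κ) := by
  refine continuous_iff_continuousAt.2 fun q => Metric.tendsto_nhds.2 fun ε hε => ?_
  filter_upwards [eventually_abs_jost_sub_le hκ q (half_pos hε)] with q' hq'
  refine lt_of_le_of_lt ?_ (half_lt_self hε)
  exact le_of_tendsto ((tendsto_jost_atBot hκ q').sub (tendsto_jost_atBot hκ q)).abs
    (Eventually.of_forall hq')

end Jost

/-! ### The KdV vector field -/

/-- `f` has quadratic decay with some constant. -/
def HasQuadDecay (f : ℝ → ℝ) : Prop := ∃ B, QuadDecay B f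

namespace HasQuadDecay
variable {f h : ℝ → ℝ}
lemma add (hf : HasQuadDecay f) (hh : HasQuadDecay h) : HasQuadDecay (fun x => f x + h x) :=
  ⟨_, hf.choose_spec.add hh.choose_spec⟩
lemma sub (hf : HasQuadDecay f) (hh : HasQuadDecay h) : HasQuadDecay (fun x => f x - h x) :=
  ⟨_, hf.choose_spec.sub hh.choose_spec⟩
lemma mul (hf : HasQuadDecay f) (hh : HasQuadDecay h) : HasQuadDecay (fun x => f x * h x) :=
  ⟨_, hf.choose_spec.mul hh.choose_spec⟩
lemma const_mul (hf : HasQuadDecay f) (c : ℝ) : HasQuadDecay (fun x => c * f x) :=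
  ⟨_, hf.choose_spec.const_mul c⟩
lemma neg (hf : HasQuadDecay f) : HasQuadDecay (fun x => -f x) := ⟨_, hf.choose_spec.neg⟩
lemma comp_neg (hf : HasQuadDecay f) : HasQuadDecay (fun x => f (-x)) :=
  ⟨_, hf.choose_spec.comp_neg⟩
lemma mul_bounded (hf : HasQuadDecay f) {C : ℝ} (hc : Continuous h) (hh : ∀ x, |h x| ≤ C) :
    HasQuadDecay (fun x => f x * h x) := ⟨_, hf.choose_spec.mul_bounded hc hh⟩
lemma integrable (hf : HasQuadDecay f) : Integrable f := hf.choose_spec.integrable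
lemma continuous (hf : HasQuadDecay f) : Continuous f := hf.choose_spec.continuous
lemma tendsto_atTop (hf : HasQuadDecay f) : Tendsto f atTop (𝓝 0) := hf.choose_spec.tendsto_atTop
lemma tendsto_atBot (hf : HasQuadDecay f) : Tendsto f atBot (𝓝 0) := hf.choose_spec.tendsto_atBot
end HasQuadDecay

lemma hasQuadDecay_iteratedDeriv (k : ℕ) (f : 𝓢(ℝ, ℝ)) : HasQuadDecay (iteratedDeriv k f) :=
  ⟨_, quadDecay_iteratedDeriv k f⟩

lemma hasQuadDecay (f : 𝓢(ℝ, ℝ)) : HasQuadDecay f := ⟨_, quadDecay f⟩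

lemma hasQuadDecay_deriv (f : 𝓢(ℝ, ℝ)) : HasQuadDecay (deriv f) := ⟨_, quadDecay_deriv f⟩

/-- The right-hand side `-q''' + 6 q q'` of the KdV equation. -/
def kdvField (q : 𝓢(ℝ, ℝ)) (x : ℝ) : ℝ := -iteratedDeriv 3 q x + 6 * q x * deriv q x

/-- A bound for `kdvField`. -/
def kdvFieldBound (q : 𝓢(ℝ, ℝ)) : ℝ := decayNorm 3 q + 6 * decayNorm 0 q * decayNorm 1 q

lemma quadDecay_kdvField (q : 𝓢(ℝ, ℝ)) : QuadDecay (kdvFieldBound q) (kdvField q) := by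
  have h := (quadDecay_iteratedDeriv 3 q).neg.add (((quadDecay q).const_mul 6).mul (quadDecay_deriv q))
  rw [abs_of_pos (by norm_num : (0 : ℝ) < 6), mul_comm (decayNorm 0 q) 6] at h
  exact h

lemma eventually_abs_kdvField_sub_le (q : 𝓢(ℝ, ℝ)) {ε : ℝ} (hε : 0 < ε) :
    ∀ᶠ q' in 𝓝 q, ∀ x, |kdvField q' x - kdvField q x| ≤ ε * (1 + x ^ 2)⁻¹ := by
  have h : Tendsto (fun q' => decayNorm 3 (q' - q) + (decayNorm 0 (q' - q) * 6) * decayNorm 1 q' +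
      decayNorm 0 q * 6 * decayNorm 1 (q' - q)) (𝓝 q) (𝓝 0) := by
    have := ((tendsto_decayNorm_sub 3 q).add (((tendsto_decayNorm_sub 0 q).mul_const 6).mul
      ((continuous_decayNorm 1).tendsto q))).add
        ((tendsto_decayNorm_sub 1 q).const_mul (decayNorm 0 q * 6))
    simpa using this
  filter_upwards [h.eventually (ge_mem_nhds hε)] with q' hq' x
  have h1 := ((quadDecay_iteratedDeriv 3 (q' - q)).neg.add
    (((quadDecay (q' - q)).const_mul 6).mul (quadDecay_deriv q'))).add
    (((quadDecay q).const_mul 6).mul (quadDecay_deriv (q' - q)))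
  rw [abs_of_pos (by norm_num : (0 : ℝ) < 6)] at h1
  have h2 : kdvField q' x - kdvField q x = -iteratedDeriv 3 (q' - q : 𝓢(ℝ, ℝ)) x +
      6 * (q' - q) x * deriv q' x + 6 * q x * deriv (q' - q : 𝓢(ℝ, ℝ)) x := by
    have h3 : iteratedDeriv 3 (q' - q : 𝓢(ℝ, ℝ)) x = iteratedDeriv 3 q' x - iteratedDeriv 3 q x :=
      iteratedDeriv_sub (q'.smooth 3).contDiffAt (q.smooth 3).contDiffAt
    have h4 : deriv (q' - q : 𝓢(ℝ, ℝ)) x = deriv q' x - deriv q x :=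
      deriv_sub q'.differentiableAt q.differentiableAt
    rw [h3, h4, sub_apply, kdvField, kdvField]; ring
  rw [h2]
  exact (h1.bound x).trans (mul_le_mul_of_nonneg_right hq' (one_add_sq_inv_pos x).le)

/-- The field is the derivative of `-q'' + 3q²`. -/
lemma integral_kdvField (q : 𝓢(ℝ, ℝ)) : ∫ x, kdvField q x = 0 := by
  have hd : ∀ x, HasDerivAt (fun x => -iteratedDeriv 2 q x + 3 * (q x * q x)) (kdvField q x) x :=
    fun x => ((hasDerivAt_iteratedDeriv 2 q x).neg.add
      (((hasDerivAt_schwartz q x).mul (hasDerivAt_schwartz q x)).const_mul 3)).congr_deriv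
      (by simp only [kdvField]; ring)
  have h := (hasQuadDecay_iteratedDeriv 2 q).neg.add (((hasQuadDecay q).mul (hasQuadDecay q)).const_mul 3)
  rw [integral_of_hasDerivAt_of_tendsto hd (quadDecay_kdvField q).integrable h.tendsto_atBot
    h.tendsto_atTop, sub_zero]

/-! ### Differentiability in time of Schwartz solutions -/

lemma hasDerivAt_of_eventually_abs_le {φ : ℝ → ℝ} {c t : ℝ}
    (h : ∀ ε > 0, ∀ᶠ s in 𝓝 t, |φ s - φ t - (s - t) * c| ≤ ε * |s - t|) : HasDerivAt φ c t := by
  rw [hasDerivAt_iff_isLittleO, Asymptotics.isLittleO_iff]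
  intro ε hε
  simpa using h ε hε

namespace IsSchwartzSolution

variable {q : ℝ → 𝓢(ℝ, ℝ)} (hq : IsSchwartzSolution q)

include hq in
/-- A Schwartz solution is differentiable in time in the weighted sup norm. -/
lemma eventually_abs_sub_le (t : ℝ) {ε : ℝ} (hε : 0 < ε) : ∀ᶠ s in 𝓝 t, ∀ x,
    |q s x - q t x - (s - t) * kdvField (q t) x| ≤ ε * |s - t| * (1 + x ^ 2)⁻¹ := by
  have h1 := (hq.continuous.tendsto t).eventually (eventually_abs_kdvField_sub_le (q t) hε)
  obtain ⟨r, hr, h2⟩ := Metric.eventually_nhds_iff_ball.1 h1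
  filter_upwards [Metric.ball_mem_nhds t hr] with s hs x
  -- The mean value inequality at each fixed `x`. Its derivative bound carries the weight `(1 +
  -- x²)⁻¹`, by continuity of the field along the curve, which upgrades the pointwise equation to a
  -- uniform weighted one.
  have h3 := (convex_ball t r).norm_image_sub_le_of_norm_hasDerivWithin_le
    (f := fun s => q s x - (s - t) * kdvField (q t) x)
    (f' := fun s => kdvField (q s) x - kdvField (q t) x) (C := ε * (1 + x ^ 2)⁻¹)
    (fun s _ => ?_) (fun s hs => h2 s hs x) (Metric.mem_ball_self hr) hs
  · rw [Real.norm_eq_abs, Real.norm_eq_abs] at h3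
    convert h3 using 1
    · congr 1; ring
    · ring
  · have h4 := (hq.equation s x).sub (((hasDerivAt_id s).sub_const t).mul_const (kdvField (q t) x))
    exact (h4.congr_deriv (by simp [kdvField])).hasDerivWithinAt

include hq in
lemma hasDerivAt_integral_mul {w : ℝ → ℝ} (hw : Continuous w) (hw1 : ∀ x, |w x| ≤ 1) (t : ℝ) :
    HasDerivAt (fun s => ∫ y, w y * q s y) (∫ y, w y * kdvField (q t) y) t := by
  refine hasDerivAt_of_eventually_abs_le fun ε hε => ?_
  have hπ := Real.pi_pos
  filter_upwards [hq.eventually_abs_sub_le t (div_pos hε hπ)] with s hs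
  have hi : ∀ {f : ℝ → ℝ}, HasQuadDecay f → Integrable fun y => w y * f y := fun hf => by
    simpa [mul_comm] using (hf.mul_bounded hw hw1).integrable
  have hF : HasQuadDecay (kdvField (q t)) := ⟨_, quadDecay_kdvField (q t)⟩
  rw [← integral_const_mul, ← integral_sub (hi (hasQuadDecay _)) (hi (hasQuadDecay _)),
    ← integral_sub (f := fun y => w y * q s y - w y * q t y)
      ((hi (hasQuadDecay _)).sub (hi (hasQuadDecay _))) ((hi hF).const_mul _),
    ← Real.norm_eq_abs]
  calc ‖∫ y, (w y * q s y - w y * q t y - (s - t) * (w y * kdvField (q t) y))‖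
      ≤ ∫ y, ε / Real.pi * |s - t| * (1 + y ^ 2)⁻¹ := by
        refine norm_integral_le_of_norm_le (integrable_inv_one_add_sq.const_mul _)
          (Eventually.of_forall fun y => ?_)
        rw [show w y * q s y - w y * q t y - (s - t) * (w y * kdvField (q t) y) =
          w y * (q s y - q t y - (s - t) * kdvField (q t) y) by ring, Real.norm_eq_abs, abs_mul]
        exact (mul_le_of_le_one_left (abs_nonneg _) (hw1 y)).trans (hs y)
    _ = ε * |s - t| := by
        rw [integral_const_mul, integral_univ_inv_one_add_sq]; field_simp

include hq in
/-- Conservation of the integral. -/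
lemma integral_eq (t : ℝ) : ∫ x, q t x = ∫ x, q 0 x := by
  have h : ∀ s, HasDerivAt (fun s => ∫ y, q s y) 0 s := fun s => by
    have := hq.hasDerivAt_integral_mul (w := fun _ => 1) continuous_const (by simp) s
    simpa [integral_kdvField] using this
  exact is_const_of_deriv_eq_zero (fun s => (h s).differentiableAt) (fun s => (h s).deriv) t 0

end IsSchwartzSolution

/-! ### Evolution of the Jost solution -/

/-- The time derivative of the Jost solution along the KdV flow. -/
def jostDot (κ : ℝ) (q : 𝓢(ℝ, ℝ)) (x : ℝ) : ℝ :=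
  -deriv q x * jost κ q x + (2 * q x - 4 * κ ^ 2) * jostDeriv κ q x - 2 * κ * q x * jost κ q x

section JostDot
variable {κ : ℝ} (hκ : 1 ≤ κ) (q : 𝓢(ℝ, ℝ))

include hκ in
lemma hasQuadDecay_mul_jost {f : ℝ → ℝ} (hf : HasQuadDecay f) :
    HasQuadDecay (fun x => f x * jost κ q x) :=
  hf.mul_bounded (continuous_jost hκ q) (abs_jost_le hκ q)

include hκ in
-- Every term contains `q`, `q'` or `m'`. This reflects the normalization of the Lax evolution `ψₜ =
-- (2q - 4κ²)ψ' - q'ψ - 4κ³ψ` for `ψ = e^{-κx}m`, whose last term cancels the only nondecaying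
-- contribution. Decay at `-∞` is what makes `jostLim` constant.
lemma hasQuadDecay_jostDot : HasQuadDecay (jostDot κ q) := by
  have hp : HasQuadDecay (jostDeriv κ q) := ⟨_, quadDecay_jostDeriv hκ q⟩
  have h := ((((hasQuadDecay_mul_jost hκ q (hasQuadDecay_deriv q)).neg.add
    (((hasQuadDecay q).mul hp).const_mul 2)).sub (hp.const_mul (4 * κ ^ 2)))).sub
    ((hasQuadDecay_mul_jost hκ q (hasQuadDecay q)).const_mul (2 * κ))
  convert h using 2
  simp only [jostDot]; ring

include hκ in
-- The right side is the time-linearization of the Volterra equation for `m`. By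
-- `QuadDecay.eq_volterra` it is enough to check the differential equation, which is the Lax
-- identity for KdV.
lemma jostDot_eq (x : ℝ) : jostDot κ q x =
    volterra κ (fun y => q y * jostDot κ q y + kdvField q y * jost κ q y) x := by
  have hp : HasQuadDecay (jostDeriv κ q) := ⟨_, quadDecay_jostDeriv hκ q⟩
  have hm : ∀ {f}, HasQuadDecay f → HasQuadDecay (fun x => f x * jost κ q x) :=
    fun hf => hasQuadDecay_mul_jost hκ q hf
  have hq0 := hasQuadDecay q
  have hq1 := hasQuadDecay_deriv q
  obtain ⟨B, hB⟩ : HasQuadDecay (fun y => q y * jostDot κ q y + kdvField q y * jost κ q y) :=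
    (hq0.mul (hasQuadDecay_jostDot hκ q)).add (hm ⟨_, quadDecay_kdvField q⟩)
  -- This function is the `x`-derivative of `jostDot`; its boundedness excludes a component growing
  -- like `e^{2κx}`.
  obtain ⟨C, hC⟩ : HasQuadDecay (fun x => -(iteratedDeriv 2 q x * jost κ q x) + deriv q x * jostDeriv κ q x
      + (2 * (q x * (2 * κ * jostDeriv κ q x + q x * jost κ q x))
        - 4 * κ ^ 2 * (2 * κ * jostDeriv κ q x + q x * jost κ q x))
      - 2 * κ * (deriv q x * jost κ q x + q x * jostDeriv κ q x)) := by
    have h1 : HasQuadDecay (fun x => 2 * κ * jostDeriv κ q x + q x * jost κ q x) :=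
      (hp.const_mul _).add (hm hq0)
    exact (((hm (hasQuadDecay_iteratedDeriv 2 q)).neg.add (hq1.mul hp)).add
      (((hq0.mul h1).const_mul 2).sub (h1.const_mul _))).sub
      (((hm hq1).add (hq0.mul hp)).const_mul _)
  have dq := hasDerivAt_schwartz q
  have dq1 := hasDerivAt_deriv_schwartz q
  have dq2 := hasDerivAt_iteratedDeriv 2 q
  have dm := hasDerivAt_jost hκ q
  have dp := hasDerivAt_jostDeriv hκ q
  refine hB.eq_volterra hκ (u := jostDot κ q) (fun y => ?_) (fun y => ?_) hC.abs_le
    (hasQuadDecay_jostDot hκ q).tendsto_atTop x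
  · exact ((((dq1 y).neg.mul (dm y)).add ((((dq y).const_mul 2).sub_const (4 * κ ^ 2)).mul (dp y))).sub
      (((dq y).const_mul (2 * κ)).mul (dm y))).congr_deriv (by simp only [Pi.neg_apply]; ring)
  · have d1 : HasDerivAt (fun y => 2 * κ * jostDeriv κ q y + q y * jost κ q y) _ y :=
      ((dp y).const_mul (2 * κ)).add ((dq y).mul (dm y))
    exact (((((dq2 y).mul (dm y)).neg.add ((dq1 y).mul (dp y))).add
      ((((dq y).mul d1).const_mul 2).sub (d1.const_mul (4 * κ ^ 2)))).sub
      ((((dq1 y).mul (dm y)).add ((dq y).mul (dp y))).const_mul (2 * κ))).congr_deriv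
      (by simp only [jostDot, kdvField]; ring)

variable {q : ℝ → 𝓢(ℝ, ℝ)} (hq : IsSchwartzSolution q)

include hκ hq in
-- The first-order remainder of `m` in time solves the Volterra equation with potential `q t`. The
-- density of its source is the remainder of `q` times `m`, plus `(s - t)` times the field times the
-- increment of `m`. Both are `o(s - t)` in the weighted norm.
lemma IsSchwartzSolution.eventually_abs_jost_sub_le (t : ℝ) {ε : ℝ} (hε : 0 < ε) :
    ∀ᶠ s in 𝓝 t, ∀ x,
      |jost κ (q s) x - jost κ (q t) x - (s - t) * jostDot κ (q t) x| ≤ ε * |s - t| := by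
  set E := Real.exp (decayNorm 0 (q t) * Real.pi)
  have hE : 0 < E := Real.exp_pos _
  set M := jostBound (q t) + 1
  have hM : 0 < M := by
    have : 0 < jostBound (q t) := by unfold jostBound; positivity
    positivity
  set F := kdvFieldBound (q t)
  have hFq := quadDecay_kdvField (q t)
  have hF : 0 ≤ F := hFq.nonneg
  have hM' : ∀ᶠ s in 𝓝 t, jostBound (q s) ≤ M :=
    ((continuous_jostBound.comp hq.continuous).tendsto t).eventually (ge_mem_nhds (lt_add_one _))
  -- The stability estimate multiplies each source term by `2 · 3 · E`; the factor `12` leaves at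
  -- most `ε/2` for each. `F + 1` avoids a zero denominator.
  filter_upwards [hq.eventually_abs_sub_le t (show 0 < ε / (12 * E * M) by positivity), hM',
    (hq.continuous.tendsto t).eventually (KdV.eventually_abs_jost_sub_le hκ (q t)
      (show 0 < ε / (12 * E * (F + 1)) by positivity))] with s h1 h2 h3 x
  set ε₁ := ε / (12 * E * M)
  set ε₂ := ε / (12 * E * (F + 1))
  have cs := continuous_jost hκ (q s)
  have ct := continuous_jost hκ (q t)
  have hn := hasQuadDecay_jostDot hκ (q t)
  obtain ⟨D, hD⟩ := hn
  have d1 : QuadDecay (ε₁ * |s - t| * M)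
      (fun y => (q s y - q t y - (s - t) * kdvField (q t) y) * jost κ (q s) y) :=
    QuadDecay.mul_bounded ⟨by have := (q s).continuous; have := (q t).continuous
                              have := hFq.continuous; fun_prop, h1⟩ cs
      fun y => (abs_jost_le hκ (q s) y).trans h2
  have d2 : QuadDecay (F * ε₂ * |s - t|)
      (fun y => (s - t) * (kdvField (q t) y * (jost κ (q s) y - jost κ (q t) y))) :=
    (hFq.mul_bounded (cs.sub ct) h3).const_mul (s - t)
  have ds := quadDecay_mul_jost hκ (q s)
  have dt := quadDecay_mul_jost hκ (q t)
  have dn : HasQuadDecay (fun y => q t y * jostDot κ (q t) y + kdvField (q t) y * jost κ (q t) y) :=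
    ((hasQuadDecay (q t)).mul ⟨D, hD⟩).add (hasQuadDecay_mul_jost hκ (q t) ⟨_, hFq⟩)
  obtain ⟨D', hD'⟩ := dn
  have hu : Continuous fun y => jost κ (q s) y - jost κ (q t) y - (s - t) * jostDot κ (q t) y :=
    (cs.sub ct).sub (hD.continuous.const_mul _)
  have hb : ∀ y, |jost κ (q s) y - jost κ (q t) y - (s - t) * jostDot κ (q t) y| ≤
      ε₂ + |s - t| * D := fun y => by
    refine (abs_sub _ _).trans (add_le_add (h3 y) ?_)
    rw [abs_mul]
    exact mul_le_mul_of_nonneg_left (hD.abs_le y) (abs_nonneg _)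
  have h4 := (quadDecay (q t)).abs_le_of_volterra hκ hu hb
    (b := 3 * (ε₁ * |s - t| * M + F * ε₂ * |s - t|)) (fun y => by
      have e1 := (d1.add d2).abs_volterra_le hκ y
      have e2 := ds.volterra_sub hκ dt y
      have e3 := (ds.sub dt).volterra_sub hκ (hD'.const_mul (s - t)) y
      rw [volterra_const_mul] at e3
      have e4 := (quadDecay (q t)).mul_bounded hu hb
      have e5 := e4.volterra_add hκ (d1.add d2) y
      have e6 : (fun y => q t y * (jost κ (q s) y - jost κ (q t) y - (s - t) * jostDot κ (q t) y) +
          ((q s y - q t y - (s - t) * kdvField (q t) y) * jost κ (q s) y +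
            (s - t) * (kdvField (q t) y * (jost κ (q s) y - jost κ (q t) y)))) =
          fun y => q s y * jost κ (q s) y - q t y * jost κ (q t) y -
            (s - t) * (q t y * jostDot κ (q t) y + kdvField (q t) y * jost κ (q t) y) := by
        funext z; ring
      rw [e6, e3, e2] at e5
      have e7 : jost κ (q s) y - jost κ (q t) y - (s - t) * jostDot κ (q t) y -
          volterra κ (fun y => q t y * (jost κ (q s) y - jost κ (q t) y -
            (s - t) * jostDot κ (q t) y)) y =
          volterra κ (fun y => (q s y - q t y - (s - t) * kdvField (q t) y) * jost κ (q s) y +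
            (s - t) * (kdvField (q t) y * (jost κ (q s) y - jost κ (q t) y))) y := by
        have f1 := jost_eq hκ (q s) y
        have f2 := jost_eq hκ (q t) y
        have f3 := jostDot_eq hκ (q t) y
        rw [← f3] at e5
        linarith
      rw [e7]; exact e1) x
  refine h4.trans ?_
  have g1 : ε₁ * (12 * E * M) = ε := div_mul_cancel₀ _ (by positivity)
  have g2 : ε₂ * (12 * E * (F + 1)) = ε := div_mul_cancel₀ _ (by positivity)
  have g3 : 0 < ε₂ := by positivity
  have g4 : 2 * (3 * (ε₁ * M + F * ε₂)) * E ≤ ε := by nlinarith [mul_pos g3 hE]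
  calc 2 * (3 * (ε₁ * |s - t| * M + F * ε₂ * |s - t|)) * E
      = (2 * (3 * (ε₁ * M + F * ε₂)) * E) * |s - t| := by ring
    _ ≤ ε * |s - t| := mul_le_mul_of_nonneg_right g4 (abs_nonneg _)

include hκ hq in
lemma IsSchwartzSolution.hasDerivAt_jost (t x : ℝ) :
    HasDerivAt (fun s => jost κ (q s) x) (jostDot κ (q t) x) t :=
  hasDerivAt_of_eventually_abs_le fun _ hε =>
    (hq.eventually_abs_jost_sub_le hκ t hε).mono fun _ h => h x

include hκ hq in
/-- Conservation of the limit of the Jost solution at `-∞`. -/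
lemma IsSchwartzSolution.jostLim_eq (t : ℝ) : jostLim κ (q t) = jostLim κ (q 0) := by
  have h : ∀ s, HasDerivAt (fun s => jostLim κ (q s)) 0 s := fun t => by
    refine hasDerivAt_of_eventually_abs_le fun ε hε => ?_
    filter_upwards [hq.eventually_abs_jost_sub_le hκ t hε] with s hs
    have h1 := (((tendsto_jost_atBot hκ (q s)).sub (tendsto_jost_atBot hκ (q t))).sub
      ((hasQuadDecay_jostDot hκ (q t)).tendsto_atBot.const_mul (s - t))).abs
    exact le_of_tendsto h1 (Eventually.of_forall hs)
  exact is_const_of_deriv_eq_zero (fun s => (h s).differentiableAt) (fun s => (h s).deriv) t 0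

end JostDot

/-! ### Positivity of the Jost solution -/

/-- The Jost solution is positive, including at `-∞`. -/
def JostPos (κ : ℝ) (q : 𝓢(ℝ, ℝ)) : Prop := (∀ x, 0 < jost κ q x) ∧ 0 < jostLim κ q

lemma exists_pos_le_of_tendsto {f : ℝ → ℝ} (hc : Continuous f) (hf : ∀ x, 0 < f x) {a b : ℝ}
    (ha : 0 < a) (hb : 0 < b) (hfa : Tendsto f atBot (𝓝 a)) (hfb : Tendsto f atTop (𝓝 b)) :
    ∃ c, 0 < c ∧ ∀ x, c ≤ f x := by
  obtain ⟨A, hA⟩ := eventually_atBot.1 (hfa.eventually (le_mem_nhds (half_lt_self ha)))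
  obtain ⟨D, hD⟩ := eventually_atTop.1 (hfb.eventually (le_mem_nhds (half_lt_self hb)))
  obtain ⟨z, -, hz⟩ := (isCompact_Icc (a := min A D) (b := max A D)).exists_isMinOn
    (nonempty_Icc.2 min_le_max) hc.continuousOn
  refine ⟨min (f z) (min (a / 2) (b / 2)), by have := hf z; positivity, fun x => ?_⟩
  rcases le_total x A with h | h
  · exact (min_le_right _ _).trans ((min_le_left _ _).trans (hA x h))
  rcases le_total D x with h' | h'
  · exact (min_le_right _ _).trans ((min_le_right _ _).trans (hD x h'))
  · exact (min_le_left _ _).trans (hz ⟨(min_le_left _ _).trans h, h'.trans (le_max_right _ _)⟩)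

section Pos
variable {κ : ℝ} (hκ : 1 ≤ κ)

include hκ in
lemma JostPos.exists_le {q : 𝓢(ℝ, ℝ)} (h : JostPos κ q) : ∃ c, 0 < c ∧ ∀ x, c ≤ jost κ q x :=
  exists_pos_le_of_tendsto (continuous_jost hκ q) h.1 h.2 one_pos (tendsto_jost_atBot hκ q)
    (tendsto_jost_atTop hκ q)

include hκ in
-- Positivity of both limits gives a uniform lower bound for `m`, a margin that survives uniformly
-- small perturbations.
lemma isOpen_jostPos : IsOpen {q | JostPos κ q} := by
  refine isOpen_iff_mem_nhds.2 fun q hq => ?_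
  obtain ⟨c, hc, h⟩ := JostPos.exists_le hκ hq
  filter_upwards [eventually_abs_jost_sub_le hκ q (half_pos hc),
    ((continuous_jostLim hκ).tendsto q).eventually (lt_mem_nhds hq.2)] with q' h1 h2
  exact ⟨fun x => by linarith [h x, (abs_le.1 (h1 x)).1], h2⟩

include hκ in
-- By uniqueness for the linear system satisfied by `(m, m')`, a double zero forces `m = 0`,
-- contrary to `m → 1` at `+∞`.
lemma jost_ne_zero_of_jostDeriv_eq_zero (q : 𝓢(ℝ, ℝ)) {x : ℝ} (h : jost κ q x = 0)
    (h' : jostDeriv κ q x = 0) : False := by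
  set v : ℝ → ℝ × ℝ → ℝ × ℝ := fun t p => (p.2, 2 * κ * p.2 + q t * p.1) with hv
  have hL : ∀ t, LipschitzOnWith (Real.toNNReal (2 * κ + decayNorm 0 q + 1)) (v t) univ := by
    intro t
    refine LipschitzOnWith.of_dist_le_mul fun p _ r _ => ?_
    have hN := decayNorm_nonneg 0 q
    rw [Real.coe_toNNReal _ (by positivity), dist_eq_norm, dist_eq_norm]
    have h1 : |p.1 - r.1| ≤ ‖p - r‖ := norm_fst_le (p - r)
    have h2 : |p.2 - r.2| ≤ ‖p - r‖ := norm_snd_le (p - r)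
    have h3 := norm_nonneg (p - r)
    refine (Prod.norm_def _).le.trans (max_le ?_ ?_)
    · refine h2.trans (le_mul_of_one_le_left h3 (by linarith))
    · have h4 := (quadDecay q).abs_le t
      simp only [hv, Prod.snd_sub, Real.norm_eq_abs]
      calc |2 * κ * p.2 + q t * p.1 - (2 * κ * r.2 + q t * r.1)|
          = |2 * κ * (p.2 - r.2) + q t * (p.1 - r.1)| := by ring_nf
        _ ≤ |2 * κ| * |p.2 - r.2| + |q t| * |p.1 - r.1| := by
            rw [← abs_mul, ← abs_mul]; exact abs_add_le _ _
        _ ≤ (2 * κ) * ‖p - r‖ + decayNorm 0 q * ‖p - r‖ := by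
            rw [abs_of_nonneg (by linarith : 0 ≤ 2 * κ)]; gcongr
        _ ≤ _ := by linarith
  have hz : (fun t => (jost κ q t, jostDeriv κ q t)) = fun _ => (0, 0) := by
    refine ODE_solution_unique_univ (v := v) (s := fun _ => univ) (t₀ := x) hL
      (fun t => ⟨?_, mem_univ _⟩) (fun t => ⟨?_, mem_univ _⟩) (by simp [h, h'])
    · exact (hasDerivAt_jost hκ q t).prodMk (hasDerivAt_jostDeriv hκ q t)
    · exact (hasDerivAt_const t ((0 : ℝ), (0 : ℝ))).congr_deriv (by simp [hv, Prod.ext_iff])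
  have h1 : ∀ t, jost κ q t = 0 := fun t => (Prod.ext_iff.1 (congrFun hz t)).1
  have h2 := tendsto_jost_atTop hκ q
  have h3 := tendsto_nhds_unique h2 (tendsto_const_nhds.congr fun t => (h1 t).symm)
  norm_num at h3

include hκ in
-- A zero of a nonnegative `m` is a minimum, hence a double zero.
lemma jostPos_of_nonneg {q : 𝓢(ℝ, ℝ)} (h : ∀ x, 0 ≤ jost κ q x) (ha : 0 < jostLim κ q) :
    JostPos κ q := by
  refine ⟨fun x => (h x).lt_of_ne fun h0 => ?_, ha⟩
  have hmin : IsLocalMin (jost κ q) x := Eventually.of_forall fun y => by rw [← h0]; exact h y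
  exact jost_ne_zero_of_jostDeriv_eq_zero hκ q h0.symm (hmin.hasDerivAt_eq_zero (hasDerivAt_jost hκ q x))

include hκ in
lemma jostPos_of_mem_closure {q : 𝓢(ℝ, ℝ)} (h : q ∈ closure {q | JostPos κ q})
    (ha : 0 < jostLim κ q) : JostPos κ q := by
  refine jostPos_of_nonneg hκ (fun x => le_of_forall_pos_le_add fun ε hε => ?_) ha
  obtain ⟨q', h1, h2⟩ := (mem_closure_iff_frequently.1 h).and_eventually
    (eventually_abs_jost_sub_le hκ q hε) |>.exists
  linarith [h1.1 x, (abs_le.1 (h2 x)).2]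

include hκ in
-- The set of good times is clopen. It is closed because limits of positive Jost solutions are
-- nonnegative and conservation of `jostLim` keeps the value at `-∞` positive.
lemma IsSchwartzSolution.jostPos {q : ℝ → 𝓢(ℝ, ℝ)} (hq : IsSchwartzSolution q)
    (h0 : JostPos κ (q 0)) (t : ℝ) : JostPos κ (q t) := by
  have hclopen : IsClopen {t | JostPos κ (q t)} := by
    refine ⟨isClosed_of_closure_subset fun t ht => ?_, (isOpen_jostPos hκ).preimage hq.continuous⟩
    refine jostPos_of_mem_closure hκ ?_ (by rw [hq.jostLim_eq hκ]; exact h0.2)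
    exact closure_mono (image_subset_iff.2 fun s hs => hs)
      (image_closure_subset_closure_image hq.continuous ⟨t, ht, rfl⟩)
  have := hclopen.eq_univ ⟨0, h0⟩
  exact (this ▸ mem_univ t : t ∈ {t | JostPos κ (q t)})

end Pos

/-! ### The `H⁻¹` norm in physical space -/

section Plancherel

open scoped FourierTransform

/-- The Fourier multiplier `1 / (2 - 2πiξ)`. -/
def resolventSymbol (ξ : ℝ) : ℂ :=
  (2 + 2 * Real.pi * Complex.I * ξ) * ((1 / 4 * (1 + ‖Real.pi * ξ‖ ^ 2) ^ (-1 : ℝ) : ℝ) : ℂ)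

lemma resolventSymbol_mul (ξ : ℝ) :
    (2 - 2 * Real.pi * Complex.I * ξ) * resolventSymbol ξ = 1 := by
  have h : (1 + (Real.pi * ξ) ^ 2 : ℝ) ≠ 0 := by positivity
  have h2 : ((1 + (Real.pi * ξ) ^ 2 : ℝ) : ℂ) ≠ 0 := by exact_mod_cast h
  rw [resolventSymbol, Real.rpow_neg_one, Real.norm_eq_abs, sq_abs, ← mul_assoc]
  push_cast at h2 ⊢
  have h3 : (2 - 2 * Real.pi * Complex.I * ξ) * (2 + 2 * Real.pi * Complex.I * ξ) =
      4 * (1 + (Real.pi * ξ : ℂ) ^ 2) := by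
    linear_combination (-4 * Real.pi ^ 2 * ξ ^ 2 : ℂ) * Complex.I_sq
  rw [h3]
  generalize (1 + (Real.pi * ξ : ℂ) ^ 2) = z at h2 ⊢
  field_simp

/-- The reason for writing the symbol as a polynomial times a power of `1 + ‖·‖²`. -/
lemma hasTemperateGrowth_resolventSymbol : Function.HasTemperateGrowth resolventSymbol := by
  have h1 : Function.HasTemperateGrowth fun ξ : ℝ => Real.pi * ξ :=
    (Function.HasTemperateGrowth.const Real.pi).mul Function.HasTemperateGrowth.id'
  have h2 := Function.HasTemperateGrowth.comp
    (Function.hasTemperateGrowth_one_add_norm_sq_rpow ℝ (-1)) h1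
  have h3 := Function.HasTemperateGrowth.comp Function.Complex.hasTemperateGrowth_ofReal
    ((Function.HasTemperateGrowth.const (1 / 4 : ℝ)).mul h2)
  have h4 : Function.HasTemperateGrowth fun ξ : ℝ => (2 + 2 * Real.pi * Complex.I * ξ : ℂ) :=
    (Function.HasTemperateGrowth.const (2 : ℂ)).add
      ((Function.HasTemperateGrowth.const (2 * Real.pi * Complex.I : ℂ)).mul
        Function.Complex.hasTemperateGrowth_ofReal)
  exact h4.mul h3

lemma normSq_resolventSymbol (ξ : ℝ) :
    ‖resolventSymbol ξ‖ ^ 2 = 1 / (4 + (2 * Real.pi * ξ) ^ 2) := by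
  have h := congrArg (fun z => ‖z‖ ^ 2) (resolventSymbol_mul ξ)
  simp only [norm_mul, mul_pow, norm_one, one_pow] at h
  have h2 : ‖(2 - 2 * Real.pi * Complex.I * ξ : ℂ)‖ ^ 2 = 4 + (2 * Real.pi * ξ) ^ 2 := by
    rw [← Complex.normSq_eq_norm_sq, Complex.normSq_apply]
    simp
    ring
  rw [h2] at h
  rw [eq_div_iff (by positivity), mul_comm]; exact h

/-- The complexification of a real Schwartz function. -/
def complexify (q : 𝓢(ℝ, ℝ)) : 𝓢(ℝ, ℂ) := SchwartzMap.postcompCLM Complex.ofRealCLM q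

lemma complexify_apply (q : 𝓢(ℝ, ℝ)) (x : ℝ) : complexify q x = q x := rfl

/-- `(2 - ∂)⁻¹ q` as a Schwartz function. -/
def schwartzResolvent (q : 𝓢(ℝ, ℝ)) : 𝓢(ℝ, ℂ) :=
  𝓕⁻ (SchwartzMap.smulLeftCLM ℂ resolventSymbol (𝓕 (complexify q)))

lemma fourier_schwartzResolvent (q : 𝓢(ℝ, ℝ)) (ξ : ℝ) :
    𝓕 (schwartzResolvent q) ξ = resolventSymbol ξ * 𝓕 (complexify q) ξ := by
  rw [schwartzResolvent, FourierTransform.fourier_fourierInv_eq,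
    SchwartzMap.smulLeftCLM_apply_apply hasTemperateGrowth_resolventSymbol, smul_eq_mul]

lemma schwartzResolvent_deriv (q : 𝓢(ℝ, ℝ)) (x : ℝ) :
    deriv (schwartzResolvent q) x = 2 * schwartzResolvent q x - q x := by
  set J := schwartzResolvent q
  have h : (2 : ℂ) • J - SchwartzMap.derivCLM ℂ ℂ J = complexify q := by
    have h1 : 𝓕 ((2 : ℂ) • J - SchwartzMap.derivCLM ℂ ℂ J) = 𝓕 (complexify q) := by
      ext ξ
      have h2 : 𝓕 (SchwartzMap.derivCLM ℂ ℂ J) ξ = (2 * Real.pi * Complex.I * ξ) • 𝓕 J ξ := by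
        have := Real.fourier_deriv J.integrable J.differentiable
          (SchwartzMap.derivCLM ℂ ℂ J).integrable
        exact congrFun this ξ
      rw [sub_eq_add_neg, ← neg_one_smul ℂ (SchwartzMap.derivCLM ℂ ℂ J), FourierTransform.fourier_add, FourierTransform.fourier_smul, FourierTransform.fourier_smul, add_apply, smul_apply, smul_apply, h2,
        fourier_schwartzResolvent, smul_eq_mul, smul_eq_mul, smul_eq_mul]
      linear_combination (𝓕 (complexify q) ξ) * resolventSymbol_mul ξ
    have := congrArg (fun f : 𝓢(ℝ, ℂ) => 𝓕⁻ f) h1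
    simpa only [FourierTransform.fourierInv_fourier_eq] using this
  have h3 : (2 : ℂ) • J x - deriv J x = q x := DFunLike.congr_fun h x
  rw [smul_eq_mul] at h3
  linear_combination -h3

/-- Both sides are bounded solutions of `j' = 2j - q`. Treating real and imaginary parts separately
avoids computing a Fourier integral. -/
lemma schwartzResolvent_eq (q : 𝓢(ℝ, ℝ)) (x : ℝ) :
    schwartzResolvent q x = (expTail 1 q x : ℂ) := by
  set J := schwartzResolvent q
  have hd : ∀ y, HasDerivAt J (2 * J y - q y) y := fun y =>
    schwartzResolvent_deriv q y ▸ (J.differentiableAt).hasDerivAt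
  have hb : ∀ y, ‖J y‖ ≤ SchwartzMap.seminorm ℝ 0 0 J := fun y => J.norm_le_seminorm ℝ y
  have hre : ∀ y, HasDerivAt (fun y => (J y).re) (2 * 1 * (J y).re - q y) y := fun y => by
    have := (Complex.reCLM.hasFDerivAt.comp_hasDerivAt y (hd y))
    exact this.congr_deriv (by simp)
  have him : ∀ y, HasDerivAt (fun y => (J y).im) (2 * 1 * (J y).im) y := fun y => by
    have := (Complex.imCLM.hasFDerivAt.comp_hasDerivAt y (hd y))
    exact this.congr_deriv (by simp)
  apply Complex.ext
  · rw [Complex.ofReal_re]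
    exact (quadDecay q).eq_expTail le_rfl hre
      (fun y => (Complex.abs_re_le_norm _).trans (hb y)) x
  · rw [Complex.ofReal_im]
    exact eq_zero_of_deriv_eq_of_bounded one_pos him
      (fun y => (Complex.abs_im_le_norm _).trans (hb y)) x

lemma fourierHat_eq (q : 𝓢(ℝ, ℝ)) (ξ : ℝ) :
    fourierHat q ξ = ((1 / Real.sqrt (2 * Real.pi) : ℝ) : ℂ) *
      𝓕 (complexify q) ((2 * Real.pi)⁻¹ * ξ) := by
  rw [fourierHat, SchwartzMap.fourier_coe, Real.fourier_real_eq_integral_exp_smul]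
  congr 2
  funext x
  rw [smul_eq_mul, complexify_apply]
  congr 2
  have : (Real.pi : ℂ) ≠ 0 := by exact_mod_cast Real.pi_ne_zero
  push_cast
  field_simp

/-- Plancherel, with `4 + ξ² = |2 - iξ|²` the squared symbol of `2 - ∂`. -/
lemma hNegOneNorm_eq (q : 𝓢(ℝ, ℝ)) :
    hNegOneNorm q = Real.sqrt (∫ x, expTail 1 q x ^ 2) := by
  have hπ := Real.pi_pos
  rw [hNegOneNorm]
  congr 1
  have h1 : ∀ ξ : ℝ, ‖fourierHat q ξ‖ ^ 2 / (4 + ξ ^ 2) =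
      (2 * Real.pi)⁻¹ * ‖𝓕 (schwartzResolvent q) ((2 * Real.pi)⁻¹ * ξ)‖ ^ 2 := fun ξ => by
    rw [fourier_schwartzResolvent, fourierHat_eq, norm_mul, norm_mul, mul_pow, mul_pow,
      normSq_resolventSymbol, Complex.norm_real, Real.norm_eq_abs, sq_abs, div_pow,
      Real.sq_sqrt (by positivity)]
    field_simp
  simp_rw [h1]
  rw [integral_const_mul, Measure.integral_comp_mul_left
    (fun ξ => ‖𝓕 (schwartzResolvent q) ξ‖ ^ 2) (2 * Real.pi)⁻¹, inv_inv, abs_of_pos (by positivity),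
    smul_eq_mul, inv_mul_cancel_left₀ (by positivity), SchwartzMap.integral_norm_sq_fourier]
  congr 1
  funext x
  rw [schwartzResolvent_eq, Complex.norm_real, Real.norm_eq_abs, sq_abs]

end Plancherel

/-! ### `L²` bounds for exponential tails -/

section L2bounds

variable {κ B : ℝ} (hκ : 1 ≤ κ) {h : ℝ → ℝ}

include hκ in
lemma HasQuadDecay.expTail (hh : HasQuadDecay h) : HasQuadDecay (expTail κ h) :=
  ⟨_, hh.choose_spec.expTail hκ⟩

lemma HasQuadDecay.integrable_sq (hh : HasQuadDecay h) : Integrable fun x => h x ^ 2 := by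
  simpa only [sq] using (hh.mul hh).integrable

include hκ in
lemma HasQuadDecay.hasDerivAt_expTail (hh : HasQuadDecay h) (x : ℝ) :
    HasDerivAt (KdV.expTail κ h) (2 * κ * KdV.expTail κ h x - h x) x :=
  hh.choose_spec.hasDerivAt_expTail (by linarith) x

include hκ in
lemma HasQuadDecay.eq_expTail (hh : HasQuadDecay h) {j : ℝ → ℝ} (hj : HasQuadDecay j)
    (hd : ∀ x, HasDerivAt j (2 * κ * j x - h x) x) (x : ℝ) : j x = KdV.expTail κ h x :=
  hh.choose_spec.eq_expTail hκ hd hj.choose_spec.abs_le x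

include hκ in
-- Integrate the derivative of `(expTail κ h)²`. Both `L²` bounds below follow from this identity.
lemma HasQuadDecay.integral_expTail_sq (hh : HasQuadDecay h) :
    2 * κ * ∫ x, KdV.expTail κ h x ^ 2 = ∫ x, h x * KdV.expTail κ h x := by
  have hj := hh.expTail hκ
  have hd : ∀ x, HasDerivAt (fun x => KdV.expTail κ h x * KdV.expTail κ h x)
      (2 * (2 * κ * KdV.expTail κ h x ^ 2 - h x * KdV.expTail κ h x)) x := fun x =>
    ((hh.hasDerivAt_expTail hκ x).mul (hh.hasDerivAt_expTail hκ x)).congr_deriv (by ring)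
  have h2 := (hj.integrable_sq.const_mul (2 * κ)).sub (hh.mul hj).integrable
  have h1 := integral_of_hasDerivAt_of_tendsto hd (h2.const_mul 2) (hj.mul hj).tendsto_atBot
    (hj.mul hj).tendsto_atTop
  rw [integral_const_mul, integral_sub (hj.integrable_sq.const_mul (2 * κ)) (hh.mul hj).integrable,
    integral_const_mul] at h1
  linarith

include hκ in
/-- `L¹ → L²` bound. -/
lemma HasQuadDecay.integral_expTail_sq_le (hh : HasQuadDecay h) :
    ∫ x, KdV.expTail κ h x ^ 2 ≤ 1 / 2 * (∫ x, |h x|) ^ 2 := by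
  have hj := hh.expTail hκ
  have h1 := hh.integral_expTail_sq hκ
  have h0 : 0 ≤ ∫ x, KdV.expTail κ h x ^ 2 := integral_nonneg fun x => sq_nonneg _
  have h2 : ∫ x, h x * KdV.expTail κ h x ≤ ∫ x, |h x| * ∫ y, |h y| := by
    refine integral_mono (hh.mul hj).integrable (hh.integrable.abs.mul_const _) fun x => ?_
    refine (le_abs_self _).trans ?_
    rw [abs_mul]
    exact mul_le_mul_of_nonneg_left
      (abs_expTail_le_integral (by linarith) hh.continuous hh.integrable x) (abs_nonneg _)
  rw [integral_mul_const] at h2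
  nlinarith

include hκ in
/-- `L² → L²` bound. -/
lemma HasQuadDecay.sq_mul_integral_expTail_sq_le (hh : HasQuadDecay h) :
    (2 * κ) ^ 2 * ∫ x, KdV.expTail κ h x ^ 2 ≤ ∫ x, h x ^ 2 := by
  have hj := hh.expTail hκ
  have h1 := hh.integral_expTail_sq hκ
  have h2 : 2 * (2 * κ) * ∫ x, h x * KdV.expTail κ h x ≤
      ∫ x, (h x ^ 2 + (2 * κ) ^ 2 * KdV.expTail κ h x ^ 2) := by
    rw [← integral_const_mul]
    refine integral_mono ((hh.mul hj).integrable.const_mul _)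
      (hh.integrable_sq.add (hj.integrable_sq.const_mul _)) fun x => ?_
    dsimp only
    nlinarith [sq_nonneg (h x - 2 * κ * KdV.expTail κ h x)]
  rw [integral_add hh.integrable_sq (hj.integrable_sq.const_mul _), integral_const_mul] at h2
  nlinarith

lemma HasQuadDecay.integral_add_sq_le {f : ℝ → ℝ} (hf : HasQuadDecay f) (hh : HasQuadDecay h) :
    ∫ x, (f x + h x) ^ 2 ≤ 2 * (∫ x, f x ^ 2) + 2 * ∫ x, h x ^ 2 := by
  rw [← integral_const_mul, ← integral_const_mul,
    ← integral_add (hf.integrable_sq.const_mul 2) (hh.integrable_sq.const_mul 2)]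
  refine integral_mono (hf.add hh).integrable_sq
    ((hf.integrable_sq.const_mul 2).add (hh.integrable_sq.const_mul 2)) fun x => ?_
  dsimp only
  nlinarith [sq_nonneg (f x - h x)]

include hκ in
-- Resolvent identity: with `j = (2 - ∂)⁻¹h`, one has `(2κ - ∂)⁻¹h = j - (2κ - 2)(2κ - ∂)⁻¹j`, and
-- the last term is no larger than `j` in `L²`.
lemma HasQuadDecay.integral_expTail_sq_le_one (hh : HasQuadDecay h) :
    ∫ x, KdV.expTail κ h x ^ 2 ≤ 4 * ∫ x, KdV.expTail 1 h x ^ 2 := by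
  set j := KdV.expTail 1 h
  have hj : HasQuadDecay j := hh.expTail le_rfl
  have hk := (hj.expTail hκ).const_mul (-(2 * κ - 2))
  have h1 : ∀ x, j x + -(2 * κ - 2) * KdV.expTail κ j x = KdV.expTail κ h x := by
    refine hh.eq_expTail hκ (hj.add hk) fun x => ?_
    exact ((hh.hasDerivAt_expTail le_rfl x).add
      ((hj.hasDerivAt_expTail hκ x).const_mul (-(2 * κ - 2)))).congr_deriv (by ring)
  have h2 := hj.integral_add_sq_le hk
  have h3 := hj.sq_mul_integral_expTail_sq_le hκ
  have h0 : 0 ≤ ∫ x, KdV.expTail κ j x ^ 2 := integral_nonneg fun x => sq_nonneg _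
  simp only [h1, mul_pow] at h2
  rw [integral_const_mul] at h2
  nlinarith [mul_nonneg h0 (by linarith : 0 ≤ κ), mul_nonneg h0 (by linarith : 0 ≤ κ - 1)]

end L2bounds

/-! ### The Riccati variable -/

/-- The logarithmic derivative of the Jost solution. -/
def riccati (κ : ℝ) (q : 𝓢(ℝ, ℝ)) (x : ℝ) : ℝ := jostDeriv κ q x / jost κ q x

/-- The conserved quantity `2κ α = ∫ q - 2κ log a`. -/
def energy (κ : ℝ) (q : 𝓢(ℝ, ℝ)) : ℝ := (∫ x, q x) - 2 * κ * Real.log (jostLim κ q)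

section Riccati

variable {κ : ℝ} (hκ : 1 ≤ κ) {q : 𝓢(ℝ, ℝ)} (hq : JostPos κ q)

include hκ hq in
lemma hasQuadDecay_riccati : HasQuadDecay (riccati κ q) := by
  obtain ⟨c, hc, h⟩ := JostPos.exists_le hκ hq
  have h1 : HasQuadDecay (jostDeriv κ q) := ⟨_, quadDecay_jostDeriv hκ q⟩
  refine h1.mul_bounded (h := fun x => (jost κ q x)⁻¹) (C := c⁻¹)
    ((continuous_jost hκ q).inv₀ fun x => (hq.1 x).ne') fun x => ?_
  rw [abs_of_pos (inv_pos.2 (hq.1 x))]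
  exact inv_anti₀ hc (h x)

include hκ hq in
lemma hasDerivAt_riccati (x : ℝ) :
    HasDerivAt (riccati κ q) (q x + 2 * κ * riccati κ q x - riccati κ q x ^ 2) x := by
  have hm := (hq.1 x).ne'
  refine ((hasDerivAt_jostDeriv hκ q x).div (hasDerivAt_jost hκ q x) hm).congr_deriv ?_
  simp only [riccati]
  field_simp
  ring

include hκ hq in
lemma integral_riccati : ∫ x, riccati κ q x = -Real.log (jostLim κ q) := by
  have h : ∀ x, HasDerivAt (fun x => Real.log (jost κ q x)) (riccati κ q x) x := fun x =>
    (hasDerivAt_jost hκ q x).log (hq.1 x).ne'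
  rw [integral_of_hasDerivAt_of_tendsto h (hasQuadDecay_riccati hκ hq).integrable
    ((tendsto_jost_atBot hκ q).log hq.2.ne') ((tendsto_jost_atTop hκ q).log one_ne_zero)]
  simp

include hκ hq in
-- Integrate the Riccati equation over the line; the linear term contributes `log a`. This exhibits
-- the conserved quantity as a square, hence coercive.
lemma integral_riccati_sq : ∫ x, riccati κ q x ^ 2 = energy κ q := by
  have hs := hasQuadDecay_riccati hκ hq
  have h0 := (hasQuadDecay q).add (hs.const_mul (2 * κ))
  have h := integral_of_hasDerivAt_of_tendsto (hasDerivAt_riccati hκ hq)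
    (h0.integrable.sub hs.integrable_sq) hs.tendsto_atBot hs.tendsto_atTop
  rw [integral_sub h0.integrable hs.integrable_sq, integral_add q.integrable
    (hs.const_mul _).integrable, integral_const_mul, integral_riccati hκ hq] at h
  rw [energy]; linarith

include hκ hq in
-- The Riccati equation `q = s' - 2κs + s²` after applying `(2κ - ∂)⁻¹`.
lemma expTail_eq_riccati (x : ℝ) :
    -riccati κ q x + expTail κ (fun y => riccati κ q y ^ 2) x = expTail κ q x := by
  have hs := hasQuadDecay_riccati hκ hq
  have hs2 : HasQuadDecay fun y => riccati κ q y ^ 2 := by simpa only [sq] using hs.mul hs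
  refine (hasQuadDecay q).eq_expTail hκ (hs.neg.add (hs2.expTail hκ)) (fun x => ?_) x
  exact ((hasDerivAt_riccati hκ hq x).neg.add (hs2.hasDerivAt_expTail hκ x)).congr_deriv (by ring)

include hκ hq in
lemma integral_expTail_riccati_sq_le :
    ∫ x, expTail κ (fun y => riccati κ q y ^ 2) x ^ 2 ≤ 1 / 2 * energy κ q ^ 2 := by
  have hs := hasQuadDecay_riccati hκ hq
  have hs2 : HasQuadDecay fun y => riccati κ q y ^ 2 := by simpa only [sq] using hs.mul hs
  have := hs2.integral_expTail_sq_le hκ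
  simpa only [abs_sq, integral_riccati_sq hκ hq] using this

include hκ hq in
lemma integral_expTail_sq_le_energy :
    ∫ x, expTail κ q x ^ 2 ≤ 2 * energy κ q + energy κ q ^ 2 := by
  have hs := hasQuadDecay_riccati hκ hq
  have hs2 : HasQuadDecay fun y => riccati κ q y ^ 2 := by simpa only [sq] using hs.mul hs
  have h := hs.neg.integral_add_sq_le (hs2.expTail hκ)
  simp only [expTail_eq_riccati hκ hq, neg_sq, integral_riccati_sq hκ hq] at h
  linarith [integral_expTail_riccati_sq_le hκ hq]

include hκ hq in
-- Solve `expTail_eq_riccati` for the Riccati variable and take `L²` norms. The quadratic term can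
-- be absorbed only once the energy is known to be small, hence the continuity method below.
lemma energy_le : energy κ q ≤ 8 * (∫ x, expTail 1 q x ^ 2) + energy κ q ^ 2 := by
  have hs := hasQuadDecay_riccati hκ hq
  have hs2 : HasQuadDecay fun y => riccati κ q y ^ 2 := by simpa only [sq] using hs.mul hs
  have h := (hs2.expTail hκ).integral_add_sq_le ((hasQuadDecay q).expTail hκ).neg
  have h1 : ∀ x, expTail κ (fun y => riccati κ q y ^ 2) x + -expTail κ q x = riccati κ q x :=
    fun x => by rw [← expTail_eq_riccati hκ hq]; ring
  simp only [h1, neg_sq, integral_riccati_sq hκ hq] at h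
  linarith [integral_expTail_riccati_sq_le hκ hq, (hasQuadDecay q).integral_expTail_sq_le_one hκ]

include hκ hq in
lemma energy_nonneg : 0 ≤ energy κ q := by
  rw [← integral_riccati_sq hκ hq]; exact integral_nonneg fun x => sq_nonneg _

end Riccati

/-! ### Positivity for small potentials -/

section Small

variable {κ : ℝ} (hκ : 1 ≤ κ)

lemma continuous_schwartz_integral : Continuous fun q : 𝓢(ℝ, ℝ) => ∫ x, q x :=
  (SchwartzMap.integralCLM ℝ (volume : Measure ℝ)).continuous

include hκ in
lemma isOpen_jostPos_energy_lt (c : ℝ) : IsOpen {q | JostPos κ q ∧ energy κ q < c} := by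
  refine isOpen_iff_mem_nhds.2 fun q hq => ?_
  have h : ContinuousAt (energy κ) q := continuous_schwartz_integral.continuousAt.sub
    (continuousAt_const.mul ((continuous_jostLim hκ).continuousAt.log hq.1.2.ne'))
  filter_upwards [(isOpen_jostPos hκ).mem_nhds hq.1, h.eventually (gt_mem_nhds hq.2)] with q' h1 h2
  exact ⟨h1, h2⟩

include hκ in
-- An upper bound on the energy is a lower bound on `log a`, so `a` cannot degenerate to `0` in the
-- limit.
lemma of_mem_closure_jostPos_energy_lt {c : ℝ} {q : 𝓢(ℝ, ℝ)}
    (hq : q ∈ closure {q | JostPos κ q ∧ energy κ q < c}) : JostPos κ q ∧ energy κ q ≤ c := by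
  have h1 : Real.exp (((∫ x, q x) - c) / (2 * κ)) ≤ jostLim κ q := by
    have hcl : IsClosed {q : 𝓢(ℝ, ℝ) | Real.exp (((∫ x, q x) - c) / (2 * κ)) ≤ jostLim κ q} :=
      isClosed_le (Real.continuous_exp.comp
        ((continuous_schwartz_integral.sub continuous_const).div_const _)) (continuous_jostLim hκ)
    refine closure_minimal (fun q hq => ?_) hcl hq
    rw [mem_ofPred_eq, ← Real.le_log_iff_exp_le hq.1.2, div_le_iff₀ (by linarith)]
    have := hq.2
    rw [energy] at this
    linarith
  have h2 : 0 < jostLim κ q := (Real.exp_pos _).trans_le h1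
  refine ⟨jostPos_of_mem_closure hκ (closure_mono (fun q hq => hq.1) hq) h2, ?_⟩
  rw [← Real.le_log_iff_exp_le h2, div_le_iff₀ (by linarith)] at h1
  rw [energy]; linarith

include hκ in
lemma jost_zero : jost κ 0 = fun _ => 1 := by
  funext x
  rw [jost_eq hκ]
  simp [volterra, expTail, tail]

include hκ in
lemma jostPos_zero : JostPos κ 0 ∧ energy κ 0 = 0 := by
  have h : jostLim κ 0 = 1 := by simp [jostLim]
  exact ⟨⟨fun x => by rw [jost_zero hκ]; exact one_pos, by rw [h]; exact one_pos⟩, by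
    simp [energy, h]⟩

include hκ in
/-- Positivity of the Jost solution for small potentials. -/
lemma jostPos_of_small {q : 𝓢(ℝ, ℝ)} (hq : 8 * ∫ x, expTail 1 q x ^ 2 < 1 / 4) :
    JostPos κ q ∧ energy κ q ≤ 16 * ∫ x, expTail 1 q x ^ 2 := by
  have hη : 0 ≤ ∫ x, expTail 1 q x ^ 2 := integral_nonneg fun x => sq_nonneg _
  -- When the energy is at most `1/2`, its square is at most half of it and is absorbed in
  -- `energy_le`.
  have key : ∀ l ∈ Icc (0 : ℝ) 1, JostPos κ (l • q) → energy κ (l • q) ≤ 1 / 2 →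
      energy κ (l • q) ≤ 16 * ∫ x, expTail 1 q x ^ 2 := by
    intro l hl h1 h2
    have h3 := energy_le hκ h1
    have h4 := energy_nonneg hκ h1
    have h5 : ∫ x, expTail 1 (l • q : 𝓢(ℝ, ℝ)) x ^ 2 = l ^ 2 * ∫ x, expTail 1 q x ^ 2 := by
      rw [← integral_const_mul]
      congr 1; funext x
      rw [← mul_pow, ← expTail_const_mul]; rfl
    have h6 : l ^ 2 * (∫ x, expTail 1 q x ^ 2) ≤ ∫ x, expTail 1 q x ^ 2 :=
      mul_le_of_le_one_left hη (pow_le_one₀ hl.1 hl.2)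
    rw [h5] at h3
    nlinarith
  have hcont : Continuous fun l : ℝ => l • q := continuous_id.smul continuous_const
  set V := {q | JostPos κ q ∧ energy κ q < 1 / 2}
  -- Continuity method in the coupling constant. In the closure the energy is at most `1/2`, which
  -- `key` and the smallness of `q` improve to a strict inequality.
  have hsub : Icc (0 : ℝ) 1 ⊆ (fun l : ℝ => l • q) ⁻¹' V := by
    refine isPreconnected_Icc.subset_of_closure_inter_subset
      ((isOpen_jostPos_energy_lt hκ (1 / 2)).preimage hcont) ⟨0, by simp, ?_⟩ ?_
    · have := jostPos_zero hκ
      simp only [V, mem_preimage, zero_smul, mem_ofPred_eq]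
      exact ⟨this.1, by rw [this.2]; norm_num⟩
    · rintro l ⟨hl, hl1⟩
      have h1 := of_mem_closure_jostPos_energy_lt hκ (hcont.closure_preimage_subset V hl)
      exact ⟨h1.1, by linarith [key l hl1 h1.1 h1.2]⟩
  have h1 := hsub (right_mem_Icc.2 zero_le_one)
  have h2 := key 1 (right_mem_Icc.2 zero_le_one) h1.1 h1.2.le
  simp only [V, mem_preimage, one_smul] at h1 h2
  exact ⟨h1.1, h2⟩

end Small

/-- The a priori `H⁻¹` bound. -/
lemma IsSchwartzSolution.hNegOneNorm_le {q : ℝ → 𝓢(ℝ, ℝ)} (hq : IsSchwartzSolution q)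
    (h0 : hNegOneNorm (q 0) ≤ 1 / 6) (t : ℝ) :
    hNegOneNorm (q t) ≤ 7 * hNegOneNorm (q 0) := by
  simp only [hNegOneNorm_eq] at *
  have hnn : ∀ s, 0 ≤ ∫ x, expTail 1 (q s) x ^ 2 := fun s => integral_nonneg fun x => sq_nonneg _
  set η := Real.sqrt (∫ x, expTail 1 (q 0) x ^ 2) with hη
  have hη0 : 0 ≤ η := Real.sqrt_nonneg _
  have hη2 : ∫ x, expTail 1 (q 0) x ^ 2 = η ^ 2 := (Real.sq_sqrt (hnn 0)).symm
  obtain ⟨h1, h2⟩ := jostPos_of_small (κ := 1) le_rfl (q := q 0) (by rw [hη2]; nlinarith)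
  have h3 := integral_expTail_sq_le_energy le_rfl (hq.jostPos le_rfl h1 t)
  have h4 : energy 1 (q t) = energy 1 (q 0) := by
    rw [energy, energy, hq.jostLim_eq le_rfl, hq.integral_eq]
  have h5 := energy_nonneg le_rfl h1
  rw [h4] at h3
  rw [hη2] at h2
  refine Real.sqrt_le_iff.2 ⟨by positivity, ?_⟩
  -- With `E` the energy, `E ≤ 16η² ≤ 16/36`. Then `2E + E² ≤ (5/2)E ≤ 40η² ≤ (7η)²`.
  have h6 : energy 1 (q 0) ≤ 1 / 2 := by nlinarith
  nlinarith

/-! ### Pairings in `L²` -/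

lemma integrable_mul_of_memLp {f h : ℝ → ℂ} (hf : MemLp f 2) (hh : MemLp h 2) :
    Integrable fun x => f x * h x := hf.integrable_mul hh

lemma MemLp_conj {f : ℝ → ℂ} (hf : MemLp f 2) : MemLp (fun x => conj (f x)) 2 := hf.star

lemma integral_mul_eq_inner {p : ℝ → ℂ} (hp : MemLp p 2) (v : L2) :
    ∫ x, v x * p x = inner ℂ ((MemLp_conj hp).toLp _) v := by
  rw [L2.inner_def]
  refine integral_congr_ae ?_
  filter_upwards [(MemLp_conj hp).coeFn_toLp] with x hx
  rw [hx]
  simp [RCLike.inner_apply]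

lemma continuous_integral_mul {p : ℝ → ℂ} (hp : MemLp p 2) :
    Continuous fun v : L2 => ∫ x, v x * p x := by
  simp_rw [integral_mul_eq_inner hp]
  exact continuous_const.inner continuous_id

/-! ### The Schur test -/

lemma integrable_exp_neg_abs : Integrable fun z : ℝ => Real.exp (-|z|) := by
  refine (integrable_inv_one_add_sq.const_mul 2).mono' (by fun_prop) (Eventually.of_forall fun z => ?_)
  rw [Real.norm_eq_abs, Real.abs_exp, Real.exp_neg, ← div_eq_mul_inv, inv_eq_one_div,
    div_le_div_iff₀ (Real.exp_pos _) (by positivity)]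
  have h := Real.quadratic_le_exp_of_nonneg (abs_nonneg z)
  rw [sq_abs] at h
  nlinarith [abs_nonneg z]

section Schur

open scoped ENNReal

/-- The mass of `e^{-|z|}`. -/
def expMass : ℝ≥0∞ := ∫⁻ z : ℝ, ENNReal.ofReal (Real.exp (-|z|))

lemma expMass_ne_top : expMass ≠ ⊤ := integrable_exp_neg_abs.lintegral_lt_top.ne

lemma lintegral_exp_neg_abs_sub (x : ℝ) :
    ∫⁻ y : ℝ, ENNReal.ofReal (Real.exp (-|x - y|)) = expMass :=
  lintegral_sub_left_eq_self (fun z => ENNReal.ofReal (Real.exp (-|z|))) x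

lemma lintegral_exp_neg_abs_sub' (y : ℝ) :
    ∫⁻ x : ℝ, ENNReal.ofReal (Real.exp (-|x - y|)) = expMass :=
  lintegral_sub_right_eq_self (fun z => ENNReal.ofReal (Real.exp (-|z|))) y

/-- Cauchy–Schwarz, with the kernel split into two square roots. -/
lemma sq_lintegral_exp_mul_le {f : ℝ → ℂ} (hf : AEStronglyMeasurable f) (x : ℝ) :
    (∫⁻ y, ENNReal.ofReal (Real.exp (-|x - y|)) * ‖f y‖ₑ) ^ 2 ≤
      expMass * ∫⁻ y, ENNReal.ofReal (Real.exp (-|x - y|)) * ‖f y‖ₑ ^ 2 := by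
  have hm : ∀ y : ℝ, ENNReal.ofReal (Real.exp (-|x - y| / 2)) ^ 2 =
      ENNReal.ofReal (Real.exp (-|x - y|)) := fun y => by
    rw [← ENNReal.ofReal_pow (Real.exp_pos _).le, ← Real.exp_nat_mul]
    congr 2; push_cast; ring
  have h := ENNReal.lintegral_mul_le_Lp_mul_Lq volume Real.HolderConjugate.two_two
    (f := fun y : ℝ => ENNReal.ofReal (Real.exp (-|x - y| / 2)))
    (g := fun y => ENNReal.ofReal (Real.exp (-|x - y| / 2)) * ‖f y‖ₑ)
    (by fun_prop) (by fun_prop)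
  simp only [Pi.mul_apply, ← mul_assoc, ← sq, hm, ENNReal.rpow_ofNat, mul_pow,
    lintegral_exp_neg_abs_sub] at h
  calc _ ≤ (expMass ^ (1 / 2 : ℝ) *
        (∫⁻ y, ENNReal.ofReal (Real.exp (-|x - y|)) * ‖f y‖ₑ ^ 2) ^ (1 / 2 : ℝ)) ^ 2 := by gcongr
    _ = _ := by
      rw [mul_pow, ← ENNReal.rpow_mul_natCast, ← ENNReal.rpow_mul_natCast]
      norm_num

lemma lintegral_sq_lintegral_exp_mul_le {f : ℝ → ℂ} (hf : StronglyMeasurable f) :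
    ∫⁻ x, (∫⁻ y, ENNReal.ofReal (Real.exp (-|x - y|)) * ‖f y‖ₑ) ^ 2 ≤
      expMass ^ 2 * ∫⁻ y, ‖f y‖ₑ ^ 2 := by
  calc _ ≤ ∫⁻ x, expMass * ∫⁻ y, ENNReal.ofReal (Real.exp (-|x - y|)) * ‖f y‖ₑ ^ 2 :=
        lintegral_mono fun x => sq_lintegral_exp_mul_le hf.aestronglyMeasurable x
    _ = expMass * ∫⁻ y, ∫⁻ x, ENNReal.ofReal (Real.exp (-|x - y|)) * ‖f y‖ₑ ^ 2 := by
        have hfm := hf.measurable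
        rw [lintegral_const_mul' _ _ expMass_ne_top, lintegral_lintegral_swap]
        fun_prop
    _ = expMass * ∫⁻ y, expMass * ‖f y‖ₑ ^ 2 := by
        have hfm := hf.measurable
        congr 2; funext y
        rw [lintegral_mul_const _ (by fun_prop), lintegral_exp_neg_abs_sub']
    _ = _ := by
        rw [lintegral_const_mul' _ _ expMass_ne_top, ← mul_assoc, sq]

variable {k : ℝ → ℝ → ℝ} {C : ℝ}

lemma enorm_kernel_mul_le (hk : ∀ x y, |k x y| ≤ C * Real.exp (-|x - y|)) (x y : ℝ) (z : ℂ) :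
    ‖(k x y : ℂ) * z‖ₑ ≤ ENNReal.ofReal C * (ENNReal.ofReal (Real.exp (-|x - y|)) * ‖z‖ₑ) := by
  have hC : 0 ≤ C := by
    have := (abs_nonneg _).trans (hk 0 0)
    simpa using this
  rw [enorm_mul, ← mul_assoc, ← ENNReal.ofReal_mul hC]
  gcongr
  rw [← ofReal_norm, Complex.norm_real]
  exact ENNReal.ofReal_le_ofReal (hk x y)

lemma integrable_kernel_mul (hm : Measurable (Function.uncurry k))
    (hk : ∀ x y, |k x y| ≤ C * Real.exp (-|x - y|)) {f : ℝ → ℂ} (hf : MemLp f 2) (x : ℝ) :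
    Integrable fun y => (k x y : ℂ) * f y := by
  have hkm : Measurable (k x) := hm.comp measurable_prodMk_left
  refine ⟨(Complex.measurable_ofReal.comp hkm).aestronglyMeasurable.mul hf.1, ?_⟩
  refine (lintegral_mono fun y => enorm_kernel_mul_le hk x y (f y)).trans_lt ?_
  rw [lintegral_const_mul' _ _ ENNReal.ofReal_ne_top]
  refine ENNReal.mul_lt_top ENNReal.ofReal_lt_top ?_
  have h1 := sq_lintegral_exp_mul_le hf.1 x
  have h2 : ∫⁻ y, ENNReal.ofReal (Real.exp (-|x - y|)) * ‖f y‖ₑ ^ 2 < ⊤ := by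
    have h3 : ∫⁻ y, ‖f y‖ₑ ^ 2 < ⊤ := by
      have := lintegral_rpow_enorm_lt_top_of_eLpNorm_lt_top two_ne_zero ENNReal.ofNat_ne_top hf.2
      simpa using this
    refine lt_of_le_of_lt (lintegral_mono fun y => ?_) h3
    refine mul_le_of_le_one_left (zero_le) ?_
    rw [ENNReal.ofReal_le_one]
    exact Real.exp_le_one_iff.2 (neg_nonpos.2 (abs_nonneg _))
  have h4 := h1.trans_lt (ENNReal.mul_lt_top expMass_ne_top.lt_top h2)
  by_contra h5
  rw [not_lt_top_iff] at h5
  rw [h5] at h4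
  simp at h4

lemma schur_aux (hm : Measurable (Function.uncurry k))
    (hk : ∀ x y, |k x y| ≤ C * Real.exp (-|x - y|)) (f : L2) :
    AEStronglyMeasurable (fun x => ∫ y, (k x y : ℂ) * f y) ∧
    eLpNorm (fun x => ∫ y, (k x y : ℂ) * f y) 2 volume ≤
      ENNReal.ofReal C * expMass * eLpNorm f 2 volume := by
  have hf := Lp.stronglyMeasurable f
  have hsm : StronglyMeasurable (fun x => ∫ y, (k x y : ℂ) * f y) := by
    refine StronglyMeasurable.integral_prod_right (f := fun x y => (k x y : ℂ) * f y) ?_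
    exact (Complex.measurable_ofReal.comp hm).stronglyMeasurable.mul (hf.comp_measurable measurable_snd)
  refine ⟨hsm.aestronglyMeasurable, ?_⟩
  rw [eLpNorm_eq_lintegral_rpow_enorm_toReal two_ne_zero ENNReal.ofNat_ne_top,
    eLpNorm_eq_lintegral_rpow_enorm_toReal two_ne_zero ENNReal.ofNat_ne_top]
  simp only [ENNReal.toReal_ofNat, ENNReal.rpow_ofNat]
  have h1 : ∫⁻ x, ‖∫ y, (k x y : ℂ) * f y‖ₑ ^ 2 ≤
      (ENNReal.ofReal C * expMass) ^ 2 * ∫⁻ y, ‖f y‖ₑ ^ 2 := by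
    calc _ ≤ ∫⁻ x, ENNReal.ofReal C ^ 2 *
          (∫⁻ y, ENNReal.ofReal (Real.exp (-|x - y|)) * ‖f y‖ₑ) ^ 2 := by
          refine lintegral_mono fun x => ?_
          rw [← mul_pow, ← lintegral_const_mul' _ _ ENNReal.ofReal_ne_top]
          gcongr
          exact (enorm_integral_le_lintegral_enorm _).trans
            (lintegral_mono fun y => enorm_kernel_mul_le hk x y (f y))
      _ ≤ _ := by
          rw [lintegral_const_mul' _ _ (by finiteness), mul_pow, mul_assoc]
          gcongr
          exact lintegral_sq_lintegral_exp_mul_le hf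
  calc _ ≤ ((ENNReal.ofReal C * expMass) ^ 2 * ∫⁻ y, ‖f y‖ₑ ^ 2) ^ (1 / 2 : ℝ) := by gcongr
    _ = _ := by
      rw [ENNReal.mul_rpow_of_nonneg _ _ (by norm_num), ← ENNReal.rpow_natCast_mul]
      norm_num

/-- A measurable kernel bounded by `C e^{-|x-y|}` defines a bounded operator on `L²`. -/
lemma exists_kernel_operator (hm : Measurable (Function.uncurry k))
    (hk : ∀ x y, |k x y| ≤ C * Real.exp (-|x - y|)) :
    ∃ T : L2 →L[ℂ] L2, ∀ f : L2, ∀ᵐ x, T f x = ∫ y, (k x y : ℂ) * f y := by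
  have hT : ∀ f : L2, MemLp (fun x => ∫ y, (k x y : ℂ) * f y) 2 := fun f =>
    ⟨(schur_aux hm hk f).1, (schur_aux hm hk f).2.trans_lt
      (ENNReal.mul_lt_top (ENNReal.mul_lt_top ENNReal.ofReal_lt_top
        expMass_ne_top.lt_top) (Lp.memLp f).2)⟩
  have hi : ∀ (f : L2) x, Integrable fun y => (k x y : ℂ) * f y := fun f x =>
    integrable_kernel_mul hm hk (Lp.memLp f) x
  let T : L2 →ₗ[ℂ] L2 :=
    { toFun := fun f => (hT f).toLp _
      map_add' := fun f h => by
        rw [← MemLp.toLp_add, MemLp.toLp_eq_toLp_iff]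
        refine Eventually.of_forall fun x => ?_
        simp only [Pi.add_apply]
        rw [← integral_add (hi f x) (hi h x)]
        refine integral_congr_ae ?_
        filter_upwards [Lp.coeFn_add f h] with y hy
        rw [hy, Pi.add_apply, mul_add]
      map_smul' := fun c f => by
        rw [RingHom.id_apply, ← MemLp.toLp_const_smul, MemLp.toLp_eq_toLp_iff]
        refine Eventually.of_forall fun x => ?_
        simp only [Pi.smul_apply, smul_eq_mul]
        rw [← integral_const_mul]
        refine integral_congr_ae ?_
        filter_upwards [Lp.coeFn_smul c f] with y hy
        rw [hy, Pi.smul_apply, smul_eq_mul]; ring }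
  refine ⟨T.mkContinuous (ENNReal.ofReal C * expMass).toReal fun f => ?_, fun f =>
    (hT f).coeFn_toLp⟩
  change ‖(hT f).toLp _‖ ≤ _
  rw [Lp.norm_toLp, Lp.norm_def, ← ENNReal.toReal_mul]
  refine ENNReal.toReal_mono ?_ (schur_aux hm hk f).2
  exact ENNReal.mul_ne_top (ENNReal.mul_ne_top ENNReal.ofReal_ne_top expMass_ne_top)
    (Lp.memLp f).2.ne

end Schur

/-! ### Weak derivatives against non-compactly supported test functions -/

/-- Cut off with `χ(εx)` and let `ε → 0`: the derivative of the cutoff is `O(ε)`. Needed because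
`greenDerivInt`, later used as a test function, lacks compact support in general. -/
lemma HasWeakDeriv.integral_eq {w w' : L2} (h : HasWeakDeriv w w') {φ : ℝ → ℂ}
    (hφ : ContDiff ℝ ∞ φ) (h1 : MemLp φ 2) (h2 : MemLp (deriv φ) 2) :
    ∫ x, w x * deriv φ x = -∫ x, w' x * φ x := by
  let χ : ContDiffBump (0 : ℝ) := ⟨1, 2, one_pos, one_lt_two⟩
  have hχ : ContDiff ℝ ∞ (χ : ℝ → ℝ) := χ.contDiff
  have hχd : ∀ x, HasDerivAt (χ : ℝ → ℝ) (deriv χ x) x := fun x =>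
    (hχ.differentiable (by simp) x).hasDerivAt
  obtain ⟨D, hD⟩ : ∃ D, ∀ x, ‖deriv χ x‖ ≤ D :=
    (χ.hasCompactSupport.deriv).exists_bound_of_continuous (hχ.continuous_deriv (by simp))
  set ε : ℕ → ℝ := fun n => 1 / ((n : ℝ) + 1) with hε
  have hε0 : ∀ n, 0 < ε n := fun n => by positivity
  have hε1 : ∀ n, ε n ≤ 1 := fun n => by
    rw [hε, div_le_one (by positivity)]; linarith [n.cast_nonneg (α := ℝ)]
  have hεl : Tendsto ε atTop (𝓝 0) := tendsto_one_div_add_atTop_nhds_zero_nat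
  set c : ℕ → ℝ → ℂ := fun n x => ((χ (ε n * x) : ℝ) : ℂ) with hc
  have hcs : ∀ n, ContDiff ℝ ∞ (c n) := fun n =>
    Complex.ofRealCLM.contDiff.comp (hχ.comp (contDiff_const.mul contDiff_id))
  have hcd : ∀ n x, HasDerivAt (c n) ((ε n * deriv χ (ε n * x) : ℝ) : ℂ) x := fun n x => by
    have h3 : HasDerivAt (fun x => χ (ε n * x)) (deriv χ (ε n * x) * ε n) x := by
      have h4 : HasDerivAt (fun x => ε n * x) (ε n) x := by
        simpa using (hasDerivAt_id x).const_mul (ε n)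
      exact (hχd (ε n * x)).comp x h4
    exact h3.ofReal_comp.congr_deriv (by rw [mul_comm])
  have hφd : ∀ x, HasDerivAt φ (deriv φ x) x := fun x =>
    (hφ.differentiable (by simp) x).hasDerivAt
  have hcn : ∀ n x, ‖c n x‖ ≤ 1 := fun n x => by
    rw [hc, Complex.norm_real, Real.norm_of_nonneg χ.nonneg]; exact χ.le_one
  have hc1 : ∀ x, Tendsto (fun n => c n x) atTop (𝓝 1) := fun x => by
    have h3 : Tendsto (fun n => ε n * x) atTop (𝓝 0) := by simpa using hεl.mul_const x
    have h4 := (hχ.continuous.tendsto 0).comp h3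
    rw [χ.one_of_mem_closedBall (by simp [χ])] at h4
    simpa [Function.comp_def] using (Complex.continuous_ofReal.tendsto 1).comp h4
  have hdn : ∀ n x, ‖((ε n * deriv χ (ε n * x) : ℝ) : ℂ)‖ ≤ ε n * D := fun n x => by
    rw [Complex.norm_real, norm_mul, Real.norm_of_nonneg (hε0 n).le]
    exact mul_le_mul_of_nonneg_left (hD _) (hε0 n).le
  have hd0 : ∀ x, Tendsto (fun n => ((ε n * deriv χ (ε n * x) : ℝ) : ℂ)) atTop (𝓝 0) := fun x =>
    squeeze_zero_norm (fun n => hdn n x) (by simpa using hεl.mul_const D)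
  have hD0 : 0 ≤ D := (norm_nonneg _).trans (hD 0)
  have hcsupp : ∀ n, HasCompactSupport (c n) := fun n => by
    have h3 : HasCompactSupport fun x => χ (ε n * x) :=
      χ.hasCompactSupport.comp_homeomorph (Homeomorph.mulLeft₀ (ε n) (hε0 n).ne')
    exact h3.comp_left (g := fun r : ℝ => (r : ℂ)) (by simp)
  have key : ∀ n, ∫ x, w x * (((ε n * deriv χ (ε n * x) : ℝ) : ℂ) * φ x + c n x * deriv φ x) =
      -∫ x, w' x * (c n x * φ x) := fun n => by
    have h3 := h (fun x => c n x * φ x) ((hcs n).mul hφ) ((hcsupp n).mul_right)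
    rw [← h3]
    congr 1; funext x
    exact congrArg (w x * ·) ((hcd n x).mul (hφd x)).deriv.symm
  have hw := Lp.memLp w
  have hw' := Lp.memLp w'
  have hφc := hφ.continuous
  have hdφc : Continuous (deriv φ) := hφ.continuous_deriv (by simp)
  have hχdc : Continuous (deriv χ) := hχ.continuous_deriv (by simp)
  have lim1 : Tendsto (fun n => ∫ x, w x * (((ε n * deriv χ (ε n * x) : ℝ) : ℂ) * φ x +
      c n x * deriv φ x)) atTop (𝓝 (∫ x, w x * deriv φ x)) := by
    refine tendsto_integral_of_dominated_convergence
      (fun x => D * ‖w x * φ x‖ + ‖w x * deriv φ x‖) (fun n => ?_)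
      (((integrable_mul_of_memLp hw h1).norm.const_mul D).add (integrable_mul_of_memLp hw h2).norm)
      (fun n => Eventually.of_forall fun x => ?_) (Eventually.of_forall fun x => ?_)
    · refine hw.1.mul (Continuous.aestronglyMeasurable ?_)
      have := (hcs n).continuous
      fun_prop
    · rw [mul_add]
      refine (norm_add_le _ _).trans (add_le_add ?_ ?_)
      · rw [mul_left_comm, norm_mul]
        refine mul_le_mul_of_nonneg_right ((hdn n x).trans ?_) (norm_nonneg _)
        exact mul_le_of_le_one_left hD0 (hε1 n)
      · rw [mul_left_comm, norm_mul]
        exact mul_le_of_le_one_left (norm_nonneg _) (hcn n x)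
    · have := (((hd0 x).mul_const (φ x)).add ((hc1 x).mul_const (deriv φ x))).const_mul (w x)
      simpa using this
  have lim2 : Tendsto (fun n => -∫ x, w' x * (c n x * φ x)) atTop (𝓝 (-∫ x, w' x * φ x)) := by
    refine (tendsto_integral_of_dominated_convergence (fun x => ‖w' x * φ x‖) (fun n => ?_)
      (integrable_mul_of_memLp hw' h1).norm
      (fun n => Eventually.of_forall fun x => ?_) (Eventually.of_forall fun x => ?_)).neg
    · refine hw'.1.mul (Continuous.aestronglyMeasurable ?_)
      have := (hcs n).continuous
      fun_prop
    · rw [mul_left_comm, norm_mul]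
      exact mul_le_of_le_one_left (norm_nonneg _) (hcn n x)
    · simpa using ((hc1 x).mul_const (φ x)).const_mul (w' x)
  exact tendsto_nhds_unique lim1 (lim2.congr fun n => (key n).symm)

/-! ### Uniqueness of continuous kernels -/

/-- Rational endpoints suffice since the primitive is continuous; countability lets one null set of
`x` serve all intervals in the next lemma. -/
lemma eq_zero_of_setIntegral_uIoc_eq_zero {f : ℝ → ℂ} (hf : Continuous f)
    (h : ∀ b : ℚ, ∫ y in uIoc (0 : ℝ) b, f y = 0) (y : ℝ) : f y = 0 := by
  have hd : ∀ x, HasDerivAt (fun x => ∫ y in (0 : ℝ)..x, f y) (f x) x := fun x =>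
    intervalIntegral.integral_hasDerivAt_right (hf.intervalIntegrable _ _)
      (hf.stronglyMeasurableAtFilter _ _) hf.continuousAt
  have h0 : (fun x => ∫ y in (0 : ℝ)..x, f y) = fun _ => 0 := by
    refine Continuous.ext_on Rat.isDenseEmbedding_coe_real.dense
      (continuous_iff_continuousAt.2 fun x => (hd x).continuousAt) continuous_const ?_
    rintro _ ⟨b, rfl⟩
    simp only [intervalIntegral.intervalIntegral_eq_integral_uIoc, h, smul_zero]
  have := hd y
  rw [h0] at this
  exact this.unique (hasDerivAt_const y 0)

/-- `IsResolvent` determines the operator, so the kernels agree when tested on indicators of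
rational intervals. Continuity removes the exceptional null sets, first in `y`, then in `x`. -/
lemma IsGreensFunction.unique {κ : ℝ} {q : 𝓢(ℝ, ℝ)} {G₁ G₂ : ℝ → ℝ → ℝ}
    (h₁ : IsGreensFunction κ q G₁) (h₂ : IsGreensFunction κ q G₂) : G₁ = G₂ := by
  obtain ⟨c₁, R₁, hR₁, k₁⟩ := h₁
  obtain ⟨c₂, R₂, hR₂, k₂⟩ := h₂
  have hR : ∀ f, R₁ f = R₂ f := fun f => (hR₁ _ _).2 ((hR₂ _ _).1 rfl)
  have key : ∀ b : ℚ, ∀ᵐ x : ℝ, ∫ y in uIoc (0 : ℝ) b, ((G₁ x y - G₂ x y : ℝ) : ℂ) = 0 := by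
    intro b
    have hmem : MemLp ((uIoc (0 : ℝ) b).indicator fun _ => (1 : ℂ)) 2 :=
      memLp_indicator_const 2 measurableSet_uIoc 1 (Or.inr (by simp [uIoc]))
    filter_upwards [(k₁ (hmem.toLp _)).1, (k₁ (hmem.toLp _)).2, (k₂ (hmem.toLp _)).1,
      (k₂ (hmem.toLp _)).2] with x i₁ e₁ i₂ e₂
    rw [hR, e₂] at e₁
    rw [← integral_indicator measurableSet_uIoc, ← sub_eq_zero.2 e₁.symm, ← integral_sub i₁ i₂]
    refine integral_congr_ae ?_
    filter_upwards [hmem.coeFn_toLp] with y hy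
    rw [hy]
    by_cases hyb : y ∈ uIoc (0 : ℝ) b <;> simp [hyb]
  have hx : ∀ᵐ x : ℝ, ∀ y, G₁ x y = G₂ x y := by
    filter_upwards [ae_all_iff.2 key] with x hx y
    have hc : Continuous fun y => ((G₁ x y - G₂ x y : ℝ) : ℂ) :=
      Complex.continuous_ofReal.comp ((c₁.comp (Continuous.prodMk_right x)).sub
        (c₂.comp (Continuous.prodMk_right x)))
    have := eq_zero_of_setIntegral_uIoc_eq_zero hc hx y
    exact sub_eq_zero.1 (by exact_mod_cast this)
  have hdense : Dense {x : ℝ | ∀ y, G₁ x y = G₂ x y} := Measure.dense_of_ae hx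
  funext x y
  have := Continuous.ext_on hdense (c₁.comp (Continuous.prodMk_left y))
    (c₂.comp (Continuous.prodMk_left y)) fun x hx => hx y
  exact congrFun this x

/-! ### Reflection -/

/-- The reflected potential `q(-x)`. -/
def reflect (q : 𝓢(ℝ, ℝ)) : 𝓢(ℝ, ℝ) :=
  SchwartzMap.compCLMOfContinuousLinearEquiv ℝ (ContinuousLinearEquiv.neg ℝ) q

lemma reflect_apply (q : 𝓢(ℝ, ℝ)) (x : ℝ) : reflect q x = q (-x) := rfl

lemma coe_reflect (q : 𝓢(ℝ, ℝ)) : (reflect q : ℝ → ℝ) = fun x => q (-x) := rfl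

lemma continuous_reflect : Continuous reflect :=
  (SchwartzMap.compCLMOfContinuousLinearEquiv ℝ (ContinuousLinearEquiv.neg ℝ)).continuous

lemma deriv_reflect (q : 𝓢(ℝ, ℝ)) (x : ℝ) : deriv (reflect q) x = -deriv q (-x) := by
  rw [coe_reflect, deriv_comp_neg]

lemma kdvField_reflect (q : 𝓢(ℝ, ℝ)) (x : ℝ) : kdvField (reflect q) x = -kdvField q (-x) := by
  have h : iteratedDeriv 3 (reflect q) x = -iteratedDeriv 3 q (-x) := by
    rw [coe_reflect, iteratedDeriv_comp_neg]; norm_num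
  rw [kdvField, h, deriv_reflect, reflect_apply, kdvField]; ring

/-- The KdV equation is invariant under `(t, x) ↦ (-t, -x)`. -/
lemma IsSchwartzSolution.reflect {q : ℝ → 𝓢(ℝ, ℝ)} (hq : IsSchwartzSolution q) :
    IsSchwartzSolution fun t => KdV.reflect (q (-t)) := by
  refine ⟨continuous_reflect.comp (hq.continuous.comp continuous_neg), fun t x => ?_⟩
  have h1 : HasDerivAt (fun s => q s (-x)) (kdvField (q (-t)) (-x)) (-t) := hq.equation (-t) (-x)
  have h2 := h1.comp t (hasDerivAt_neg t)
  refine h2.congr_deriv ?_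
  change _ = kdvField (KdV.reflect (q (-t))) x
  rw [kdvField_reflect]; ring

lemma fourierHat_reflect (q : 𝓢(ℝ, ℝ)) (ξ : ℝ) : fourierHat (reflect q) ξ = fourierHat q (-ξ) := by
  rw [fourierHat, fourierHat, ← integral_neg_eq_self]
  congr 2; funext x
  rw [reflect_apply]; simp

lemma hNegOneNorm_reflect (q : 𝓢(ℝ, ℝ)) : hNegOneNorm (reflect q) = hNegOneNorm q := by
  rw [hNegOneNorm, hNegOneNorm, ← integral_neg_eq_self]
  simp [fourierHat_reflect]

/-! ### The Jost solution at `-∞` and the Wronskian -/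

/-- The normalized Jost solution at `-∞`: `e^{κx} m(x)` solves the equation and `m → 1` at `-∞`. -/
def jostLeft (κ : ℝ) (q : 𝓢(ℝ, ℝ)) (x : ℝ) : ℝ := jost κ (reflect q) (-x)

/-- The derivative of `jostLeft`. -/
def jostLeftDeriv (κ : ℝ) (q : 𝓢(ℝ, ℝ)) (x : ℝ) : ℝ := -jostDeriv κ (reflect q) (-x)

section Left

variable {κ : ℝ} (hκ : 1 ≤ κ) (q : 𝓢(ℝ, ℝ))

include hκ in
lemma hasDerivAt_jostLeft (x : ℝ) : HasDerivAt (jostLeft κ q) (jostLeftDeriv κ q x) x :=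
  ((hasDerivAt_jost hκ (reflect q) (-x)).comp x (hasDerivAt_neg x)).congr_deriv
    (by simp [jostLeftDeriv])

include hκ in
lemma hasDerivAt_jostLeftDeriv (x : ℝ) :
    HasDerivAt (jostLeftDeriv κ q) (-2 * κ * jostLeftDeriv κ q x + q x * jostLeft κ q x) x :=
  ((hasDerivAt_jostDeriv hκ (reflect q) (-x)).comp x (hasDerivAt_neg x)).neg.congr_deriv
    (by simp only [jostLeftDeriv, jostLeft, reflect_apply, neg_neg]; ring)

include hκ in
lemma hasQuadDecay_jostLeftDeriv : HasQuadDecay (jostLeftDeriv κ q) :=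
  HasQuadDecay.neg (HasQuadDecay.comp_neg ⟨_, quadDecay_jostDeriv hκ (reflect q)⟩)

include hκ in
lemma hasQuadDecay_jostDeriv : HasQuadDecay (jostDeriv κ q) := ⟨_, quadDecay_jostDeriv hκ q⟩

include hκ in
lemma tendsto_jostLeft_atBot : Tendsto (jostLeft κ q) atBot (𝓝 1) :=
  (tendsto_jost_atTop hκ (reflect q)).comp tendsto_neg_atBot_atTop

include hκ in
lemma abs_jostLeft_le (x : ℝ) : |jostLeft κ q x| ≤ jostBound (reflect q) :=
  abs_jost_le hκ (reflect q) (-x)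

include hκ in
/-- The Wronskian identity. -/
lemma jost_wronskian (x : ℝ) : jost κ q x * jostLeftDeriv κ q x - jostDeriv κ q x * jostLeft κ q x +
    2 * κ * (jost κ q x * jostLeft κ q x) = 2 * κ * jostLim κ q := by
  have d1 := hasDerivAt_jost hκ q
  have d2 := hasDerivAt_jostDeriv hκ q
  have d3 := hasDerivAt_jostLeft hκ q
  have d4 := hasDerivAt_jostLeftDeriv hκ q
  have hd : ∀ x, HasDerivAt (fun x => jost κ q x * jostLeftDeriv κ q x -
      jostDeriv κ q x * jostLeft κ q x + 2 * κ * (jost κ q x * jostLeft κ q x)) 0 x := fun x =>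
    ((((d1 x).mul (d4 x)).sub ((d2 x).mul (d3 x))).add
      (((d1 x).mul (d3 x)).const_mul (2 * κ))).congr_deriv (by ring)
  -- The constant is evaluated at `-∞`, where both derivatives vanish and the left Jost solution
  -- tends to `1`.
  have hlim := (((tendsto_jost_atBot hκ q).mul (hasQuadDecay_jostLeftDeriv hκ q).tendsto_atBot).sub
    ((hasQuadDecay_jostDeriv hκ q).tendsto_atBot.mul (tendsto_jostLeft_atBot hκ q))).add
    (((tendsto_jost_atBot hκ q).mul (tendsto_jostLeft_atBot hκ q)).const_mul (2 * κ))
  have hc := fun y => is_const_of_deriv_eq_zero (fun z => (hd z).differentiableAt)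
    (fun z => (hd z).deriv) x y
  have := tendsto_nhds_unique (tendsto_const_nhds.congr hc) hlim
  simpa using this

/-- The solution of `-ψ'' + qψ = -κ²ψ` that decays at `+∞`. -/
def rightSol (κ : ℝ) (q : 𝓢(ℝ, ℝ)) (x : ℝ) : ℝ := Real.exp (-(κ * x)) * jost κ q x

/-- The derivative of `rightSol`. -/
def rightSolDeriv (κ : ℝ) (q : 𝓢(ℝ, ℝ)) (x : ℝ) : ℝ :=
  Real.exp (-(κ * x)) * (jostDeriv κ q x - κ * jost κ q x)

/-- The solution of `-ψ'' + qψ = -κ²ψ` that decays at `-∞`. -/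
def leftSol (κ : ℝ) (q : 𝓢(ℝ, ℝ)) (x : ℝ) : ℝ := Real.exp (κ * x) * jostLeft κ q x

/-- The derivative of `leftSol`. -/
def leftSolDeriv (κ : ℝ) (q : 𝓢(ℝ, ℝ)) (x : ℝ) : ℝ :=
  Real.exp (κ * x) * (jostLeftDeriv κ q x + κ * jostLeft κ q x)

lemma hasDerivAt_exp_neg_mul (κ x : ℝ) :
    HasDerivAt (fun x => Real.exp (-(κ * x))) (-κ * Real.exp (-(κ * x))) x :=
  (((hasDerivAt_id x).const_mul κ).neg.exp).congr_deriv (by simp [mul_comm])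

lemma hasDerivAt_exp_mul (κ x : ℝ) :
    HasDerivAt (fun x => Real.exp (κ * x)) (κ * Real.exp (κ * x)) x :=
  (((hasDerivAt_id x).const_mul κ).exp).congr_deriv (by simp [mul_comm])

include hκ in
lemma hasDerivAt_rightSol (x : ℝ) : HasDerivAt (rightSol κ q) (rightSolDeriv κ q x) x :=
  ((hasDerivAt_exp_neg_mul κ x).mul (hasDerivAt_jost hκ q x)).congr_deriv
    (by simp only [rightSolDeriv]; ring)

include hκ in
lemma hasDerivAt_rightSolDeriv (x : ℝ) :
    HasDerivAt (rightSolDeriv κ q) ((q x + κ ^ 2) * rightSol κ q x) x :=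
  ((hasDerivAt_exp_neg_mul κ x).mul ((hasDerivAt_jostDeriv hκ q x).sub
    ((hasDerivAt_jost hκ q x).const_mul κ))).congr_deriv
    (by simp only [rightSol, Pi.sub_apply]; ring)

include hκ in
lemma hasDerivAt_leftSol (x : ℝ) : HasDerivAt (leftSol κ q) (leftSolDeriv κ q x) x :=
  ((hasDerivAt_exp_mul κ x).mul (hasDerivAt_jostLeft hκ q x)).congr_deriv
    (by simp only [leftSolDeriv]; ring)

include hκ in
lemma hasDerivAt_leftSolDeriv (x : ℝ) :
    HasDerivAt (leftSolDeriv κ q) ((q x + κ ^ 2) * leftSol κ q x) x :=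
  ((hasDerivAt_exp_mul κ x).mul ((hasDerivAt_jostLeftDeriv hκ q x).add
    ((hasDerivAt_jostLeft hκ q x).const_mul κ))).congr_deriv
    (by simp only [leftSol, Pi.add_apply]; ring)

lemma exp_neg_mul_mul_exp_mul (κ x : ℝ) : Real.exp (-(κ * x)) * Real.exp (κ * x) = 1 := by
  rw [← Real.exp_add]; simp

lemma rightSol_mul_leftSol (x : ℝ) : rightSol κ q x * leftSol κ q x = jost κ q x * jostLeft κ q x := by
  rw [rightSol, leftSol]
  linear_combination (jost κ q x * jostLeft κ q x) * exp_neg_mul_mul_exp_mul κ x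

include hκ in
lemma wronskian (x : ℝ) : rightSol κ q x * leftSolDeriv κ q x - rightSolDeriv κ q x * leftSol κ q x =
    2 * κ * jostLim κ q := by
  rw [← jost_wronskian hκ q x]
  simp only [rightSol, leftSol, rightSolDeriv, leftSolDeriv]
  linear_combination (jost κ q x * (jostLeftDeriv κ q x + κ * jostLeft κ q x) -
    (jostDeriv κ q x - κ * jost κ q x) * jostLeft κ q x) * exp_neg_mul_mul_exp_mul κ x

/-! ### The Green's function -/

/-- The explicit Green's function. -/
def green (κ : ℝ) (q : 𝓢(ℝ, ℝ)) (x y : ℝ) : ℝ :=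
  (2 * κ * jostLim κ q)⁻¹ * (rightSol κ q (max x y) * leftSol κ q (min x y))

/-- The derivative of `green` in `x`. -/
def greenDeriv (κ : ℝ) (q : 𝓢(ℝ, ℝ)) (x y : ℝ) : ℝ :=
  (2 * κ * jostLim κ q)⁻¹ * (if y ≤ x then rightSolDeriv κ q x * leftSol κ q y
    else leftSolDeriv κ q x * rightSol κ q y)

include hκ in
lemma continuous_rightSol : Continuous (rightSol κ q) :=
  continuous_iff_continuousAt.2 fun x => (hasDerivAt_rightSol hκ q x).continuousAt

include hκ in
lemma continuous_leftSol : Continuous (leftSol κ q) :=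
  continuous_iff_continuousAt.2 fun x => (hasDerivAt_leftSol hκ q x).continuousAt

include hκ in
lemma continuous_rightSolDeriv : Continuous (rightSolDeriv κ q) :=
  continuous_iff_continuousAt.2 fun x => (hasDerivAt_rightSolDeriv hκ q x).continuousAt

include hκ in
lemma continuous_leftSolDeriv : Continuous (leftSolDeriv κ q) :=
  continuous_iff_continuousAt.2 fun x => (hasDerivAt_leftSolDeriv hκ q x).continuousAt

include hκ in
lemma continuous_green : Continuous fun p : ℝ × ℝ => green κ q p.1 p.2 :=
  continuous_const.mul (((continuous_rightSol hκ q).comp (continuous_fst.max continuous_snd)).mul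
    ((continuous_leftSol hκ q).comp (continuous_fst.min continuous_snd)))

include hκ in
lemma measurable_greenDeriv : Measurable (Function.uncurry (greenDeriv κ q)) := by
  have h1 := (continuous_rightSolDeriv hκ q).measurable
  have h2 := (continuous_leftSolDeriv hκ q).measurable
  have h3 := (continuous_rightSol hκ q).measurable
  have h4 := (continuous_leftSol hκ q).measurable
  refine Measurable.const_mul ?_ _
  exact Measurable.ite (measurableSet_le measurable_snd measurable_fst)
    ((h1.comp measurable_fst).mul (h4.comp measurable_snd))
    ((h2.comp measurable_fst).mul (h3.comp measurable_snd))

include hκ in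
lemma exp_mul_exp_le {x y : ℝ} (h : y ≤ x) :
    Real.exp (-(κ * x)) * Real.exp (κ * y) ≤ Real.exp (-|x - y|) := by
  rw [← Real.exp_add, abs_of_nonneg (by linarith)]
  exact Real.exp_le_exp.2 (by nlinarith)

include hκ in
lemma exists_green_bound : ∃ C, ∀ x y, |green κ q x y| ≤ C * Real.exp (-|x - y|) := by
  refine ⟨|(2 * κ * jostLim κ q)⁻¹| * (jostBound q * jostBound (reflect q)), fun x y => ?_⟩
  rw [green]
  generalize (2 * κ * jostLim κ q)⁻¹ = c
  rw [abs_mul, mul_assoc]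
  refine mul_le_mul_of_nonneg_left ?_ (abs_nonneg _)
  rw [rightSol, leftSol, show ∀ a b c d : ℝ, a * b * (c * d) = b * d * (a * c) from fun _ _ _ _ => by ring,
    abs_mul, abs_mul, abs_of_pos (mul_pos (Real.exp_pos _) (Real.exp_pos _))]
  have h1 := exp_mul_exp_le hκ (min_le_max (a := x) (b := y))
  rw [max_sub_min_eq_abs, abs_abs, abs_sub_comm] at h1
  have h2 := abs_jost_le hκ q (max x y)
  have h3 := abs_jostLeft_le hκ q (min x y)
  have h4 := (abs_nonneg _).trans h2
  have h5 := (abs_nonneg _).trans h3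
  have h6 := mul_nonneg h4 h5
  gcongr

include hκ in
lemma exists_greenDeriv_bound : ∃ C, ∀ x y, |greenDeriv κ q x y| ≤ C * Real.exp (-|x - y|) := by
  obtain ⟨D₁, hD₁⟩ := hasQuadDecay_jostDeriv hκ q
  obtain ⟨D₂, hD₂⟩ := hasQuadDecay_jostLeftDeriv hκ q
  have hκ0 : |κ| = κ := abs_of_pos (by linarith)
  set M := jostBound q
  set N := jostBound (reflect q)
  have hM : 0 ≤ M := (abs_nonneg _).trans (abs_jost_le hκ q 0)
  have hN : 0 ≤ N := (abs_nonneg _).trans (abs_jostLeft_le hκ q 0)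
  have hD₁0 := hD₁.nonneg
  have hD₂0 := hD₂.nonneg
  have hκ1 : 0 ≤ κ := by linarith
  refine ⟨|(2 * κ * jostLim κ q)⁻¹| * ((D₁ + κ * M) * N + (D₂ + κ * N) * M), fun x y => ?_⟩
  rw [greenDeriv]
  generalize (2 * κ * jostLim κ q)⁻¹ = c
  rw [abs_mul, mul_assoc]
  refine mul_le_mul_of_nonneg_left ?_ (abs_nonneg _)
  split_ifs with h
  · rw [rightSolDeriv, leftSol, show ∀ a b c d : ℝ, a * b * (c * d) = b * d * (a * c) from fun _ _ _ _ => by ring,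
      abs_mul, abs_mul, abs_of_pos (mul_pos (Real.exp_pos _) (Real.exp_pos _))]
    have h1 := exp_mul_exp_le hκ h
    have h2 : |jostDeriv κ q x - κ * jost κ q x| ≤ D₁ + κ * M := by
      refine (abs_sub _ _).trans (add_le_add (hD₁.abs_le x) ?_)
      rw [abs_mul, hκ0]
      exact mul_le_mul_of_nonneg_left (abs_jost_le hκ q x) hκ1
    have h3 := abs_jostLeft_le hκ q y
    calc _ ≤ (D₁ + κ * M) * N * Real.exp (-|x - y|) := by gcongr
      _ ≤ _ := by
        have h5 : 0 ≤ (D₂ + κ * N) * M := by positivity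
        exact mul_le_mul_of_nonneg_right (by linarith) (Real.exp_pos _).le
  · rw [leftSolDeriv, rightSol, show ∀ a b c d : ℝ, a * b * (c * d) = b * d * (c * a) from fun _ _ _ _ => by ring,
      abs_mul, abs_mul, abs_of_pos (mul_pos (Real.exp_pos _) (Real.exp_pos _))]
    have h1 := exp_mul_exp_le hκ (not_le.1 h).le
    rw [abs_sub_comm] at h1
    have h2 : |jostLeftDeriv κ q x + κ * jostLeft κ q x| ≤ D₂ + κ * N := by
      refine (abs_add_le _ _).trans (add_le_add (hD₂.abs_le x) ?_)
      rw [abs_mul, hκ0]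
      exact mul_le_mul_of_nonneg_left (abs_jostLeft_le hκ q x) hκ1
    have h3 := abs_jost_le hκ q y
    calc _ ≤ (D₂ + κ * N) * M * Real.exp (-|x - y|) := by gcongr
      _ ≤ _ := by
        have h5 : 0 ≤ (D₁ + κ * M) * N := by positivity
        exact mul_le_mul_of_nonneg_right (by linarith) (Real.exp_pos _).le

/-- `∫ G(x,y) f(y) dy`. -/
def greenInt (κ : ℝ) (q : 𝓢(ℝ, ℝ)) (f : ℝ → ℂ) (x : ℝ) : ℂ := ∫ y, (green κ q x y : ℂ) * f y

/-- `∫ ∂ₓG(x,y) f(y) dy`. -/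
def greenDerivInt (κ : ℝ) (q : 𝓢(ℝ, ℝ)) (f : ℝ → ℂ) (x : ℝ) : ℂ :=
  ∫ y, (greenDeriv κ q x y : ℂ) * f y

/-! ### The Green's operator on continuous functions of compact support -/

section TestFunction

variable {f : ℝ → ℂ} (hf : Continuous f) (hs : HasCompactSupport f)

lemma integral_split {A B : ℝ → ℂ} {k : ℝ → ℂ} (x : ℝ) (hA : Integrable A) (hB : Integrable B)
    (h1 : ∀ y ≤ x, k y = A y) (h2 : ∀ y, x < y → k y = B y) :
    ∫ y, k y = (∫ y in Iic x, A y) + ∫ y in Ioi x, B y := by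
  have e1 : EqOn k A (Iic x) := fun y hy => h1 y hy
  have e2 : EqOn k B (Ioi x) := fun y hy => h2 y hy
  rw [← setIntegral_congr_fun measurableSet_Iic e1, ← setIntegral_congr_fun measurableSet_Ioi e2,
    intervalIntegral.integral_Iic_add_Ioi (hA.integrableOn.congr_fun e1.symm measurableSet_Iic)
      (hB.integrableOn.congr_fun e2.symm measurableSet_Ioi)]

lemma hasDerivAt_integral_Iic {f : ℝ → ℂ} (hc : Continuous f) (hi : Integrable f) (x : ℝ) :
    HasDerivAt (fun a => ∫ y in Iic a, f y) (f x) x := by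
  have h : (fun a => ∫ y in Iic a, f y) = fun a => (∫ y, f y) - ∫ y in Ioi a, f y := by
    funext a
    rw [← intervalIntegral.integral_Iic_add_Ioi (b := a) hi.integrableOn hi.integrableOn]; ring
  rw [h]
  exact ((hasDerivAt_integral_Ioi hc (fun _ => hi.integrableOn) x).const_sub _).congr_deriv
    (neg_neg _)

include hf hs in
lemma integrable_ofReal_mul {r : ℝ → ℝ} (hr : Continuous r) : Integrable fun y => (r y : ℂ) * f y :=
  ((Complex.continuous_ofReal.comp hr).mul hf).integrable_of_hasCompactSupport hs.mul_left

include hκ hf hs in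
lemma greenInt_eq (x : ℝ) : greenInt κ q f x = (2 * κ * jostLim κ q : ℂ)⁻¹ *
    (rightSol κ q x * (∫ y in Iic x, (leftSol κ q y : ℂ) * f y) +
      leftSol κ q x * ∫ y in Ioi x, (rightSol κ q y : ℂ) * f y) := by
  have hl := integrable_ofReal_mul hf hs (continuous_leftSol hκ q)
  have hr := integrable_ofReal_mul hf hs (continuous_rightSol hκ q)
  rw [greenInt, integral_split x
    (A := fun y => (2 * κ * jostLim κ q : ℂ)⁻¹ * rightSol κ q x * (leftSol κ q y * f y))
    (B := fun y => (2 * κ * jostLim κ q : ℂ)⁻¹ * leftSol κ q x * (rightSol κ q y * f y))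
    (hl.const_mul _) (hr.const_mul _) (fun y hy => ?_) (fun y hy => ?_),
    integral_const_mul, integral_const_mul]
  · ring
  · rw [green, max_eq_left hy, min_eq_right hy]; push_cast; ring
  · rw [green, max_eq_right hy.le, min_eq_left hy.le]; push_cast; ring

include hκ hf hs in
lemma greenDerivInt_eq (x : ℝ) : greenDerivInt κ q f x = (2 * κ * jostLim κ q : ℂ)⁻¹ *
    (rightSolDeriv κ q x * (∫ y in Iic x, (leftSol κ q y : ℂ) * f y) +
      leftSolDeriv κ q x * ∫ y in Ioi x, (rightSol κ q y : ℂ) * f y) := by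
  have hl := integrable_ofReal_mul hf hs (continuous_leftSol hκ q)
  have hr := integrable_ofReal_mul hf hs (continuous_rightSol hκ q)
  rw [greenDerivInt, integral_split x
    (A := fun y => (2 * κ * jostLim κ q : ℂ)⁻¹ * rightSolDeriv κ q x * (leftSol κ q y * f y))
    (B := fun y => (2 * κ * jostLim κ q : ℂ)⁻¹ * leftSolDeriv κ q x * (rightSol κ q y * f y))
    (hl.const_mul _) (hr.const_mul _) (fun y hy => ?_) (fun y hy => ?_),
    integral_const_mul, integral_const_mul]
  · ring
  · rw [greenDeriv, if_pos hy]; push_cast; ring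
  · rw [greenDeriv, if_neg (not_le.2 hy)]; push_cast; ring

include hκ hf hs in
lemma hasDerivAt_greenInt (x : ℝ) :
    HasDerivAt (greenInt κ q f) (greenDerivInt κ q f x) x := by
  have hl := integrable_ofReal_mul hf hs (continuous_leftSol hκ q)
  have hr := integrable_ofReal_mul hf hs (continuous_rightSol hκ q)
  have cl : Continuous fun y => (leftSol κ q y : ℂ) * f y := by
    have := continuous_leftSol hκ q; fun_prop
  have cr : Continuous fun y => (rightSol κ q y : ℂ) * f y := by
    have := continuous_rightSol hκ q; fun_prop
  rw [funext (greenInt_eq hκ q hf hs), greenDerivInt_eq hκ q hf hs]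
  refine ((((hasDerivAt_rightSol hκ q x).ofReal_comp.mul (hasDerivAt_integral_Iic cl hl x)).add
    ((hasDerivAt_leftSol hκ q x).ofReal_comp.mul
      (hasDerivAt_integral_Ioi cr (fun _ => hr.integrableOn) x))).const_mul _).congr_deriv ?_
  ring

include hκ hf hs in
-- The boundary terms at `y = x`, which cancel in the first derivative, now leave minus the
-- Wronskian over `2κa` times `f`, that is `-f`.
lemma hasDerivAt_greenDerivInt (ha : jostLim κ q ≠ 0) (x : ℝ) :
    HasDerivAt (greenDerivInt κ q f) ((q x + κ ^ 2 : ℂ) * greenInt κ q f x - f x) x := by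
  have hl := integrable_ofReal_mul hf hs (continuous_leftSol hκ q)
  have hr := integrable_ofReal_mul hf hs (continuous_rightSol hκ q)
  have cl : Continuous fun y => (leftSol κ q y : ℂ) * f y := by
    have := continuous_leftSol hκ q; fun_prop
  have cr : Continuous fun y => (rightSol κ q y : ℂ) * f y := by
    have := continuous_rightSol hκ q; fun_prop
  rw [funext (greenDerivInt_eq hκ q hf hs), greenInt_eq hκ q hf hs]
  refine ((((hasDerivAt_rightSolDeriv hκ q x).ofReal_comp.mul
    (hasDerivAt_integral_Iic cl hl x)).add
    ((hasDerivAt_leftSolDeriv hκ q x).ofReal_comp.mul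
      (hasDerivAt_integral_Ioi cr (fun _ => hr.integrableOn) x))).const_mul _).congr_deriv ?_
  have hw : (rightSol κ q x * leftSolDeriv κ q x - rightSolDeriv κ q x * leftSol κ q x : ℂ) =
      2 * κ * jostLim κ q := by exact_mod_cast wronskian hκ q x
  have hne : (2 * κ * jostLim κ q : ℂ) ≠ 0 := by
    have : κ ≠ 0 := by linarith
    exact_mod_cast mul_ne_zero (mul_ne_zero two_ne_zero this) ha
  have hinv := inv_mul_cancel₀ hne
  push_cast
  linear_combination (-(2 * κ * jostLim κ q : ℂ)⁻¹ * f x) * hw - f x * hinv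

end TestFunction

include hκ in
-- Bootstrapping from the differential equation.
lemma contDiff_greenInt {f : ℝ → ℂ} (hf : ContDiff ℝ ∞ f) (hs : HasCompactSupport f)
    (ha : jostLim κ q ≠ 0) :
    ContDiff ℝ ∞ (greenInt κ q f) ∧ ContDiff ℝ ∞ (greenDerivInt κ q f) := by
  have d1 := hasDerivAt_greenInt hκ q hf.continuous hs
  have d2 := hasDerivAt_greenDerivInt hκ q hf.continuous hs ha
  have e1 : deriv (greenInt κ q f) = greenDerivInt κ q f := funext fun x => (d1 x).deriv
  have e2 : deriv (greenDerivInt κ q f) = fun x => (q x + κ ^ 2 : ℂ) * greenInt κ q f x - f x :=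
    funext fun x => (d2 x).deriv
  have key : ∀ n : ℕ, ContDiff ℝ n (greenInt κ q f) ∧ ContDiff ℝ n (greenDerivInt κ q f) := by
    intro n
    induction n with
    | zero =>
      exact ⟨contDiff_zero.2 (continuous_iff_continuousAt.2 fun x => (d1 x).continuousAt),
        contDiff_zero.2 (continuous_iff_continuousAt.2 fun x => (d2 x).continuousAt)⟩
    | succ n ih =>
      have hqn : ContDiff ℝ n fun x => (q x : ℂ) := Complex.ofRealCLM.contDiff.comp (q.smooth n)
      have hfn : ContDiff ℝ n f := hf.of_le (by exact_mod_cast le_top)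
      constructor
      · push_cast
        rw [contDiff_succ_iff_deriv]
        refine ⟨fun x => (d1 x).differentiableAt, by simp, ?_⟩
        rw [e1]; exact ih.2
      · push_cast
        rw [contDiff_succ_iff_deriv]
        refine ⟨fun x => (d2 x).differentiableAt, by simp, ?_⟩
        rw [e2]
        exact ((hqn.add contDiff_const).mul ih.1).sub hfn
  exact ⟨contDiff_infty.2 fun n => (key n).1, contDiff_infty.2 fun n => (key n).2⟩

end Left

/-! ### The Green's function is the kernel of the resolvent -/

section Resolvent

variable {κ : ℝ} (hκ : 1 ≤ κ) (q : 𝓢(ℝ, ℝ))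

lemma memLp_mul_schwartz {v : ℝ → ℂ} (hv : MemLp v 2) (c : ℂ) :
    MemLp (fun x => (q x + c) * v x) 2 := by
  refine hv.of_le_mul (c := decayNorm 0 q + ‖c‖) ?_ (Eventually.of_forall fun x => ?_)
  · refine AEStronglyMeasurable.mul (Continuous.aestronglyMeasurable ?_) hv.1
    have := q.continuous; fun_prop
  · rw [norm_mul]
    refine mul_le_mul_of_nonneg_right ((norm_add_le _ _).trans (add_le_add ?_ le_rfl))
      (norm_nonneg _)
    rw [Complex.norm_real]
    exact (quadDecay q).abs_le x

lemma HasWeakDeriv.conj_integral_eq {w w' : L2} (h : HasWeakDeriv w w') {φ : ℝ → ℂ}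
    (hφ : ContDiff ℝ ∞ φ) (h1 : MemLp φ 2) (h2 : MemLp (deriv φ) 2) :
    ∫ x, deriv φ x * conj (w x) = -∫ x, φ x * conj (w' x) := by
  have hd : ∀ x, deriv (fun x => conj (φ x)) x = conj (deriv φ x) := fun x =>
    ((hφ.differentiable (by simp) x).hasDerivAt.star).deriv
  have hc : ContDiff ℝ ∞ fun x => conj (φ x) := Complex.conjCLE.contDiff.comp hφ
  have h3 := h.integral_eq hc (MemLp_conj h1) (by rw [funext hd]; exact MemLp_conj h2)
  have h4 := congrArg conj h3
  rw [map_neg, ← integral_conj, ← integral_conj] at h4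
  simp only [hd, map_mul, Complex.conj_conj] at h4
  simpa only [mul_comm] using h4

include hκ in
/-- The operators with kernels `G` and `∂ₓG`. -/
lemma exists_green_operators (ha : jostLim κ q ≠ 0) : ∃ R R' : L2 →L[ℂ] L2,
    (∀ f : L2, R f =ᵐ[volume] greenInt κ q f) ∧ (∀ f : L2, HasWeakDeriv (R f) (R' f)) ∧
    ∀ f w w' : L2, HasWeakDeriv w w' →
      ∫ x, (R' f x * conj (w' x) + (q x + (κ ^ 2 : ℝ) : ℂ) * R f x * conj (w x)) =
        ∫ x, f x * conj (w x) := by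
  obtain ⟨C, hC⟩ := exists_green_bound hκ q
  obtain ⟨C', hC'⟩ := exists_greenDeriv_bound hκ q
  obtain ⟨R, hR⟩ := exists_kernel_operator (k := green κ q) (continuous_green hκ q).measurable hC
  obtain ⟨R', hR'⟩ := exists_kernel_operator (measurable_greenDeriv hκ q) hC'
  have hcongr : ∀ (f : L2) (g : ℝ → ℂ), f =ᵐ[volume] g →
      R f =ᵐ[volume] greenInt κ q g ∧ R' f =ᵐ[volume] greenDerivInt κ q g := fun f g hfg => by
    constructor
    · filter_upwards [hR f] with x hx
      rw [hx, greenInt]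
      exact integral_congr_ae (hfg.mono fun y hy => by simp only [hy])
    · filter_upwards [hR' f] with x hx
      rw [hx, greenDerivInt]
      exact integral_congr_ae (hfg.mono fun y hy => by simp only [hy])
  have hdense := Lp.dense_hasCompactSupport_contDiff (E := ℝ) (F := ℂ) (μ := volume) (p := 2)
    ENNReal.ofNat_ne_top
  refine ⟨R, R', hR, fun f φ hφ hφs => ?_, fun f w w' hw => ?_⟩
  · have m1 : MemLp (deriv φ) 2 :=
      (hφ.continuous_deriv (by simp)).memLp_of_hasCompactSupport hφs.deriv
    have m2 : MemLp φ 2 := hφ.continuous.memLp_of_hasCompactSupport hφs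
    -- Both sides are continuous in `f`, so a smooth compactly supported `f` suffices, and for it
    -- the derivatives are classical.
    have c1 := (continuous_integral_mul m1).comp R.continuous
    have c2 := ((continuous_integral_mul m2).comp R'.continuous).neg
    refine congrFun (Continuous.ext_on hdense c1 c2 ?_) f
    rintro f ⟨g, hfg, hgs, hg⟩
    obtain ⟨e1, e2⟩ := hcongr f g hfg
    have d1 := hasDerivAt_greenInt hκ q hg.continuous hgs
    have d2 := hasDerivAt_greenDerivInt hκ q hg.continuous hgs ha
    have hφd : ∀ x, HasDerivAt φ (deriv φ x) x := fun x =>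
      (hφ.differentiable (by simp) x).hasDerivAt
    have k1 : ∫ x, R f x * deriv φ x = ∫ x, greenInt κ q g x * deriv φ x :=
      integral_congr_ae (e1.mono fun x hx => by simp only [hx])
    have k2 : ∫ x, R' f x * φ x = ∫ x, greenDerivInt κ q g x * φ x :=
      integral_congr_ae (e2.mono fun x hx => by simp only [hx])
    change ∫ x, R f x * deriv φ x = -∫ x, R' f x * φ x
    rw [k1, k2]
    have cu := continuous_iff_continuousAt.2 fun x => (d1 x).continuousAt
    have cu' := continuous_iff_continuousAt.2 fun x => (d2 x).continuousAt
    exact integral_mul_deriv_eq_deriv_mul_of_integrable (fun x _ => d1 x) (fun x _ => hφd x)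
      ((cu.mul (hφ.continuous_deriv (by simp))).integrable_of_hasCompactSupport hφs.deriv.mul_left)
      ((cu'.mul hφ.continuous).integrable_of_hasCompactSupport hφs.mul_left)
      ((cu.mul hφ.continuous).integrable_of_hasCompactSupport hφs.mul_left)
  · have mw := MemLp_conj (Lp.memLp w)
    have mw' := MemLp_conj (Lp.memLp w')
    have mqw := memLp_mul_schwartz q mw (κ ^ 2 : ℝ)
    have split : ∀ f : L2, ∫ x, (R' f x * conj (w' x) + (q x + (κ ^ 2 : ℝ) : ℂ) * R f x * conj (w x)) =
        (∫ x, R' f x * conj (w' x)) + ∫ x, R f x * ((q x + (κ ^ 2 : ℝ)) * conj (w x)) := fun f => by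
      rw [← integral_add (integrable_mul_of_memLp (Lp.memLp _) mw')
        (integrable_mul_of_memLp (Lp.memLp _) mqw)]
      congr 1; funext x; ring
    rw [split]
    have c1 := ((continuous_integral_mul mw').comp R'.continuous).add
      ((continuous_integral_mul mqw).comp R.continuous)
    refine congrFun (Continuous.ext_on hdense c1 (continuous_integral_mul mw) ?_) f
    rintro f ⟨g, hfg, hgs, hg⟩
    obtain ⟨e1, e2⟩ := hcongr f g hfg
    have d2 := hasDerivAt_greenDerivInt hκ q hg.continuous hgs ha
    have hd : deriv (greenDerivInt κ q g) = fun x => (q x + (κ ^ 2 : ℝ) : ℂ) * greenInt κ q g x - g x :=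
      funext fun x => by rw [(d2 x).deriv]; push_cast; rfl
    have mu : MemLp (greenInt κ q g) 2 := (memLp_congr_ae e1).1 (Lp.memLp _)
    have mu' : MemLp (greenDerivInt κ q g) 2 := (memLp_congr_ae e2).1 (Lp.memLp _)
    have mg : MemLp g 2 := hg.continuous.memLp_of_hasCompactSupport hgs
    have mu'' : MemLp (deriv (greenDerivInt κ q g)) 2 := by
      rw [hd]; exact (memLp_mul_schwartz q mu _).sub mg
    -- The roles are exchanged: the smooth function `greenDerivInt κ q g` is the test function for
    -- the weak derivative of `w`.
    have key := hw.conj_integral_eq (contDiff_greenInt hκ q hg hgs ha).2 mu' mu''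
    have k1 : ∫ x, R' f x * conj (w' x) = ∫ x, greenDerivInt κ q g x * conj (w' x) :=
      integral_congr_ae (e2.mono fun x hx => by simp only [hx])
    have k2 : ∫ x, R f x * ((q x + (κ ^ 2 : ℝ)) * conj (w x)) =
        ∫ x, greenInt κ q g x * ((q x + (κ ^ 2 : ℝ)) * conj (w x)) :=
      integral_congr_ae (e1.mono fun x hx => by simp only [hx])
    have k3 : ∫ x, f x * conj (w x) = ∫ x, g x * conj (w x) :=
      integral_congr_ae (hfg.mono fun x hx => by simp only [hx])
    change (∫ x, R' f x * conj (w' x)) + (∫ x, R f x * ((q x + (κ ^ 2 : ℝ)) * conj (w x))) =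
      ∫ x, f x * conj (w x)
    rw [k1, k2, k3, ← neg_eq_iff_eq_neg.2 key, neg_add_eq_sub, ← integral_sub
      (integrable_mul_of_memLp mu mqw) (integrable_mul_of_memLp mu'' mw)]
    congr 1; funext x
    rw [hd]; ring

/-- The weak form of the graph relation. -/
lemma schrodingerGraph_iff {u f : L2} :
    SchrodingerGraph q u (f - ((κ ^ 2 : ℝ) : ℂ) • u) ↔ ∃ u' : L2, HasWeakDeriv u u' ∧
      ∀ v v' : L2, HasWeakDeriv v v' →
        ∫ x, (u' x * conj (v' x) + (q x + (κ ^ 2 : ℝ) : ℂ) * u x * conj (v x)) =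
          ∫ x, f x * conj (v x) := by
  refine exists_congr fun u' => and_congr_right fun _ => forall₃_congr fun v v' _ => ?_
  have mv := MemLp_conj (Lp.memLp v)
  have mv' := MemLp_conj (Lp.memLp v')
  have mqv := memLp_mul_schwartz q mv 0
  have i1 := integrable_mul_of_memLp (Lp.memLp u') mv'
  have i2 : Integrable fun x => (q x : ℂ) * u x * conj (v x) := by
    refine (integrable_mul_of_memLp (Lp.memLp u) mqv).congr (Eventually.of_forall fun x => ?_)
    simp only; ring
  have i3 := (integrable_mul_of_memLp (Lp.memLp u) mv).const_mul ((κ ^ 2 : ℝ) : ℂ)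
  have i4 := integrable_mul_of_memLp (Lp.memLp f) mv
  have e1 : ∫ x, (f - ((κ ^ 2 : ℝ) : ℂ) • u) x * conj (v x) =
      (∫ x, f x * conj (v x)) - ∫ x, ((κ ^ 2 : ℝ) : ℂ) * (u x * conj (v x)) := by
    rw [← integral_sub i4 i3]
    refine integral_congr_ae ?_
    filter_upwards [Lp.coeFn_sub f (((κ ^ 2 : ℝ) : ℂ) • u), Lp.coeFn_smul ((κ ^ 2 : ℝ) : ℂ) u]
      with x h1 h2
    rw [h1, Pi.sub_apply, h2, Pi.smul_apply, smul_eq_mul]; ring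
  have e2 : ∫ x, (u' x * conj (v' x) + (q x + (κ ^ 2 : ℝ) : ℂ) * u x * conj (v x)) =
      (∫ x, (u' x * conj (v' x) + (q x : ℂ) * u x * conj (v x))) +
        ∫ x, ((κ ^ 2 : ℝ) : ℂ) * (u x * conj (v x)) := by
    rw [← integral_add (f := fun x => u' x * conj (v' x) + (q x : ℂ) * u x * conj (v x))
      (i1.add i2) i3]
    congr 1; funext x; ring
  rw [e1, e2]
  exact eq_sub_iff_add_eq

include hκ in
-- That `R f` is a solution is `exists_green_operators`. For uniqueness, test the equation of any
-- solution `v` with `R p` and use the symmetry of the form: `⟨p, v⟩` is then expressed through `f`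
-- and `R p` alone.
lemma isGreensFunction_green (ha : jostLim κ q ≠ 0) : IsGreensFunction κ q (green κ q) := by
  obtain ⟨C, hC⟩ := exists_green_bound hκ q
  obtain ⟨R, R', hR, hw, hgraph⟩ := exists_green_operators hκ q ha
  refine ⟨continuous_green hκ q, R, fun u f => ⟨?_, fun h => ?_⟩, fun f => ⟨?_, hR f⟩⟩
  · rintro rfl
    exact (schrodingerGraph_iff q).2 ⟨R' f, hw f, hgraph f⟩
  · have key : ∀ v : L2, SchrodingerGraph q v (f - ((κ ^ 2 : ℝ) : ℂ) • v) →
        ∀ p : L2, inner ℂ p v = ∫ x, f x * conj (R p x) := by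
      intro v hv p
      obtain ⟨v', hv', h1⟩ := (schrodingerGraph_iff q).1 hv
      rw [← h1 _ _ (hw p), L2.inner_def]
      have h2 := congrArg conj (hgraph p v v' hv')
      rw [← integral_conj, ← integral_conj] at h2
      simp only [map_add, map_mul, Complex.conj_conj, Complex.conj_ofReal] at h2
      refine Eq.trans ?_ (h2.symm.trans ?_)
      · congr 1; funext x
        rw [RCLike.inner_apply, mul_comm]
      · congr 1; funext x; ring
    exact ext_inner_left ℂ fun p => by
      rw [key u h, key (R f) ((schrodingerGraph_iff q).2 ⟨R' f, hw f, hgraph f⟩)]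
  · exact Eventually.of_forall fun x =>
      integrable_kernel_mul (k := green κ q) (continuous_green hκ q).measurable hC (Lp.memLp f) x

include hκ in
lemma existsUnique_isGreensFunction (ha : jostLim κ q ≠ 0) : ∃! G, IsGreensFunction κ q G :=
  ⟨green κ q, isGreensFunction_green hκ q ha, fun _ h => h.unique (isGreensFunction_green hκ q ha)⟩

include hκ in
lemma g_eq (ha : jostLim κ q ≠ 0) (x : ℝ) :
    g κ q x = jost κ q x * jostLeft κ q x / (2 * κ * jostLim κ q) := by
  have h : ∃ G, IsGreensFunction κ q G := ⟨_, isGreensFunction_green hκ q ha⟩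
  have h1 : greensFunction κ q = green κ q := by
    rw [greensFunction, dif_pos h]
    exact h.choose_spec.unique (isGreensFunction_green hκ q ha)
  rw [g, h1, green, max_self, min_self, rightSol_mul_leftSol, div_eq_inv_mul]

end Resolvent

/-! ### Convolution with `e^{-2κ|x|}` -/

section ExpConv

variable {κ : ℝ} (hκ : 1 ≤ κ) {f : ℝ → ℝ}

/-- The derivative of `expConv`. -/
def expConvDeriv (κ : ℝ) (f : ℝ → ℝ) (x : ℝ) : ℝ :=
  2 * κ * (expTail κ f x - expTail κ (fun y => f (-y)) (-x))

include hκ in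
lemma HasQuadDecay.expConv_eq (hf : HasQuadDecay f) (x : ℝ) :
    expConv κ f x = KdV.expTail κ f x + KdV.expTail κ (fun y => f (-y)) (-x) := by
  have hi : Integrable fun y => Real.exp (-(2 * κ * |x - y|)) * f y := by
    refine hf.integrable.norm.mono' (by have := hf.continuous; fun_prop)
      (Eventually.of_forall fun y => ?_)
    rw [norm_mul, Real.norm_eq_abs, Real.abs_exp]
    refine mul_le_of_le_one_left (norm_nonneg _) (Real.exp_le_one_iff.2 (neg_nonpos.2 ?_))
    have : 0 ≤ κ := by linarith
    positivity
  rw [expConv, ← intervalIntegral.integral_Iic_add_Ioi (b := x) hi.integrableOn hi.integrableOn,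
    add_comm]
  congr 1
  · refine setIntegral_congr_fun measurableSet_Ioi fun y hy => ?_
    rw [abs_sub_comm, abs_of_pos (sub_pos.2 hy)]
  · rw [KdV.expTail, ← integral_comp_neg_Iic]
    refine setIntegral_congr_fun measurableSet_Iic fun y hy => ?_
    simp only [neg_neg]
    rw [abs_of_nonneg (sub_nonneg.2 hy)]
    ring_nf

include hκ in
lemma HasQuadDecay.hasDerivAt_expConv (hf : HasQuadDecay f) (x : ℝ) :
    HasDerivAt (expConv κ f) (expConvDeriv κ f x) x := by
  rw [funext (hf.expConv_eq hκ)]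
  refine ((hf.hasDerivAt_expTail hκ x).add
    ((hf.comp_neg.hasDerivAt_expTail hκ (-x)).comp x (hasDerivAt_neg x))).congr_deriv ?_
  simp only [expConvDeriv, neg_neg]; ring

include hκ in
lemma HasQuadDecay.expConv (hf : HasQuadDecay f) : HasQuadDecay (expConv κ f) := by
  rw [funext (hf.expConv_eq hκ)]
  exact (hf.expTail hκ).add (hf.comp_neg.expTail hκ).comp_neg

include hκ in
lemma HasQuadDecay.integral_expTail (hf : HasQuadDecay f) :
    2 * κ * ∫ x, KdV.expTail κ f x = ∫ x, f x := by
  have hj := hf.expTail hκ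
  have h := integral_of_hasDerivAt_of_tendsto (hf.hasDerivAt_expTail hκ)
    ((hj.integrable.const_mul (2 * κ)).sub hf.integrable) hj.tendsto_atBot hj.tendsto_atTop
  rw [integral_sub (hj.integrable.const_mul (2 * κ)) hf.integrable, integral_const_mul] at h
  linarith

include hκ in
lemma HasQuadDecay.integral_expConv (hf : HasQuadDecay f) :
    κ * ∫ x, KdV.expConv κ f x = ∫ x, f x := by
  have h1 := hf.integral_expTail hκ
  have h2 := hf.comp_neg.integral_expTail hκ
  rw [integral_neg_eq_self f] at h2
  rw [funext (hf.expConv_eq hκ), integral_add (hf.expTail hκ).integrable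
    (hf.comp_neg.expTail hκ).comp_neg.integrable,
    integral_neg_eq_self (KdV.expTail κ fun y => f (-y))]
  linarith

lemma hasQuadDecay_sq (q : 𝓢(ℝ, ℝ)) : HasQuadDecay fun y => q y ^ 2 := by
  simpa only [sq] using (hasQuadDecay q).mul (hasQuadDecay q)

include hκ in
-- Polynomial division by `2κ - ∂`: `-∂³ = (2κ - ∂)(∂² + 2κ∂ + 4κ²) - 8κ³`, and `3∂ = -3(2κ - ∂) +
-- 6κ` acting on `q²`.
lemma expTail_kdvField (q : 𝓢(ℝ, ℝ)) (x : ℝ) : expTail κ (kdvField q) x =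
    -8 * κ ^ 3 * expTail κ q x + 4 * κ ^ 2 * q x + 2 * κ * deriv q x +
      6 * κ * expTail κ (fun y => q y ^ 2) x + iteratedDeriv 2 q x - 3 * q x ^ 2 := by
  have h0 := hasQuadDecay q
  have h2 := hasQuadDecay_sq q
  have hF : HasQuadDecay (kdvField q) := ⟨_, quadDecay_kdvField q⟩
  symm
  refine hF.eq_expTail hκ (j := fun x => -8 * κ ^ 3 * expTail κ q x + 4 * κ ^ 2 * q x +
    2 * κ * deriv q x + 6 * κ * expTail κ (fun y => q y ^ 2) x + iteratedDeriv 2 q x - 3 * q x ^ 2)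
    ?_ (fun x => ?_) x
  · exact ((((((h0.expTail hκ).const_mul _).add (h0.const_mul _)).add
      ((hasQuadDecay_deriv q).const_mul _)).add ((h2.expTail hκ).const_mul _)).add
      (hasQuadDecay_iteratedDeriv 2 q)).sub (h2.const_mul 3)
  · have d0 := hasDerivAt_schwartz q x
    exact (((((((h0.hasDerivAt_expTail hκ x).const_mul (-8 * κ ^ 3)).add (d0.const_mul (4 * κ ^ 2))).add
      ((hasDerivAt_deriv_schwartz q x).const_mul (2 * κ))).add
      ((h2.hasDerivAt_expTail hκ x).const_mul (6 * κ))).add (hasDerivAt_iteratedDeriv 2 q x)).sub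
      ((d0.pow 2).const_mul 3)).congr_deriv (by simp only [kdvField]; push_cast; ring)

include hκ in
-- Sum of the two one-sided formulas. The field is odd under reflection, so the local terms in `q`,
-- `q''` and `q²` cancel and those in `q'` double.
lemma expConv_kdvField (q : 𝓢(ℝ, ℝ)) (x : ℝ) : expConv κ (kdvField q) x =
    -4 * κ ^ 2 * expConvDeriv κ q x + 4 * κ * deriv q x +
      3 * expConvDeriv κ (fun y => q y ^ 2) x := by
  have hF : HasQuadDecay (kdvField q) := ⟨_, quadDecay_kdvField q⟩
  have h1 : expTail κ (fun y => kdvField q (-y)) (-x) = -expTail κ (kdvField (reflect q)) (-x) := by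
    have e := expTail_const_mul (κ := κ) (f := kdvField (reflect q)) (-1) (-x)
    rw [neg_one_mul] at e
    rw [← e]
    congr 1; funext y; rw [kdvField_reflect]; ring
  have h2 : iteratedDeriv 2 (reflect q) (-x) = iteratedDeriv 2 q x := by
    rw [coe_reflect, iteratedDeriv_comp_neg]; norm_num
  rw [hF.expConv_eq hκ, h1, expTail_kdvField hκ, expTail_kdvField hκ, h2, deriv_reflect,
    expConvDeriv, expConvDeriv, reflect_apply, neg_neg]
  simp only [coe_reflect]
  ring

include hκ in
lemma IsSchwartzSolution.hasDerivAt_expConv {q : ℝ → 𝓢(ℝ, ℝ)} (hq : IsSchwartzSolution q)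
    (t x : ℝ) : HasDerivAt (fun s => KdV.expConv κ (q s) x) (KdV.expConv κ (kdvField (q t)) x) t :=
  hq.hasDerivAt_integral_mul (w := fun y => Real.exp (-(2 * κ * |x - y|))) (by fun_prop)
    (fun y => by
      rw [Real.abs_exp, Real.exp_le_one_iff, neg_nonpos]
      have : 0 ≤ κ := by linarith
      positivity) t

end ExpConv

/-! ### The diagonal Green's function -/

section Diagonal

variable {κ : ℝ} (hκ : 1 ≤ κ) {q : 𝓢(ℝ, ℝ)}

/-- The derivative of the diagonal Green's function. -/
def gDeriv (κ : ℝ) (q : 𝓢(ℝ, ℝ)) (x : ℝ) : ℝ :=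
  (jostDeriv κ q x * jostLeft κ q x + jost κ q x * jostLeftDeriv κ q x) / (2 * κ * jostLim κ q)

include hκ in
lemma hasDerivAt_g (ha : jostLim κ q ≠ 0) (x : ℝ) : HasDerivAt (g κ q) (gDeriv κ q x) x := by
  rw [funext (g_eq hκ q ha)]
  exact ((hasDerivAt_jost hκ q x).mul (hasDerivAt_jostLeft hκ q x)).div_const _

variable (h : JostPos κ q) (h' : JostPos κ (reflect q))

include hκ h h' in
lemma g_pos (x : ℝ) : 0 < g κ q x := by
  rw [g_eq hκ q h.2.ne']
  exact div_pos (mul_pos (h.1 x) (h'.1 (-x))) (mul_pos (by linarith) h.2)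

include hκ h h' in
-- Divide the Wronskian identity by `2 m m₋`.
lemma rho_eq (x : ℝ) :
    rho κ q x = 1 / 2 * riccati κ q x + 1 / 2 * riccati κ (reflect q) (-x) + 1 / 2 * expConv κ q x := by
  have h1 : jost κ q x ≠ 0 := (h.1 x).ne'
  have h2 : jostLeft κ q x ≠ 0 := (h'.1 (-x)).ne'
  have h3 := jost_wronskian hκ q x
  have h4 : jostLim κ q ≠ 0 := h.2.ne'
  have h5 : κ ≠ 0 := by linarith
  have h6 : riccati κ (reflect q) (-x) = -(jostLeftDeriv κ q x / jostLeft κ q x) := by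
    simp only [riccati, jostLeftDeriv, jostLeft]; ring
  rw [rho, g_eq hκ q h4, h6, riccati]
  congr 1
  field_simp
  linear_combination h3

include hκ h h' in
lemma integrable_rho : Integrable (rho κ q) := by
  rw [funext (rho_eq hκ h h')]
  exact ((((hasQuadDecay_riccati hκ h).const_mul _).add
    ((hasQuadDecay_riccati hκ h').comp_neg.const_mul _)).add
    (((hasQuadDecay q).expConv hκ).const_mul _)).integrable

include hκ h h' in
lemma alpha_eq : alpha κ q = 1 / 2 * -Real.log (jostLim κ q) +
    1 / 2 * -Real.log (jostLim κ (reflect q)) + 1 / 2 * ((∫ x, q x) / κ) := by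
  have i1 := (hasQuadDecay_riccati hκ h).const_mul (1 / 2)
  have i2 := (hasQuadDecay_riccati hκ h').comp_neg.const_mul (1 / 2)
  have i3 := ((hasQuadDecay q).expConv hκ).const_mul (1 / 2)
  rw [alpha, funext (rho_eq hκ h h'), integral_add (i1.add i2).integrable i3.integrable,
    integral_add i1.integrable i2.integrable, integral_const_mul, integral_const_mul,
    integral_const_mul, integral_neg_eq_self (riccati κ (reflect q)), integral_riccati hκ h,
    integral_riccati hκ h', ← (hasQuadDecay q).integral_expConv hκ,
    mul_div_cancel_left₀ _ (by linarith : κ ≠ 0)]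

include hκ h h' in
lemma hasDerivAt_recipFlux (x : ℝ) : HasDerivAt (recipFlux κ q)
    ((deriv q x * g κ q x - q x * gDeriv κ q x + 2 * κ ^ 2 * gDeriv κ q x) / g κ q x ^ 2) x := by
  have hg := (g_pos hκ h h' x).ne'
  have dg := hasDerivAt_g hκ h.2.ne' x
  refine ((((hasDerivAt_schwartz q x).div dg hg).sub
    ((hasDerivAt_const x (2 * κ ^ 2)).div dg hg)).add_const (4 * κ ^ 3)).congr_deriv ?_
  field_simp
  ring

include hκ h h' in
lemma hasDerivAt_inv_two_mul_g (x : ℝ) :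
    HasDerivAt (fun x => 1 / (2 * g κ q x)) (-gDeriv κ q x / (2 * g κ q x ^ 2)) x := by
  have hg := (g_pos hκ h h' x).ne'
  refine ((hasDerivAt_const x (1 : ℝ)).div ((hasDerivAt_g hκ h.2.ne' x).const_mul 2)
    (mul_ne_zero two_ne_zero hg)).congr_deriv ?_
  field_simp
  ring

include hκ h h' in
lemma hasDerivAt_rho (x : ℝ) : HasDerivAt (rho κ q)
    (gDeriv κ q x / (2 * g κ q x ^ 2) + 1 / 2 * expConvDeriv κ q x) x :=
  (((hasDerivAt_inv_two_mul_g hκ h h' x).const_sub κ).add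
    (((hasQuadDecay q).hasDerivAt_expConv hκ x).const_mul (1 / 2))).congr_deriv (by ring)

include hκ h h' in
lemma hasDerivAt_rhoFlux (x : ℝ) : HasDerivAt (rhoFlux κ q)
    (3 / 2 * expConvDeriv κ (fun y => q y ^ 2) x + 2 * deriv q x * (κ - 1 / (2 * g κ q x)) +
      q x * gDeriv κ q x / g κ q x ^ 2 -
      4 * κ ^ 2 * (gDeriv κ q x / (2 * g κ q x ^ 2) + 1 / 2 * expConvDeriv κ q x)) x :=
  (((((hasQuadDecay_sq q).hasDerivAt_expConv hκ x).const_mul (3 / 2)).add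
    (((hasDerivAt_schwartz q x).const_mul 2).mul
      ((hasDerivAt_inv_two_mul_g hκ h h' x).const_sub κ))).sub
    ((hasDerivAt_rho hκ h h' x).const_mul (4 * κ ^ 2))).congr_deriv (by ring)

end Diagonal

/-! ### Evolution of the diagonal Green's function -/

namespace IsSchwartzSolution

variable {κ : ℝ} (hκ : 1 ≤ κ) {q : ℝ → 𝓢(ℝ, ℝ)} (hq : IsSchwartzSolution q)

include hκ hq in
-- Apply the evolution of `jost` to the solution reflected in space and time.
lemma hasDerivAt_jostLeft (t x : ℝ) : HasDerivAt (fun s => jostLeft κ (q s) x)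
    (-deriv (q t) x * jostLeft κ (q t) x + (2 * q t x - 4 * κ ^ 2) * jostLeftDeriv κ (q t) x +
      2 * κ * q t x * jostLeft κ (q t) x) t := by
  have h1 := (hq.reflect.hasDerivAt_jost hκ (-t) (-x)).comp t (hasDerivAt_neg t)
  simp only [Function.comp_def, neg_neg] at h1
  refine h1.congr_deriv ?_
  simp only [jostDot, deriv_reflect, reflect_apply, neg_neg, jostLeft, jostLeftDeriv]
  ring

include hκ hq in
lemma jostLim_reflect_eq (t : ℝ) :
    jostLim κ (KdV.reflect (q t)) = jostLim κ (KdV.reflect (q 0)) := by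
  simpa using hq.reflect.jostLim_eq hκ (-t)

include hκ hq in
lemma jostPos_reflect (h : JostPos κ (KdV.reflect (q 0))) (t : ℝ) :
    JostPos κ (KdV.reflect (q t)) := by
  simpa using hq.reflect.jostPos hκ (by simpa using h) (-t)

include hκ hq in
-- The denominator is constant in time, and the terms `∓2κq` of the two Jost evolutions cancel in
-- the product.
lemma hasDerivAt_g (h : JostPos κ (q 0)) (t x : ℝ) : HasDerivAt (fun s => g κ (q s) x)
    (-2 * deriv (q t) x * g κ (q t) x + 2 * q t x * gDeriv κ (q t) x
      - 4 * κ ^ 2 * gDeriv κ (q t) x) t := by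
  have hlim := hq.jostLim_eq hκ
  have e : (fun s => g κ (q s) x) =
      fun s => jost κ (q s) x * jostLeft κ (q s) x / (2 * κ * jostLim κ (q 0)) := funext fun s => by
    rw [g_eq hκ _ (by rw [hlim]; exact h.2.ne'), hlim]
  rw [e]
  refine (((hq.hasDerivAt_jost hκ t x).mul (hq.hasDerivAt_jostLeft hκ t x)).div_const _).congr_deriv ?_
  rw [g_eq hκ _ (by rw [hlim]; exact h.2.ne'), gDeriv]
  simp only [hlim t, jostDot]
  ring

variable (h : JostPos κ (q 0)) (h' : JostPos κ (KdV.reflect (q 0)))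

include hκ hq h h' in
lemma hasDerivAt_inv_two_mul_g (t x : ℝ) : HasDerivAt (fun s => 1 / (2 * g κ (q s) x))
    (deriv (recipFlux κ (q t)) x) t := by
  have p := hq.jostPos hκ h t
  have p' := hq.jostPos_reflect hκ h' t
  have hg := (g_pos hκ p p' x).ne'
  refine ((hasDerivAt_const t (1 : ℝ)).div ((hq.hasDerivAt_g hκ h t x).const_mul 2)
    (mul_ne_zero two_ne_zero hg)).congr_deriv ?_
  rw [(hasDerivAt_recipFlux hκ p p' x).deriv]
  field_simp
  ring

include hκ hq h h' in
lemma hasDerivAt_rho (t x : ℝ) : HasDerivAt (fun s => rho κ (q s) x)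
    (deriv (rhoFlux κ (q t)) x) t := by
  have p := hq.jostPos hκ h t
  have p' := hq.jostPos_reflect hκ h' t
  have hg := (g_pos hκ p p' x).ne'
  refine (((hq.hasDerivAt_inv_two_mul_g hκ h h' t x).const_sub κ).add
    ((hq.hasDerivAt_expConv hκ t x).const_mul (1 / 2))).congr_deriv ?_
  rw [(hasDerivAt_recipFlux hκ p p' x).deriv, (hasDerivAt_rhoFlux hκ p p' x).deriv,
    expConv_kdvField hκ]
  field_simp
  ring

include hκ hq h h' in
lemma alpha_eq (t : ℝ) : alpha κ (q t) = alpha κ (q 0) := by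
  rw [KdV.alpha_eq hκ (hq.jostPos hκ h t) (hq.jostPos_reflect hκ h' t), KdV.alpha_eq hκ h h',
    hq.jostLim_eq hκ, hq.jostLim_reflect_eq hκ, hq.integral_eq]

end IsSchwartzSolution

/-! ### Proof of the proposition -/

lemma jostPos_of_hNegOneNorm_le {κ : ℝ} (hκ : 1 ≤ κ) {q : 𝓢(ℝ, ℝ)}
    (h : hNegOneNorm q ≤ 1 / 6) : JostPos κ q := by
  rw [hNegOneNorm_eq, Real.sqrt_le_left (by norm_num)] at h
  exact (jostPos_of_small hκ (by linarith)).1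

end KdV

end

theorem proposition3p1 (δ : ℝ) (hδ : 0 < δ) :
    ∃ δ₀ : ℝ, 0 < δ₀ ∧ ∀ q : ℝ → 𝓢(ℝ, ℝ), KdV.IsSchwartzSolution q →
      KdV.hNegOneNorm (q 0) ≤ δ₀ →
      (∀ t : ℝ, KdV.hNegOneNorm (q t) ≤ δ) ∧
      ∀ κ : ℝ, 1 ≤ κ → ∀ t : ℝ,
        -- the objects are well defined
        (∃! G : ℝ → ℝ → ℝ, KdV.IsGreensFunction κ (q t) G) ∧
        (∀ x : ℝ, 0 < KdV.g κ (q t) x) ∧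
        Differentiable ℝ (KdV.g κ (q t)) ∧
        Integrable (KdV.rho κ (q t)) ∧
        -- evolution of `g`
        (∀ x : ℝ, HasDerivAt (fun s : ℝ => KdV.g κ (q s) x)
          (-2 * deriv (q t) x * KdV.g κ (q t) x + 2 * q t x * deriv (KdV.g κ (q t)) x
            - 4 * κ ^ 2 * deriv (KdV.g κ (q t)) x) t) ∧
        -- evolution of `1 / (2g)`
        Differentiable ℝ (KdV.recipFlux κ (q t)) ∧
        (∀ x : ℝ, HasDerivAt (fun s : ℝ => 1 / (2 * KdV.g κ (q s) x))
          (deriv (KdV.recipFlux κ (q t)) x) t) ∧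
        -- evolution of `ρ`
        Differentiable ℝ (KdV.rhoFlux κ (q t)) ∧
        (∀ x : ℝ, HasDerivAt (fun s : ℝ => KdV.rho κ (q s) x)
          (deriv (KdV.rhoFlux κ (q t)) x) t) ∧
        -- conservation of `α`
        HasDerivAt (fun s : ℝ => KdV.alpha κ (q s)) 0 t := by
  -- The `7` is the constant of the a priori bound; `1/6` gives `8‖q(0)‖² < 1/4`, the smallness
  -- required by `jostPos_of_small` for all `κ ≥ 1` at once.
  refine ⟨min (δ / 7) (1 / 6), by positivity, fun q hq h0 => ⟨fun t => ?_, fun κ hκ t => ?_⟩⟩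
  · have h1 := hq.hNegOneNorm_le (h0.trans (min_le_right _ _)) t
    have h2 := h0.trans (min_le_left _ _)
    linarith
  have h := KdV.jostPos_of_hNegOneNorm_le hκ (h0.trans (min_le_right _ _))
  have h' : KdV.JostPos κ (KdV.reflect (q 0)) := KdV.jostPos_of_hNegOneNorm_le hκ
    ((KdV.hNegOneNorm_reflect _).trans_le (h0.trans (min_le_right _ _)))
  have p := hq.jostPos hκ h t
  have p' := hq.jostPos_reflect hκ h' t
  have dg := KdV.hasDerivAt_g hκ p.2.ne'
  refine ⟨KdV.existsUnique_isGreensFunction hκ _ p.2.ne', KdV.g_pos hκ p p',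
    fun x => (dg x).differentiableAt, KdV.integrable_rho hκ p p', fun x => ?_,
    fun x => (KdV.hasDerivAt_recipFlux hκ p p' x).differentiableAt,
    hq.hasDerivAt_inv_two_mul_g hκ h h' t,
    fun x => (KdV.hasDerivAt_rhoFlux hκ p p' x).differentiableAt,
    hq.hasDerivAt_rho hκ h h' t, ?_⟩
  · rw [(dg x).deriv]
    exact hq.hasDerivAt_g hκ h t x
  · rw [funext (hq.alpha_eq hκ h h')]
    exact hasDerivAt_const _ _
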